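/- **Setting.** Let Minkowski space $\mathbb{R}^{1,3}$ have coordinates $(T,X,Y,Z)$ and metric $\langle\cdot,\cdot\rangle = dT^2-dX^2-dY^2-dZ^2$. It is identified with Hermitian $2\times2$ matrices by $(T,X,Y,Z)\leftrightarrow \frac12\begin{pmatrix}T+Z & X+iY\\ X-iY & T-Z\end{pmatrix}$, and $A\in SL(2,\mathbb{C})$ acts on it by $S\mapsto ASA^*$. Let $L^+=\{x:\langle x,x\rangle=0,\ T>0\}$ and $\mathbb{H}^3=\{x:\langle x,x\rangle=1,\ T>0\}$. The group $SL(2,\mathbb{C})$ acts linearly on $\mathbb{C}^2_*=\mathbb{C}^2\setminus\{0\}$, the space of nonzero spinors. * A *flag* consists of a point $p\in L^+$, a 2-plane $V$ with $\mathbb{R}p\subset V\subset p^\perp$, and an orientation of $V/\mathbb{R}p$. The set of flags is $\mathcal{F}$. For $v\in p^\perp\setminus\mathbb{R}p$, $[[p,v]]$ is the flag with $V=\mathrm{span}(p,v)$, oriented by $v$. * A *horosphere* is a set $\{x\in\mathbb{H}^3:\langle x,p\rangle=c\}$ with $p\in L^+$ and $c>0$; its centre is the ray of $p$. A *decoration*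 of a horosphere is an oriented tangent line field that is parallel, i.e. invariant under all parabolic isometries preserving the horosphere. It is directed by a unit tangent field $v$. The set of decorated horospheres is $\mathrm{Hor}^D$. * Let $\mathrm{Fr}\to\mathbb{H}^3$ be the bundle of right-handed orthonormal frames and $\mathrm{Fr}^S\to\mathrm{Fr}$ its connected double cover, the bundle of spin frames. A decoration $v$ of $H$, with $N^{out}$ the unit normal field of $H$ towards its centre and $N^{in}=-N^{out}$, gives two frame fields $(N^{out},v,N^{out}\times v)$ and $(N^{in},v,N^{in}\times v)$ along $H$. A *spin decoration* of $H$ is a decoration together with a pair $(W^{in},W^{out})$ of continuous lifts of the inward and outward frame fields to $\mathrm{Fr}^S$, such that $W^{in}$ is obtained from $W^{out}$ by rotating by angle $\pi$ about $v$ at each point. The set of spin-decorated horospheres is $\mathrm{Hor}^S$. * Let $\mathcal{F}^S\to\mathcal{F}$ be the connected double cover (spin flags). The group $SL(2,\mathbb{C})$ acts on $\mathcal{F}$, $\mathrm{Hor}^D$ and $\mathrm{Fr}$ through its action on $\mathbb{R}^{1,3}$. All these spaces carry their natural smooth structures. Define $\Phi_1:\mathbb{C}^2_*\to\mathcal{F}$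 by $\Phi_1(\kappa)=[[\phi_1(\kappa),D_\kappa\phi_1(Z\kappa)]]$, where $\phi_1(\kappa)=\kappa\kappa^*$ and $Z(\xi,\eta)=(i\bar\eta,-i\bar\xi)$. Let $\Phi_2$ send a flag with point $p$ and oriented plane $V$ to the horosphere $\{x\in\mathbb{H}^3:\langle x,p\rangle=1\}$ with the line field $q^\perp\cap V$ at each point $q$, oriented by $V/\mathbb{R}p$. **Theorem.** There is an explicit, smooth, bijective, $SL(2,\mathbb{C})$-equivariant correspondence between nonzero spinors and spin-decorated horospheres in $\mathbb{H}^3$. More precisely: 1. Connected double covers of $\mathrm{Fr}$ and of $\mathcal{F}$ exist. The map $\Phi_2$ takes values in $\mathrm{Hor}^D$. For any connected double covers $\mathrm{Fr}^S\to\mathrm{Fr}$ and $\mathcal{F}^S\to\mathcal{F}$, the forgetful map $\mathrm{Hor}^S\to\mathrm{Hor}^D$ is a connected double cover. 2. The $SL(2,\mathbb{C})$-actions on $\mathrm{Fr}$ and $\mathcal{F}$ lift uniquely to continuous actions on $\mathrm{Fr}^S$ and $\mathcal{F}^S$; the former induces an action on $\mathrm{Hor}^S$. 3. For every $\kappa_0\in\mathbb{C}^2_*$,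 every $f_0\in\mathcal{F}^S$ over $\Phi_1(\kappa_0)$ and every $h_0\in\mathrm{Hor}^S$ over $\Phi_2\Phi_1(\kappa_0)$, there is a unique pair of $SL(2,\mathbb{C})$-equivariant diffeomorphisms $$\mathbb{C}^2_*\xrightarrow{\ \widetilde{\Phi_1}\ }\mathcal{F}^S\xrightarrow{\ \widetilde{\Phi_2}\ }\mathrm{Hor}^S$$ that lift $\Phi_1$ and $\Phi_2$ and satisfy $\widetilde{\Phi_1}(\kappa_0)=f_0$ and $\widetilde{\Phi_2}(f_0)=h_0$. The correspondence is the $SL(2,\mathbb{C})$-equivariant diffeomorphism $\widetilde{\Phi_2}\circ\widetilde{\Phi_1}:\mathbb{C}^2_*\to\mathrm{Hor}^S$. -/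

import Mathlib

open Matrix Topology

noncomputable section

namespace SpinHor

/-! ### Minkowski space, Hermitian matrices, and the action of `SL(2,ℂ)` -/

/-- Minkowski space `ℝ^{1,3}`, with coordinates `(T, X, Y, Z)`. -/
abbrev Mink : Type := Fin 4 → ℝ

/-- The group `SL(2,ℂ)`. -/
abbrev SL2 : Type := SpecialLinearGroup (Fin 2) ℂ

/-- The metric `dT² - dX² - dY² - dZ²`. -/
def mink (x y : Mink) : ℝ := x 0 * y 0 - x 1 * y 1 - x 2 * y 2 - x 3 * y 3

/-- The Hermitian matrix `½ [[T + Z, X + iY], [X - iY, T - Z]]` of a point `(T, X, Y, Z)`. -/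
def toHerm (x : Mink) : Matrix (Fin 2) (Fin 2) ℂ :=
  !![((x 0 + x 3) / 2 : ℂ), (x 1 + x 2 * Complex.I) / 2;
     (x 1 - x 2 * Complex.I) / 2, (x 0 - x 3) / 2]

/-- The point of Minkowski space of a Hermitian matrix (inverse of `toHerm`). -/
def ofHerm (S : Matrix (Fin 2) (Fin 2) ℂ) : Mink :=
  ![(S 0 0 + S 1 1).re, 2 * (S 0 1).re, 2 * (S 0 1).im, (S 0 0 - S 1 1).re]

theorem ofHerm_toHerm (x : Mink) : ofHerm (toHerm x) = x := by
  ext i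
  fin_cases i <;> simp [ofHerm, toHerm] <;> ring

theorem toHerm_ofHerm {S : Matrix (Fin 2) (Fin 2) ℂ} (hS : S.IsHermitian) :
    toHerm (ofHerm S) = S := by
  have h00 := congrArg Complex.im (hS.apply 0 0)
  have h11 := congrArg Complex.im (hS.apply 1 1)
  have h10 := hS.apply 1 0
  have hr := congrArg Complex.re h10
  have hi := congrArg Complex.im h10
  simp at h00 h11 hr hi
  ext i j
  fin_cases i <;> fin_cases j <;> apply Complex.ext <;>
    simp [ofHerm, toHerm] <;> linarith

theorem isHermitian_toHerm (x : Mink) : (toHerm x).IsHermitian := by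
  ext i j
  fin_cases i <;> fin_cases j <;> simp [toHerm, sub_eq_add_neg]

/-- The action `S ↦ A S A*` of `SL(2,ℂ)` on Hermitian matrices, i.e. on Minkowski space. -/
def lorentz (A : SL2) : Mink →ₗ[ℝ] Mink where
  toFun x := ofHerm (A.1 * toHerm x * A.1ᴴ)
  map_add' x y := by
    have h : toHerm (x + y) = toHerm x + toHerm y := by
      ext i j
      fin_cases i <;> fin_cases j <;> simp [toHerm] <;> ring
    have h' (S S' : Matrix (Fin 2) (Fin 2) ℂ) : ofHerm (S + S') = ofHerm S + ofHerm S' := by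
      ext i
      fin_cases i <;> simp [ofHerm] <;> ring
    rw [h, mul_add, add_mul, h']
  map_smul' c x := by
    have h : toHerm (c • x) = (c : ℂ) • toHerm x := by
      ext i j
      fin_cases i <;> fin_cases j <;> simp [toHerm] <;> ring
    have h' (S : Matrix (Fin 2) (Fin 2) ℂ) : ofHerm ((c : ℂ) • S) = c • ofHerm S := by
      ext i
      fin_cases i <;> simp [ofHerm] <;> ring
    rw [h, mul_smul_comm, smul_mul_assoc, h']
    rfl

theorem lorentz_apply (A : SL2) (x : Mink) :
    lorentz A x = ofHerm (A.1 * toHerm x * A.1ᴴ) := rfl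

theorem toHerm_lorentz (A : SL2) (x : Mink) :
    toHerm (lorentz A x) = A.1 * toHerm x * A.1ᴴ :=
  toHerm_ofHerm (isHermitian_mul_mul_conjTranspose A.1 (isHermitian_toHerm x))

theorem lorentz_one (x : Mink) : lorentz 1 x = x := by
  simp [lorentz_apply, ofHerm_toHerm]

theorem lorentz_mul (A B : SL2) (x : Mink) :
    lorentz (A * B) x = lorentz A (lorentz B x) := by
  rw [lorentz_apply A, toHerm_lorentz, lorentz_apply]
  simp [conjTranspose_mul, Matrix.mul_assoc]

theorem lorentz_inv_lorentz (A : SL2) (x : Mink) : lorentz A⁻¹ (lorentz A x) = x := by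
  rw [← lorentz_mul, inv_mul_cancel, lorentz_one]

theorem lorentz_lorentz_inv (A : SL2) (x : Mink) : lorentz A (lorentz A⁻¹ x) = x := by
  rw [← lorentz_mul, mul_inv_cancel, lorentz_one]

theorem det_toHerm (x : Mink) : (toHerm x).det = ((mink x x / 4 : ℝ) : ℂ) := by
  rw [det_fin_two]
  apply Complex.ext <;> simp [toHerm, mink] <;> ring

theorem mink_lorentz_self (A : SL2) (x : Mink) :
    mink (lorentz A x) (lorentz A x) = mink x x := by
  have h := det_toHerm (lorentz A x)
  rw [toHerm_lorentz, det_mul, det_mul, det_conjTranspose, A.2, det_toHerm] at h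
  simp only [one_mul, star_one, mul_one, Complex.ofReal_inj] at h
  linarith

theorem mink_lorentz (A : SL2) (x y : Mink) :
    mink (lorentz A x) (lorentz A y) = mink x y := by
  have h (a b : Mink) : mink a b = (mink (a + b) (a + b) - mink a a - mink b b) / 2 := by
    simp [mink]; ring
  rw [h, ← map_add, mink_lorentz_self, mink_lorentz_self, mink_lorentz_self, ← h]

theorem mink_lorentz_left (A : SL2) (x y : Mink) :
    mink (lorentz A x) y = mink x (lorentz A⁻¹ y) := by
  conv_lhs => rw [← lorentz_lorentz_inv A y]
  exact mink_lorentz A _ _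

theorem mink_comm (x y : Mink) : mink x y = mink y x := by
  simp [mink]; ring

theorem mink_add_left (x y z : Mink) : mink (x + y) z = mink x z + mink y z := by
  simp [mink]; ring

theorem mink_smul_left (c : ℝ) (x z : Mink) : mink (c • x) z = c * mink x z := by
  simp [mink]; ring

/-- The action preserves the time orientation. -/
theorem lorentz_zero_pos (A : SL2) {x : Mink} (hx : 0 ≤ mink x x) (hx0 : 0 < x 0) :
    0 < lorentz A x 0 := by
  have hrow (r s : ℂ) : 0 ≤ (r * ((x 0 + x 3) / 2) * star r + r * ((x 1 + x 2 * Complex.I) / 2)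
      * star s + s * ((x 1 - x 2 * Complex.I) / 2) * star r
      + s * ((x 0 - x 3) / 2) * star s).re := by
    obtain ⟨a, b⟩ := r
    obtain ⟨c, d⟩ := s
    simp only [mink] at hx
    simp
    have hm : 0 ≤ x 0 + x 3 := by nlinarith [sq_nonneg (x 1), sq_nonneg (x 2)]
    rcases hm.eq_or_lt with h | h
    · have h1 : x 1 = 0 := by nlinarith [sq_nonneg (x 1), sq_nonneg (x 2)]
      have h2 : x 2 = 0 := by nlinarith [sq_nonneg (x 1), sq_nonneg (x 2)]
      have h3 : x 3 = - x 0 := by linarith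
      rw [h1, h2, h3]
      ring_nf
      positivity
    · have key : 0 ≤ (x 0 + x 3) * ((x 0 + x 3) * (a ^ 2 + b ^ 2)
          + (x 0 - x 3) * (c ^ 2 + d ^ 2)
          + 2 * (x 1 * (a * c + b * d) + x 2 * (a * d - b * c))) := by
        nlinarith [sq_nonneg ((x 0 + x 3) * a + x 1 * c + x 2 * d),
          sq_nonneg ((x 0 + x 3) * b + x 1 * d - x 2 * c),
          mul_nonneg hx (add_nonneg (sq_nonneg c) (sq_nonneg d))]
      have := nonneg_of_mul_nonneg_right key h
      nlinarith [this]
  have hnn : 0 ≤ lorentz A x 0 := by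
    have h0 := hrow (A.1 0 0) (A.1 0 1)
    have h1 := hrow (A.1 1 0) (A.1 1 1)
    have : lorentz A x 0 = _ := rfl
    rw [lorentz_apply]
    simp [ofHerm, toHerm, Matrix.mul_apply, Fin.sum_univ_two] at h0 h1 ⊢
    linarith
  rcases hnn.eq_or_lt with h | h
  · exfalso
    have hm := mink_lorentz_self A x
    have hz : lorentz A x = 0 := by
      simp only [mink] at hm hx
      ext i
      fin_cases i
      · exact h.symm
      · simp; nlinarith [sq_nonneg (lorentz A x 1), sq_nonneg (lorentz A x 2),
          sq_nonneg (lorentz A x 3)]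
      · simp; nlinarith [sq_nonneg (lorentz A x 1), sq_nonneg (lorentz A x 2),
          sq_nonneg (lorentz A x 3)]
      · simp; nlinarith [sq_nonneg (lorentz A x 1), sq_nonneg (lorentz A x 2),
          sq_nonneg (lorentz A x 3)]
    have := lorentz_inv_lorentz A x
    rw [hz, map_zero] at this
    rw [← this] at hx0
    simp at hx0
  · exact h

/-- The action preserves the orientation: `A` or `-A` is a square in `SL(2,ℂ)`. -/
theorem det_lorentz_pos (A : SL2) : 0 < LinearMap.det (lorentz A) := by
  have hne (B : SL2) : LinearMap.det (lorentz B) ≠ 0 := by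
    have h : lorentz B⁻¹ ∘ₗ lorentz B = LinearMap.id :=
      LinearMap.ext fun x => lorentz_inv_lorentz B x
    intro h0
    have := congrArg LinearMap.det h
    rw [LinearMap.det_comp, h0] at this
    simp at this
  have hsq (A : SL2) (hA : A.1.trace + 2 ≠ 0) : 0 < LinearMap.det (lorentz A) := by
    obtain ⟨s, hs⟩ := IsAlgClosed.exists_pow_nat_eq (A.1.trace + 2) (n := 2) (by norm_num)
    have hs0 : s ≠ 0 := by rintro rfl; apply hA; rw [← hs]; simp
    have hd : A.1 0 0 * A.1 1 1 - A.1 0 1 * A.1 1 0 = 1 := by rw [← det_fin_two]; exact A.2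
    rw [trace_fin_two] at hs
    have hB : (s⁻¹ • (A.1 + 1)).det = 1 := by
      rw [det_fin_two]
      simp
      field_simp
      linear_combination hd - hs
    let B : SL2 := ⟨_, hB⟩
    have hAB : A = B * B := by
      apply Subtype.ext
      change A.1 = (s⁻¹ • (A.1 + 1)) * (s⁻¹ • (A.1 + 1))
      ext i j
      fin_cases i <;> fin_cases j <;> simp [Matrix.mul_apply, Fin.sum_univ_two] <;>
        field_simp
      · linear_combination A.1 0 0 * hs + hd
      · linear_combination A.1 0 1 * hs
      · linear_combination A.1 1 0 * hs
      · linear_combination A.1 1 1 * hs + hd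
    have : lorentz A = lorentz B ∘ₗ lorentz B := by
      refine LinearMap.ext fun x => ?_
      conv_lhs => rw [hAB, lorentz_mul]
      rfl
    rw [this, LinearMap.det_comp]
    exact mul_self_pos.2 (hne _)
  by_cases hA : A.1.trace + 2 = 0
  · have hneg : lorentz (-A) = lorentz A := by
      refine LinearMap.ext fun x => ?_
      simp [lorentz_apply]
    rw [← hneg]
    apply hsq
    have h : (-A).1 = -A.1 := rfl
    rw [h, trace_neg]
    intro h'
    have : (4 : ℂ) = 0 := by linear_combination hA + h'
    norm_num at this
  · exact hsq A hA

/-! ### Spinors -/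

/-- `ℂ²` minus the origin. -/
abbrev Spinor : Type := {κ : Fin 2 → ℂ // κ ≠ 0}

/-- The action of `SL(2,ℂ)` on spinors by matrix multiplication. -/
def Spinor.act (A : SL2) (κ : Spinor) : Spinor :=
  ⟨A.1 *ᵥ κ.1, fun h => κ.2 <| by
    have h1 : (A⁻¹).1 *ᵥ (A.1 *ᵥ κ.1) = κ.1 := by
      have h2 : (A⁻¹).1 * A.1 = 1 := congrArg Subtype.val (inv_mul_cancel A)
      rw [mulVec_mulVec, h2, one_mulVec]
    rw [← h1, h, mulVec_zero]⟩

/-- The map `κ ↦ κ κ*`. -/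
def phi (κ : Fin 2 → ℂ) : Mink := ofHerm (vecMulVec κ (star κ))

/-- The direction `Z(ξ, η) = (i η̄, -i ξ̄)`. -/
def zdir (κ : Fin 2 → ℂ) : Fin 2 → ℂ :=
  ![Complex.I * star (κ 1), -Complex.I * star (κ 0)]

/-- The derivative of `κ ↦ κ κ*` at `κ` in the direction `Z κ`. -/
def dphi (κ : Fin 2 → ℂ) : Mink := lineDeriv ℝ phi κ (zdir κ)

theorem dphi_eq (κ : Fin 2 → ℂ) :
    dphi κ = ofHerm (vecMulVec κ (star (zdir κ)) + vecMulVec (zdir κ) (star κ)) := by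
  have h (t : ℝ) : phi (κ + t • zdir κ) = phi κ
      + t • ofHerm (vecMulVec κ (star (zdir κ)) + vecMulVec (zdir κ) (star κ))
      + t ^ 2 • phi (zdir κ) := by
    ext i
    fin_cases i <;> simp [phi, ofHerm, vecMulVec_apply] <;> ring
  unfold dphi lineDeriv
  simp_rw [h]
  have hd := (((hasDerivAt_id (0 : ℝ)).smul_const
      (ofHerm (vecMulVec κ (star (zdir κ)) + vecMulVec (zdir κ) (star κ)))).const_add
      (phi κ)).add (((hasDerivAt_id (0 : ℝ)).pow 2).smul_const (phi (zdir κ)))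
  refine Eq.trans hd.deriv ?_
  simp

theorem phi_coords (κ : Fin 2 → ℂ) : phi κ =
    ![(κ 0).re ^ 2 + (κ 0).im ^ 2 + (κ 1).re ^ 2 + (κ 1).im ^ 2,
      2 * ((κ 0).re * (κ 1).re + (κ 0).im * (κ 1).im),
      2 * ((κ 0).im * (κ 1).re - (κ 0).re * (κ 1).im),
      (κ 0).re ^ 2 + (κ 0).im ^ 2 - (κ 1).re ^ 2 - (κ 1).im ^ 2] := by
  ext i
  fin_cases i <;> simp [phi, ofHerm, vecMulVec_apply] <;> ring

theorem dphi_coords (κ : Fin 2 → ℂ) : dphi κ =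
    ![0, 4 * ((κ 1).re * (κ 1).im - (κ 0).re * (κ 0).im),
      2 * ((κ 0).re ^ 2 - (κ 0).im ^ 2 + (κ 1).re ^ 2 - (κ 1).im ^ 2),
      4 * ((κ 0).re * (κ 1).im + (κ 0).im * (κ 1).re)] := by
  rw [dphi_eq]
  have h0 : zdir κ 0 = Complex.I * star (κ 1) := rfl
  have h1 : zdir κ 1 = -Complex.I * star (κ 0) := rfl
  ext i
  fin_cases i <;>
    simp [ofHerm, vecMulVec_apply, Matrix.add_apply, h0, h1] <;> ring

/-! ### Light cone and pointed oriented null flags -/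

/-- The future light cone `L⁺`. -/
def LightCone : Set Mink := {x | mink x x = 0 ∧ 0 < x 0}

/-- A pointed oriented null flag: a point `p ∈ L⁺` and a 2-plane `V ∋ p` tangent to `L⁺` at `p`
(so `V ⊆ p^⊥`), with an orientation of the line `V / ℝp`. The orientation is recorded as the set
of all vectors of `V` that are positive modulo `ℝp`, an open half-plane bounded by `ℝp`. The
line `ℝp` carries the orientation from `0` towards `p`. -/
@[ext] structure NullFlag where
  pt : Mink
  plane : Submodule ℝ Mink
  pos : Set Mink
  pt_mem : pt ∈ LightCone
  finrank_plane : Module.finrank ℝ plane = 2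
  pt_mem_plane : pt ∈ plane
  tangent : ∀ w ∈ plane, mink w pt = 0
  pos_eq : ∃ v ∈ plane, v ∉ Submodule.span ℝ {pt} ∧
    pos = {w | ∃ a b : ℝ, 0 < b ∧ w = a • pt + b • v}

/-- Pairs of a point `p ∈ L⁺` and a vector `v` tangent to `L⁺` at `p` and independent of `p`. -/
def FlagPair : Type :=
  {x : Mink × Mink // x.1 ∈ LightCone ∧ mink x.2 x.1 = 0 ∧ x.2 ∉ Submodule.span ℝ {x.1}}

theorem LightCone.ne_zero {p : Mink} (hp : p ∈ LightCone) : p ≠ 0 := by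
  rintro rfl
  exact lt_irrefl _ hp.2

theorem lorentz_mem_lightCone (A : SL2) {p : Mink} (hp : p ∈ LightCone) :
    lorentz A p ∈ LightCone :=
  ⟨by rw [mink_lorentz_self]; exact hp.1, lorentz_zero_pos A hp.1.ge hp.2⟩

/-- The flag `[[p, v]]`. -/
def flagOf (x : FlagPair) : NullFlag where
  pt := x.1.1
  plane := Submodule.span ℝ {x.1.1, x.1.2}
  pos := {w | ∃ a b : ℝ, 0 < b ∧ w = a • x.1.1 + b • x.1.2}
  pt_mem := x.2.1
  finrank_plane := by
    have hli : LinearIndependent ℝ ![x.1.1, x.1.2] := by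
      rw [LinearIndependent.pair_iff' (LightCone.ne_zero x.2.1)]
      intro a ha
      exact x.2.2.2 (Submodule.mem_span_singleton.2 ⟨a, ha⟩)
    have := finrank_span_eq_card hli
    rwa [range_cons, range_cons, range_empty, Set.union_empty, Set.singleton_union,
      Fintype.card_fin] at this
  pt_mem_plane := Submodule.subset_span (by simp)
  tangent := by
    intro w hw
    obtain ⟨a, b, rfl⟩ := Submodule.mem_span_pair.1 hw
    rw [mink_add_left, mink_smul_left, mink_smul_left, x.2.2.1, x.2.1.1]
    simp
  pos_eq := ⟨x.1.2, Submodule.subset_span (by simp), x.2.2.2, rfl⟩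

/-- The action of `SL(2,ℂ)` on flags. -/
def NullFlag.act (A : SL2) (f : NullFlag) : NullFlag where
  pt := lorentz A f.pt
  plane := f.plane.map (lorentz A)
  pos := lorentz A '' f.pos
  pt_mem := lorentz_mem_lightCone A f.pt_mem
  finrank_plane := by
    have hinj : Function.Injective (lorentz A) :=
      Function.LeftInverse.injective (lorentz_inv_lorentz A)
    rw [← f.finrank_plane]
    exact (Submodule.equivMapOfInjective (lorentz A) hinj f.plane).finrank_eq.symm
  pt_mem_plane := Submodule.mem_map_of_mem f.pt_mem_plane
  tangent := by
    rintro _ ⟨w, hw, rfl⟩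
    rw [mink_lorentz]
    exact f.tangent w hw
  pos_eq := by
    obtain ⟨v, hv, hv', h⟩ := f.pos_eq
    refine ⟨lorentz A v, Submodule.mem_map_of_mem hv, ?_, ?_⟩
    · intro hm
      obtain ⟨c, hc⟩ := Submodule.mem_span_singleton.1 hm
      refine hv' (Submodule.mem_span_singleton.2 ⟨c, ?_⟩)
      have := congrArg (lorentz A⁻¹) hc
      rwa [map_smul, lorentz_inv_lorentz, lorentz_inv_lorentz] at this
    · rw [h]
      ext w
      constructor
      · rintro ⟨_, ⟨a, b, hb, rfl⟩, rfl⟩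
        exact ⟨a, b, hb, by simp⟩
      · rintro ⟨a, b, hb, rfl⟩
        exact ⟨_, ⟨a, b, hb, rfl⟩, by simp⟩

theorem phi_pair (κ : Spinor) : phi κ.1 ∈ LightCone ∧ mink (dphi κ.1) (phi κ.1) = 0 ∧
    dphi κ.1 ∉ Submodule.span ℝ {phi κ.1} := by
  obtain ⟨κ, hκ⟩ := κ
  rw [phi_coords, dphi_coords]
  have hpos : 0 < (κ 0).re ^ 2 + (κ 0).im ^ 2 + (κ 1).re ^ 2 + (κ 1).im ^ 2 := by
    by_contra! h
    refine hκ (funext fun i => Complex.ext ?_ ?_) <;> fin_cases i <;> simp <;>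
      nlinarith [sq_nonneg (κ 0).re, sq_nonneg (κ 0).im, sq_nonneg (κ 1).re, sq_nonneg (κ 1).im]
  refine ⟨⟨?_, hpos⟩, ?_, ?_⟩
  · simp [mink]; ring
  · simp [mink]; ring
  · intro h
    obtain ⟨c, hc⟩ := Submodule.mem_span_singleton.1 h
    have h0 := congrFun hc 0
    have hc0 : c = 0 := by simpa [hpos.ne'] using h0
    have h1 := congrFun hc 1
    have h2 := congrFun hc 2
    have h3 := congrFun hc 3
    simp [hc0] at h1 h2 h3
    nlinarith [sq_nonneg ((κ 0).re ^ 2 - (κ 0).im ^ 2 + (κ 1).re ^ 2 - (κ 1).im ^ 2),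
      mul_pos hpos hpos]

/-- The map `Φ₁` from nonzero spinors to flags, `κ ↦ [[κκ*, D_κ(κκ*)(Zκ)]]`. -/
def spinorFlag (κ : Spinor) : NullFlag := flagOf ⟨(phi κ.1, dphi κ.1), phi_pair κ⟩


/-! ### Hyperbolic space, horospheres, oriented line fields, decorations -/

/-- The hyperboloid model of hyperbolic 3-space. -/
def Hyp : Set Mink := {x | mink x x = 1 ∧ 0 < x 0}

/-- `H` is the intersection of hyperbolic space with the affine 3-plane `⟨x, p⟩ = c`, where
`p ∈ L⁺` and `c > 0`: a horosphere whose point at infinity is the ray of `p`. -/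
def IsCentre (H : Set Mink) (p : Mink) : Prop :=
  p ∈ LightCone ∧ ∃ c : ℝ, 0 < c ∧ H = {x | x ∈ Hyp ∧ mink x p = c}

/-- `H` is a horosphere. -/
def IsHorosphere (H : Set Mink) : Prop := ∃ p, IsCentre H p

/-- The tangent plane `q^⊥ ∩ p^⊥` of a horosphere with centre `p` at its point `q`. -/
def tangentPlane (H : Set Mink) (q : Mink) : Set Mink :=
  {w | mink w q = 0 ∧ ∃ p, IsCentre H p ∧ mink w p = 0}

/-- A horosphere with an oriented tangent line field. The oriented line at a point `q` of the
horosphere is given by its unit vector `dir q` (`dir` is `0` off the horosphere). -/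
@[ext] structure LineFieldHorosphere where
  carrier : Set Mink
  dir : Mink → Mink
  isHorosphere : IsHorosphere carrier
  dir_off : ∀ q, q ∉ carrier → dir q = 0
  dir_tangent : ∀ q ∈ carrier, dir q ∈ tangentPlane carrier q
  dir_unit : ∀ q ∈ carrier, mink (dir q) (dir q) = -1

/-- The line field is parallel: it is invariant under all parabolic isometries preserving the
horosphere, i.e. under its Euclidean translations. -/
def LineFieldHorosphere.IsParallel (h : LineFieldHorosphere) : Prop :=
  ∀ B : SL2, B.1.IsParabolic → lorentz B '' h.carrier = h.carrier →
    ∀ q ∈ h.carrier, h.dir (lorentz B q) = lorentz B (h.dir q)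

/-- Decorated horospheres. -/
def DecoratedHorosphere : Type := {h : LineFieldHorosphere // h.IsParallel}

theorem LightCone.mink_neg {p v : Mink} (hp : p ∈ LightCone) (hv : mink v p = 0)
    (hv' : v ∉ Submodule.span ℝ {p}) : mink v v < 0 := by
  obtain ⟨hpp, hp0⟩ := hp
  by_contra! h
  apply hv'
  simp only [mink] at *
  have key : (v 1 * p 0 - v 0 * p 1) ^ 2 + (v 2 * p 0 - v 0 * p 2) ^ 2
      + (v 3 * p 0 - v 0 * p 3) ^ 2 ≤ 0 := by
    have h1 := mul_nonneg h (sq_nonneg (p 0))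
    have h2 : (v 0 * p 0 - v 1 * p 1 - v 2 * p 2 - v 3 * p 3) * (v 0 * p 0) = 0 := by
      rw [hv]; ring
    have h3 : (p 0 * p 0 - p 1 * p 1 - p 2 * p 2 - p 3 * p 3) * (v 0 * v 0) = 0 := by
      rw [hpp]; ring
    nlinarith
  have e1 : v 1 * p 0 - v 0 * p 1 = 0 := by
    nlinarith [sq_nonneg (v 1 * p 0 - v 0 * p 1), sq_nonneg (v 2 * p 0 - v 0 * p 2),
      sq_nonneg (v 3 * p 0 - v 0 * p 3)]
  have e2 : v 2 * p 0 - v 0 * p 2 = 0 := by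
    nlinarith [sq_nonneg (v 1 * p 0 - v 0 * p 1), sq_nonneg (v 2 * p 0 - v 0 * p 2),
      sq_nonneg (v 3 * p 0 - v 0 * p 3)]
  have e3 : v 3 * p 0 - v 0 * p 3 = 0 := by
    nlinarith [sq_nonneg (v 1 * p 0 - v 0 * p 1), sq_nonneg (v 2 * p 0 - v 0 * p 2),
      sq_nonneg (v 3 * p 0 - v 0 * p 3)]
  refine Submodule.mem_span_singleton.2 ⟨v 0 / p 0, ?_⟩
  ext i
  fin_cases i <;> simp <;> field_simp <;> linarith

theorem NullFlag.exists_dir (f : NullFlag) {q : Mink} (hq : mink q f.pt = 1) :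
    ∃ u ∈ f.pos, mink u q = 0 ∧ mink u u = -1 := by
  obtain ⟨v, hv, hv', hpos⟩ := f.pos_eq
  have hvp := f.tangent v hv
  have hneg := LightCone.mink_neg f.pt_mem hvp hv'
  have hs : 0 < Real.sqrt (-mink v v) := Real.sqrt_pos.2 (by linarith)
  have hs2 : Real.sqrt (-mink v v) ^ 2 = -mink v v := Real.sq_sqrt (by linarith)
  set s := Real.sqrt (-mink v v) with hsdef
  refine ⟨(-(s⁻¹ * mink v q)) • f.pt + s⁻¹ • v, ?_, ?_, ?_⟩
  · rw [hpos]
    exact ⟨_, _, inv_pos.2 hs, rfl⟩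
  · rw [mink_add_left, mink_smul_left, mink_smul_left, mink_comm f.pt, hq]
    ring
  · have hexp (a b : ℝ) : mink (a • f.pt + b • v) (a • f.pt + b • v)
        = a ^ 2 * mink f.pt f.pt + 2 * a * b * mink v f.pt + b ^ 2 * mink v v := by
      simp [mink]; ring
    rw [hexp, f.pt_mem.1, hvp]
    have : mink v v = -s ^ 2 := by linarith
    rw [this]
    field_simp
    ring

theorem NullFlag.pos_tangent (f : NullFlag) {u : Mink} (hu : u ∈ f.pos) : mink u f.pt = 0 := by
  obtain ⟨v, hv, -, hpos⟩ := f.pos_eq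
  rw [hpos] at hu
  obtain ⟨a, b, -, rfl⟩ := hu
  rw [mink_add_left, mink_smul_left, mink_smul_left, f.pt_mem.1, f.tangent v hv]
  ring

open Classical in
/-- The map `Φ₂`: the flag with point `p` and oriented plane `V` is sent to the horosphere
`⟨x, p⟩ = 1` with the oriented line field `q^⊥ ∩ V` at `q`. -/
def penner (f : NullFlag) : LineFieldHorosphere where
  carrier := {x | x ∈ Hyp ∧ mink x f.pt = 1}
  dir q := if h : mink q q = 1 ∧ 0 < q 0 ∧ mink q f.pt = 1 then
    (f.exists_dir h.2.2).choose else 0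
  isHorosphere := ⟨f.pt, f.pt_mem, 1, one_pos, rfl⟩
  dir_off q hq := dif_neg fun h => hq ⟨⟨h.1, h.2.1⟩, h.2.2⟩
  dir_tangent q hq := by
    rw [dif_pos ⟨hq.1.1, hq.1.2, hq.2⟩]
    have h := (f.exists_dir hq.2).choose_spec
    exact ⟨h.2.1, f.pt, ⟨f.pt_mem, 1, one_pos, rfl⟩, f.pos_tangent h.1⟩
  dir_unit q hq := by
    rw [dif_pos ⟨hq.1.1, hq.1.2, hq.2⟩]
    exact (f.exists_dir hq.2).choose_spec.2.2

theorem lorentz_mem_hyp (A : SL2) {x : Mink} (hx : x ∈ Hyp) : lorentz A x ∈ Hyp :=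
  ⟨by rw [mink_lorentz_self]; exact hx.1, lorentz_zero_pos A (by rw [hx.1]; norm_num) hx.2⟩

theorem IsCentre.image (A : SL2) {H : Set Mink} {p : Mink} (h : IsCentre H p) :
    IsCentre (lorentz A '' H) (lorentz A p) := by
  obtain ⟨hp, c, hc, rfl⟩ := h
  refine ⟨lorentz_mem_lightCone A hp, c, hc, ?_⟩
  ext x
  constructor
  · rintro ⟨y, ⟨hy, hyc⟩, rfl⟩
    exact ⟨lorentz_mem_hyp A hy, by rw [mink_lorentz, hyc]⟩
  · rintro ⟨hx, hxc⟩
    refine ⟨lorentz A⁻¹ x, ⟨lorentz_mem_hyp _ hx, ?_⟩, lorentz_lorentz_inv A x⟩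
    rw [mink_lorentz_left, inv_inv, hxc]

theorem lorentz_inv_mem {A : SL2} {H : Set Mink} {q : Mink} (hq : q ∈ lorentz A '' H) :
    lorentz A⁻¹ q ∈ H := by
  obtain ⟨x, hx, rfl⟩ := hq
  rwa [lorentz_inv_lorentz]

theorem tangentPlane_image (A : SL2) {H : Set Mink} {q w : Mink} (h : w ∈ tangentPlane H q) :
    lorentz A w ∈ tangentPlane (lorentz A '' H) (lorentz A q) := by
  obtain ⟨hq, p, hp, hw⟩ := h
  exact ⟨by rw [mink_lorentz, hq], lorentz A p, hp.image A, by rw [mink_lorentz, hw]⟩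

/-- The action of `SL(2,ℂ)` on horospheres with oriented line fields. -/
def LineFieldHorosphere.act (A : SL2) (h : LineFieldHorosphere) : LineFieldHorosphere where
  carrier := lorentz A '' h.carrier
  dir q := lorentz A (h.dir (lorentz A⁻¹ q))
  isHorosphere := let ⟨p, hp⟩ := h.isHorosphere; ⟨lorentz A p, hp.image A⟩
  dir_off q hq := by
    rw [h.dir_off, map_zero]
    exact fun hm => hq ⟨_, hm, lorentz_lorentz_inv A q⟩
  dir_tangent q hq := by
    have := tangentPlane_image A (h.dir_tangent _ (lorentz_inv_mem hq))
    rwa [lorentz_lorentz_inv] at this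
  dir_unit q hq := by
    rw [mink_lorentz]
    exact h.dir_unit _ (lorentz_inv_mem hq)

theorem LineFieldHorosphere.IsParallel.act (A : SL2) {h : LineFieldHorosphere}
    (hh : h.IsParallel) : (h.act A).IsParallel := by
  intro B hB hBh q hq
  have hpar : (A⁻¹ * B * A).1.IsParabolic := by
    have h1 : (A⁻¹ * B * A).1 = (SpecialLinearGroup.toGL A⁻¹).1 * B.1
        * (SpecialLinearGroup.toGL A⁻¹).1⁻¹ := by
      have h2 : (SpecialLinearGroup.toGL A⁻¹).1⁻¹ = A.1 := by
        apply Matrix.inv_eq_left_inv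
        exact congrArg Subtype.val (mul_inv_cancel A)
      rw [h2]
      rfl
    rw [h1, isParabolic_conj_iff]
    exact hB
  have hcar : lorentz (A⁻¹ * B * A) '' h.carrier = h.carrier := by
    have h1 : lorentz B '' (lorentz A '' h.carrier) = lorentz A '' h.carrier := hBh
    have h2 : lorentz (A⁻¹ * B * A) '' h.carrier
        = lorentz A⁻¹ '' (lorentz B '' (lorentz A '' h.carrier)) := by
      simp only [Set.image_image, lorentz_mul]
    rw [h2, h1]
    simp only [Set.image_image, lorentz_inv_lorentz, Set.image_id']
  have := hh _ hpar hcar _ (lorentz_inv_mem hq)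
  simp only [lorentz_mul, lorentz_lorentz_inv] at this
  change lorentz A (h.dir (lorentz A⁻¹ (lorentz B q)))
    = lorentz B (lorentz A (h.dir (lorentz A⁻¹ q)))
  rw [this, lorentz_lorentz_inv]

/-! ### Frames and frame fields -/

/-- Right-handed orthonormal frames of hyperbolic space: `F 0` is the base point, and
`(F 1, F 2, F 3)` is an orthonormal basis of its tangent space `(F 0)^⊥`, right-handed for the
orientation in which `(∂_X, ∂_Y, ∂_Z)` is right-handed at `(1, 0, 0, 0)`. -/
def HFrame : Type :=
  {F : Fin 4 → Mink // F 0 ∈ Hyp ∧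
    (∀ i j, mink (F i) (F j) = if i = j then (if i = 0 then 1 else -1) else 0) ∧
    0 < (Matrix.of F).det}

instance : TopologicalSpace HFrame := inferInstanceAs (TopologicalSpace (Subtype _))

/-- The action of `SL(2,ℂ)` on frames. -/
def HFrame.act (A : SL2) (F : HFrame) : HFrame :=
  ⟨fun i => lorentz A (F.1 i), lorentz_mem_hyp A F.2.1,
    fun i j => by rw [mink_lorentz]; exact F.2.2.1 i j, by
      have h : Matrix.of (fun i => lorentz A (F.1 i))
          = Matrix.of F.1 * (LinearMap.toMatrix' (lorentz A))ᵀ := by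
        ext i j
        have := congrFun (LinearMap.toMatrix'_mulVec (lorentz A) (F.1 i)) j
        rw [Matrix.of_apply, ← this]
        simp [Matrix.mul_apply, mulVec, dotProduct, mul_comm]
      rw [h, det_mul, det_transpose, LinearMap.det_toMatrix']
      exact mul_pos F.2.2.2 (det_lorentz_pos A)⟩

/-- The frame obtained by rotating a frame by the angle `t` about its second vector `F 2`
(right-hand rule). -/
def HFrame.rotate (F : HFrame) (t : ℝ) : HFrame :=
  ⟨![F.1 0, Real.cos t • F.1 1 - Real.sin t • F.1 3, F.1 2,
      Real.sin t • F.1 1 + Real.cos t • F.1 3], F.2.1, by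
    intro i j
    have h11 : mink (F.1 1) (F.1 1) = -1 := F.2.2.1 1 1
    have h33 : mink (F.1 3) (F.1 3) = -1 := F.2.2.1 3 3
    have h13 : mink (F.1 1) (F.1 3) = 0 := F.2.2.1 1 3
    have h31 : mink (F.1 3) (F.1 1) = 0 := F.2.2.1 3 1
    have h00 : mink (F.1 0) (F.1 0) = 1 := F.2.2.1 0 0
    have h22 : mink (F.1 2) (F.1 2) = -1 := F.2.2.1 2 2
    have h01 : mink (F.1 0) (F.1 1) = 0 := F.2.2.1 0 1
    have h10 : mink (F.1 1) (F.1 0) = 0 := F.2.2.1 1 0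
    have h02 : mink (F.1 0) (F.1 2) = 0 := F.2.2.1 0 2
    have h20 : mink (F.1 2) (F.1 0) = 0 := F.2.2.1 2 0
    have h03 : mink (F.1 0) (F.1 3) = 0 := F.2.2.1 0 3
    have h30 : mink (F.1 3) (F.1 0) = 0 := F.2.2.1 3 0
    have h12 : mink (F.1 1) (F.1 2) = 0 := F.2.2.1 1 2
    have h21 : mink (F.1 2) (F.1 1) = 0 := F.2.2.1 2 1
    have h32 : mink (F.1 3) (F.1 2) = 0 := F.2.2.1 3 2
    have h23 : mink (F.1 2) (F.1 3) = 0 := F.2.2.1 2 3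
    have hsc := Real.sin_sq_add_cos_sq t
    have hadd (x y z : Mink) : mink x (y + z) = mink x y + mink x z := by simp [mink]; ring
    have hsmul (c : ℝ) (x z : Mink) : mink x (c • z) = c * mink x z := by simp [mink]; ring
    rw [sub_eq_add_neg, ← neg_smul]
    fin_cases i <;> fin_cases j <;>
      simp [hadd, hsmul, mink_add_left, mink_smul_left, h11, h33, h13, h31, h00, h22, h01, h10,
        h02, h20, h03, h30, h12, h21, h32, h23, -neg_smul] <;> linarith, by
    have h : Matrix.of ![F.1 0, Real.cos t • F.1 1 - Real.sin t • F.1 3, F.1 2,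
        Real.sin t • F.1 1 + Real.cos t • F.1 3]
        = !![1, 0, 0, 0; 0, Real.cos t, 0, -Real.sin t; 0, 0, 1, 0;
            0, Real.sin t, 0, Real.cos t] * Matrix.of F.1 := by
      ext i j
      fin_cases i <;> (simp [Matrix.mul_apply, Fin.sum_univ_four]; try ring)
    have hd : (!![1, 0, 0, 0; 0, Real.cos t, 0, -Real.sin t; 0, 0, 1, 0;
            0, Real.sin t, 0, Real.cos t] : Matrix (Fin 4) (Fin 4) ℝ).det = 1 := by
      have hsc := Real.sin_sq_add_cos_sq t
      simp [det_succ_row_zero, Fin.sum_univ_succ, Fin.succAbove]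
      linarith
    rw [h, det_mul, hd, one_mul]
    exact F.2.2.2⟩

theorem HFrame.rotate_act (A : SL2) (F : HFrame) (t : ℝ) :
    (F.rotate t).act A = (F.act A).rotate t := by
  apply Subtype.ext
  ext i : 1
  fin_cases i <;> simp [HFrame.act, HFrame.rotate]

/-- `N` is the outward unit normal of the horosphere `H` at `q`: a unit tangent vector of
hyperbolic space at `q`, normal to `H`, such that the geodesic `cosh s • q + sinh s • N` tends to
the centre of `H`, i.e. `q + N` lies on the ray of the centre. -/
def IsOutNormal (H : Set Mink) (q N : Mink) : Prop :=
  mink N q = 0 ∧ mink N N = -1 ∧ (∀ w ∈ tangentPlane H q, mink N w = 0) ∧ IsCentre H (q + N)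

/-- The outward frame field `(N^out, v, N^out × v)`, as a set of frames. -/
def LineFieldHorosphere.outFrames (h : LineFieldHorosphere) : Set HFrame :=
  {F | F.1 0 ∈ h.carrier ∧ IsOutNormal h.carrier (F.1 0) (F.1 1) ∧ F.1 2 = h.dir (F.1 0)}

/-- The inward frame field `(N^in, v, N^in × v)`, where `N^in = -N^out`, as a set of frames. -/
def LineFieldHorosphere.inFrames (h : LineFieldHorosphere) : Set HFrame :=
  {F | F.1 0 ∈ h.carrier ∧ IsOutNormal h.carrier (F.1 0) (-F.1 1) ∧ F.1 2 = h.dir (F.1 0)}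

theorem IsOutNormal.image (A : SL2) {H : Set Mink} {q N : Mink} (h : IsOutNormal H q N) :
    IsOutNormal (lorentz A '' H) (lorentz A q) (lorentz A N) := by
  refine ⟨by rw [mink_lorentz, h.1], by rw [mink_lorentz, h.2.1], ?_, ?_⟩
  · intro w hw
    have hw' := tangentPlane_image A⁻¹ hw
    simp only [Set.image_image, lorentz_inv_lorentz, Set.image_id'] at hw'
    rw [mink_lorentz_left]
    exact h.2.2.1 _ hw'
  · rw [← map_add]
    exact h.2.2.2.image A

theorem act_mem_outFrames (A : SL2) {h : LineFieldHorosphere} {F : HFrame}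
    (hF : F ∈ h.outFrames) : F.act A ∈ (h.act A).outFrames := by
  refine ⟨⟨_, hF.1, rfl⟩, hF.2.1.image A, ?_⟩
  change lorentz A (F.1 2) = lorentz A (h.dir (lorentz A⁻¹ (lorentz A (F.1 0))))
  rw [lorentz_inv_lorentz, hF.2.2]

theorem act_mem_inFrames (A : SL2) {h : LineFieldHorosphere} {F : HFrame}
    (hF : F ∈ h.inFrames) : F.act A ∈ (h.act A).inFrames := by
  refine ⟨⟨_, hF.1, rfl⟩, ?_, ?_⟩
  · have := hF.2.1.image A
    rwa [map_neg] at this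
  · change lorentz A (F.1 2) = lorentz A (h.dir (lorentz A⁻¹ (lorentz A (F.1 0))))
    rw [lorentz_inv_lorentz, hF.2.2]

/-! ### Double covers and lifted actions -/

universe u v

/-- `π` is a connected double cover. (The frame bundle and the space of flags have fundamental
group `ℤ/2`, so these are their universal covers, unique up to isomorphism.) -/
def IsConnectedDoubleCover {E : Type u} {X : Type v} [TopologicalSpace E] [TopologicalSpace X]
    (π : E → X) : Prop :=
  IsCoveringMap π ∧ (∀ x, (π ⁻¹' {x}).ncard = 2) ∧ ConnectedSpace E

/-- A continuous action of `SL(2,ℂ)` on `E` that lifts the action `act` on `X`. -/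
@[ext] structure LiftedAction {E : Type u} {X : Type v} [TopologicalSpace E] (π : E → X)
    (act : SL2 → X → X) where
  smul : SL2 → E → E
  one_smul : ∀ e, smul 1 e = e
  mul_smul : ∀ A B e, smul (A * B) e = smul A (smul B e)
  continuous : Continuous fun z : SL2 × E => smul z.1 z.2
  lift : ∀ A e, π (smul A e) = act A (π e)

/-! ### Spin decorations

In this section `π : E → HFrame` is a (spin) double cover of the frame bundle. -/

/-- `w'` is obtained by rotating the spin frame `w` by the angle `θ` about the second vector of
the underlying frame. -/
def SpinRotation {E : Type u} [TopologicalSpace E] (π : E → HFrame) (θ : ℝ) (w w' : E) : Prop :=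
  ∃ γ : ℝ → E, Continuous γ ∧ γ 0 = w ∧ γ θ = w' ∧ ∀ t, π (γ t) = (π w).rotate t

/-- `W` is (the image of) a continuous lift along `H` of the frame field `Fr`. -/
def IsSpinLift {E : Type u} [TopologicalSpace E] (π : E → HFrame) (H : Set Mink)
    (Fr : Set HFrame) (W : Set E) : Prop :=
  ∃ s : H → E, Continuous s ∧ (∀ q, π (s q) ∈ Fr ∧ (π (s q)).1 0 = q.1) ∧ W = Set.range s

/-- A spin-decorated horosphere: a decorated horosphere with continuous lifts `Win`, `Wout` of
its inward and outward frame fields to spin frames, such that `Win` is obtained from `Wout` by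
rotating by the angle `π` about the decoration vector at each point. -/
@[ext] structure SpinHorosphere {E : Type u} [TopologicalSpace E] (π : E → HFrame) extends
    LineFieldHorosphere where
  parallel : toLineFieldHorosphere.IsParallel
  Win : Set E
  Wout : Set E
  in_lift : IsSpinLift π carrier toLineFieldHorosphere.inFrames Win
  out_lift : IsSpinLift π carrier toLineFieldHorosphere.outFrames Wout
  assoc : ∀ w ∈ Wout, ∃ w' ∈ Win, SpinRotation π Real.pi w w'

section

variable {E : Type u} [TopologicalSpace E] {π : E → HFrame}

theorem IsSpinLift.image (a : LiftedAction π HFrame.act) (A : SL2) {H : Set Mink}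
    {Fr Fr' : Set HFrame} {W : Set E} (hFr : ∀ F ∈ Fr, F.act A ∈ Fr') (h : IsSpinLift π H Fr W) :
    IsSpinLift π (lorentz A '' H) Fr' (a.smul A '' W) := by
  obtain ⟨s, hs, hs', rfl⟩ := h
  have hc : Continuous (a.smul A) := a.continuous.comp (Continuous.prodMk_right A)
  have hL : Continuous (lorentz A⁻¹) := LinearMap.continuous_of_finiteDimensional _
  refine ⟨fun q => a.smul A (s ⟨lorentz A⁻¹ q.1, lorentz_inv_mem q.2⟩), ?_, ?_, ?_⟩
  · exact hc.comp (hs.comp (Continuous.subtype_mk (hL.comp continuous_subtype_val) _))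
  · intro q
    rw [a.lift]
    refine ⟨hFr _ (hs' _).1, ?_⟩
    change lorentz A ((π (s _)).1 0) = q.1
    rw [(hs' _).2]
    exact lorentz_lorentz_inv A q.1
  · ext w
    constructor
    · rintro ⟨_, ⟨q, rfl⟩, rfl⟩
      refine ⟨⟨lorentz A q.1, q.1, q.2, rfl⟩, ?_⟩
      simp only [lorentz_inv_lorentz]
    · rintro ⟨q, rfl⟩
      exact ⟨_, ⟨_, rfl⟩, rfl⟩

/-- The action of `SL(2,ℂ)` on spin-decorated horospheres, for its action on spin frames. -/
def SpinHorosphere.act (a : LiftedAction π HFrame.act) (A : SL2) (h : SpinHorosphere π) :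
    SpinHorosphere π where
  toLineFieldHorosphere := h.toLineFieldHorosphere.act A
  parallel := h.parallel.act A
  Win := a.smul A '' h.Win
  Wout := a.smul A '' h.Wout
  in_lift := h.in_lift.image a A fun _ => act_mem_inFrames A
  out_lift := h.out_lift.image a A fun _ => act_mem_outFrames A
  assoc := by
    rintro _ ⟨w, hw, rfl⟩
    obtain ⟨w', hw', γ, hγ, h0, h1, h2⟩ := h.assoc w hw
    have hc : Continuous (a.smul A) := a.continuous.comp (Continuous.prodMk_right A)
    refine ⟨_, ⟨w', hw', rfl⟩, fun t => a.smul A (γ t), hc.comp hγ, congrArg _ h0, congrArg _ h1, ?_⟩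
    intro t
    rw [a.lift, h2, a.lift, HFrame.rotate_act]

/-- Forget the spin decoration and keep the decoration. -/
def SpinHorosphere.forget (h : SpinHorosphere π) : DecoratedHorosphere :=
  ⟨h.toLineFieldHorosphere, h.parallel⟩

end

/-! ### Topologies and smooth structures

Smooth structures are recorded as diffeologies, i.e. by their smooth families over `ℝⁿ`; for
manifolds this is equivalent to the usual notion of smoothness. -/

/-- The smooth structure induced by a map into a space with a smooth structure (for inclusions of
submanifolds: the submanifold structure). -/
@[reducible] def inducedDiffeology {X : Type u} {Y : Type v} (d : DiffeologicalSpace Y)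
    (f : X → Y) : DiffeologicalSpace X where
  plots n := {p | f ∘ p ∈ d.plots n}
  constant_plots x := d.constant_plots (f x)
  plot_reparam hp hg := d.plot_reparam hp hg
  locality hp := d.locality hp

/-- The quotient smooth structure, whose smooth families are those that locally lift along `f`
to smooth families (or are constant). -/
@[reducible] def coinducedDiffeology {X : Type u} {Y : Type v} (d : DiffeologicalSpace X)
    (f : X → Y) : DiffeologicalSpace Y :=
  DiffeologicalSpace.generateFrom {x | ∃ p ∈ d.plots x.1, x.2 = f ∘ p}

/-- The smooth structure of a covering space: a family is smooth if it is continuous and its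
projection is smooth. -/
@[reducible] def coverDiffeology {E : Type u} {X : Type v} [TopologicalSpace E]
    (d : DiffeologicalSpace X) (π : E → X) : DiffeologicalSpace E where
  plots n := {p | Continuous p ∧ π ∘ p ∈ d.plots n}
  constant_plots x := ⟨continuous_const, d.constant_plots (π x)⟩
  plot_reparam hp hg := ⟨hp.1.comp hg.continuous, d.plot_reparam hp.2 hg⟩
  locality {n p} hp := by
    refine ⟨continuous_iff_continuousAt.2 fun x => ?_, d.locality fun x => ?_⟩
    · obtain ⟨U, hU, hx, h⟩ := hp x
      obtain ⟨ε, hε, hball⟩ := Metric.isOpen_iff.1 hU x hx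
      have hmem (y) : OpenPartialHomeomorph.univBall x ε y ∈ U := by
        have h1 := (OpenPartialHomeomorph.univBall x ε).map_source (x := y)
        rw [OpenPartialHomeomorph.univBall_target x hε] at h1
        exact hball (h1 (by simp))
      have hc := (h hmem OpenPartialHomeomorph.contDiff_univBall).1
      have hsymm : ContinuousOn (OpenPartialHomeomorph.univBall x ε).symm (Metric.ball x ε) :=
        OpenPartialHomeomorph.continuousOn_univBall_symm x ε
      have hcomp := (hc.comp_continuousOn hsymm).continuousAt (Metric.ball_mem_nhds x hε)
      refine hcomp.congr ?_
      filter_upwards [Metric.ball_mem_nhds x hε] with y hy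
      have := (OpenPartialHomeomorph.univBall x ε).right_inv
        (by rwa [OpenPartialHomeomorph.univBall_target x hε])
      simp [this]
    · obtain ⟨U, hU, hx, h⟩ := hp x
      exact ⟨U, hU, hx, fun hf hs => (h hf hs).2⟩

/-- A bijection that is smooth with smooth inverse. -/
def IsDiffeo {X : Type u} {Y : Type v} (dX : DiffeologicalSpace X) (dY : DiffeologicalSpace Y)
    (e : X ≃ Y) : Prop :=
  @Diffeology.DSmooth X Y dX dY e ∧ @Diffeology.DSmooth Y X dY dX e.symm

/-- Nonzero spinors: an open subset of the real vector space `ℂ²`. -/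
@[reducible] def spinorDiffeology : DiffeologicalSpace Spinor :=
  inducedDiffeology (NormedSpace.toDiffeology (Fin 2 → ℂ)) Subtype.val

/-- Flags: a quotient of the submanifold `FlagPair` of `ℝ⁸`. -/
@[reducible] def flagDiffeology : DiffeologicalSpace NullFlag :=
  coinducedDiffeology
    (inducedDiffeology (NormedSpace.toDiffeology (Mink × Mink)) fun x : FlagPair => x.1) flagOf

instance : TopologicalSpace NullFlag :=
  .coinduced flagOf (.induced (fun x : FlagPair => x.1) inferInstance)

/-- Frames: a submanifold of `(ℝ⁴)⁴`. -/
@[reducible] def frameDiffeology : DiffeologicalSpace HFrame :=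
  inducedDiffeology (NormedSpace.toDiffeology (Fin 4 → Mink)) Subtype.val

/-- Decorated horospheres are a quotient of the frame bundle: a frame is sent to the decorated
horosphere with that frame in its outward frame field. -/
instance : TopologicalSpace DecoratedHorosphere :=
  .coinduced (fun x : {x : HFrame × DecoratedHorosphere // x.1 ∈ x.2.1.outFrames} => x.1.2)
    (.induced (fun x => x.1.1) inferInstance)

section

variable {E : Type u} [TopologicalSpace E] (π : E → HFrame)

/-- A spin-decorated horosphere together with one of its outward spin frames. -/
def MarkedSpinHorosphere : Type u := {x : E × SpinHorosphere π // x.1 ∈ x.2.Wout}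

/-- Spin-decorated horospheres are a quotient of the spin frame bundle: a spin frame is sent to
the spin-decorated horosphere with that spin frame in its outward spin decoration. -/
instance : TopologicalSpace (SpinHorosphere π) :=
  .coinduced (fun x : MarkedSpinHorosphere π => x.1.2) (.induced (fun x => x.1.1) inferInstance)

/-- The quotient smooth structure on spin-decorated horospheres: a family is smooth if outward
spin frames of its members can locally be chosen smoothly. -/
@[reducible] def spinHorosphereDiffeology : DiffeologicalSpace (SpinHorosphere π) :=
  coinducedDiffeology (inducedDiffeology (coverDiffeology frameDiffeology π)
    fun x : MarkedSpinHorosphere π => x.1.1) fun x => x.1.2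

end

end SpinHor

end

open SpinHor

noncomputable section

namespace SpinHor

/-! ### Vectors up to sign -/

/-! Both double covers have explicit models. Applying `A ∈ SL(2,ℂ)` to a fixed frame `F⁰` gives a
map `SL(2,ℂ) → Fr`, and `Φ₁` is a map `ℂ²∖0 → 𝓕`; both are quotients by `±1`. The reason is the same
in the two cases: the pairwise products of the entries of `A`, respectively of the coordinates of
`κ`, are functions of the frame (`frameProducts_act`), respectively of the flag
(`bivectorProducts_phi`), and a nonzero vector is determined up to sign by the products of its
coordinates. Dividing the products by a local square root of one of the squares gives local
sections. So both maps are coverings (`SignQuotient.isCoveringMap`), and a continuous lift of a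
smooth family is smooth (`contDiff_of_mul`).

Maps from `ℂ²∖0` and from `SL(2,ℂ) ≅ (ℂ²∖0) × ℂ` lift to every covering. A lift of a sign quotient
to a connected double cover is a homeomorphism (`SignQuotient.isHomeomorph_lift`), so every `Fr^S`
is a copy of `SL(2,ℂ)` and every `𝓕^S` a copy of `ℂ²∖0`. The actions are transported from left
multiplication and from the linear action; they are unique because `SL(2,ℂ)` is connected.

For the horospheres, assign to a frame `(q, N, v, N × v)` the flag `[[q + N, v]]`. The frames with
flag `f` are exactly the outward frames of the decorated horosphere of `f` (`mem_outFrames_penner`),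
and `A F⁰` has flag `Φ₁(A e)` for the first basis spinor `e`. Hence an outward spin frame over the
horosphere of `κ` is an `A` with `A e = ±κ`. Since a horosphere is connected, a continuous outward
lift selects one sign, so it is the coset `{A | A e = κ}`; the inward lift is then forced to be this
coset times the rotation by `π`. Thus spin-decorated horospheres correspond to nonzero spinors
(`spinHorosphere_injective`, `spinHorosphere_surjective`), and the spinor is read off from any
outward spin frame. The base points are met by composing with `-1` where necessary, and uniqueness
follows from the transitivity of `SL(2,ℂ)` on `ℂ²∖0`. -/

theorem eq_or_eq_neg_of_mul_eq_mul {ι : Type*} {x y : ι → ℂ} (hx : x ≠ 0)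
    (h : ∀ i j, x i * x j = y i * y j) : x = y ∨ x = -y := by
  obtain ⟨i, hi⟩ := Function.ne_iff.1 hx
  have hi' : x i ≠ 0 := hi
  rcases mul_self_eq_mul_self_iff.1 (h i i) with h1 | h1
  · left
    funext j
    have := h i j
    rw [h1] at this hi'
    exact mul_left_cancel₀ hi' this
  · right
    funext j
    have := h i j
    have hy : y i ≠ 0 := fun h0 => hi' (by rw [h1, h0, neg_zero])
    rw [h1] at this
    apply mul_left_cancel₀ hy
    rw [Pi.neg_apply]
    linear_combination -this

/-- Near `x` the quotient `c y / c x` has positive real part, so it is the principal square root of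
its square. Hence `c` is the principal root of `c² / c(x)²` times `c x`, a smooth function of `c²`.
-/
theorem contDiffAt_of_sq {V : Type*} [NormedAddCommGroup V] [NormedSpace ℝ V] {n : WithTop ℕ∞}
    {c : V → ℂ} {x : V} (hc : ContinuousAt c x) (h0 : c x ≠ 0)
    (hsq : ContDiffAt ℝ n (fun y => c y * c y) x) : ContDiffAt ℝ n c x := by
  have hd : ContinuousAt (fun y => c y / c x) x := hc.div_const _
  have h1 : ∀ᶠ y in 𝓝 x, 0 < (c y / c x).re := by
    have : ContinuousAt (fun y => (c y / c x).re) x := Complex.continuous_re.continuousAt.comp hd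
    refine this.eventually (lt_mem_nhds ?_)
    simp [div_self h0]
  have h2 : c =ᶠ[𝓝 x] fun y =>
      c x * Complex.exp (Complex.log (c y * c y / (c x * c x)) / 2) := by
    filter_upwards [h1] with y hy
    have h3 : c y * c y / (c x * c x) = (c y / c x) ^ 2 := by field_simp
    have hlt : |(c y / c x).arg| < Real.pi / 2 := Complex.abs_arg_lt_pi_div_two_iff.2 (Or.inl hy)
    have h4 : Complex.log ((c y / c x) ^ 2) = 2 * Complex.log (c y / c x) := by
      have hz : c y / c x ≠ 0 := fun h => by rw [h] at hy; simp at hy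
      conv_lhs => rw [← Complex.exp_log hz, ← Complex.exp_nat_mul]
      rw [← Complex.log_im, abs_lt] at hlt
      refine Complex.log_exp ?_ ?_ <;> simp <;> linarith
    rw [h3, h4, mul_div_cancel_left₀ _ two_ne_zero, Complex.exp_log]
    · field_simp
    · intro h; rw [h] at hy; simp at hy
  refine ContDiffAt.congr_of_eventuallyEq ?_ h2
  refine contDiffAt_const.mul (ContDiffAt.cexp ?_)
  refine ContDiffAt.div_const ?_ _
  have h5 : ContDiffAt ℂ n Complex.log (c x * c x / (c x * c x)) := by
    rw [div_self (mul_ne_zero h0 h0)]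
    exact Complex.contDiffAt_log Complex.one_mem_slitPlane
  exact (h5.restrict_scalars ℝ).comp x (hsq.div_const _)

/-- Where `c i ≠ 0`, this coordinate is a smooth square root and the others are `c i * c j / c i`.
This turns continuity of a lift through a sign quotient into smoothness. -/
theorem contDiff_of_mul {V ι : Type*} [Fintype ι] [NormedAddCommGroup V] [NormedSpace ℝ V]
    {n : WithTop ℕ∞} {c : V → ι → ℂ} (hc : Continuous c) (h0 : ∀ x, c x ≠ 0)
    (h : ∀ i j, ContDiff ℝ n fun x => c x i * c x j) : ContDiff ℝ n c := by
  rw [contDiff_iff_contDiffAt]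
  intro x
  obtain ⟨i, hi⟩ := Function.ne_iff.1 (h0 x)
  have hci : Continuous fun y => c y i := (continuous_apply i).comp hc
  have h1 : ContDiffAt ℝ n (fun y => c y i) x :=
    contDiffAt_of_sq hci.continuousAt hi (h i i).contDiffAt
  rw [contDiffAt_pi]
  intro j
  have h2 : (fun y => c y j) =ᶠ[𝓝 x] fun y => c y i * c y j / c y i := by
    filter_upwards [hci.continuousAt.eventually_ne hi] with y hy
    rw [mul_div_cancel_left₀ _ hy]
  refine ContDiffAt.congr_of_eventuallyEq ?_ h2
  simp_rw [div_eq_mul_inv]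
  exact (h i j).contDiffAt.mul (h1.inv hi)

/-! ### Quotients by a sign -/

/-- `f : S → X` is the quotient of a space of nonzero vectors `v s` by the sign, where the
products `v s i * v s j` descend to continuous functions on `X`. -/
structure SignQuotient {S ι X : Type*} [TopologicalSpace S] [TopologicalSpace X]
    (v : S → ι → ℂ) (neg : S → S) (f : S → X) (Q : X → ι → ι → ℂ) : Prop where
  isInducing : IsInducing v
  injective : Function.Injective v
  ne_zero : ∀ s, v s ≠ 0
  vec_neg : ∀ s, v (neg s) = -v s
  continuous : Continuous f
  surjective : Function.Surjective f
  map_neg : ∀ s, f (neg s) = f s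
  continuous_products : Continuous Q
  products : ∀ s i j, Q (f s) i j = v s i * v s j

namespace SignQuotient

variable {S ι X : Type*} [TopologicalSpace S] [TopologicalSpace X]
    {v : S → ι → ℂ} {neg : S → S} {f : S → X} {Q : X → ι → ι → ℂ} (h : SignQuotient v neg f Q)

include h

theorem neg_neg (s : S) : neg (neg s) = s := h.injective (by rw [h.vec_neg, h.vec_neg, _root_.neg_neg])

theorem neg_ne (s : S) : neg s ≠ s := by
  intro hs
  have := h.vec_neg s
  rw [hs] at this
  exact h.ne_zero s (self_eq_neg.1 this)

theorem eq_or_eq_neg {s s' : S} (hs : f s = f s') : s = s' ∨ s = neg s' := by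
  have : ∀ i j, v s i * v s j = v s' i * v s' j := fun i j => by
    rw [← h.products, ← h.products, hs]
  rcases eq_or_eq_neg_of_mul_eq_mul (h.ne_zero s) this with h1 | h1
  · exact Or.inl (h.injective h1)
  · exact Or.inr (h.injective (by rw [h1, h.vec_neg]))

theorem continuous_neg : Continuous neg := by
  rw [h.isInducing.continuous_iff]
  have : v ∘ neg = fun s => -v s := funext h.vec_neg
  rw [this]
  exact h.isInducing.continuous.neg

/-- Choose `i` with `v s i ≠ 0` and let `r` be the branch of `√(Q i i)` near `f s` with `r (f s) = v
s i`. The vector with entries `Q x i j / r x` depends continuously on `x` at `f s`, equals `v s`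
there, and is `±v t` for any `t` over `x`. So every point near `f s` has a preimage near `s`. -/
theorem isOpenMap : IsOpenMap f := by
  rw [isOpenMap_iff_nhds_le]
  intro s W hW
  rw [Filter.mem_map, h.isInducing.nhds_eq_comap, Filter.mem_comap] at hW
  obtain ⟨N, hN, hNW⟩ := hW
  obtain ⟨i, hi⟩ := Function.ne_iff.1 (h.ne_zero s)
  have hi' : v s i ≠ 0 := hi
  let r : X → ℂ := fun x => v s i * Complex.exp (Complex.log (Q x i i / (v s i * v s i)) / 2)
  have hQ (i j : ι) : Continuous fun x => Q x i j :=
    (continuous_apply j).comp ((continuous_apply i).comp h.continuous_products)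
  have h1 : Q (f s) i i / (v s i * v s i) = 1 := by
    rw [h.products, div_self (mul_ne_zero hi' hi')]
  have hrs : r (f s) = v s i := by simp [r, h1]
  have hr : ContinuousAt r (f s) := by
    refine continuousAt_const.mul ?_
    refine (ContinuousAt.div_const (ContinuousAt.clog ?_ ?_) _).cexp
    · exact (hQ i i).continuousAt.div_const _
    · rw [h1]; exact Complex.one_mem_slitPlane
  have hm : ContinuousAt (fun x j => Q x i j / r x) (f s) :=
    continuousAt_pi.2 fun j => (hQ i j).continuousAt.div hr (by rw [hrs]; exact hi')
  have hms : (fun j => Q (f s) i j / r (f s)) = v s := by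
    funext j
    rw [hrs, h.products, mul_div_cancel_left₀ _ hi']
  have hne : ∀ᶠ x in 𝓝 (f s), Q x i i ≠ 0 := (hQ i i).continuousAt.eventually_ne (by
    rw [h.products]; exact mul_ne_zero hi' hi')
  have hN' : ∀ᶠ x in 𝓝 (f s), (fun j => Q x i j / r x) ∈ N := by
    refine hm.eventually (p := (· ∈ N)) ?_
    change N ∈ 𝓝 (fun j => Q (f s) i j / r (f s))
    rw [hms]
    exact hN
  filter_upwards [hne, hN'] with x hx hxN
  obtain ⟨t, rfl⟩ := h.surjective x
  have hrr : r (f t) * r (f t) = v t i * v t i := by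
    have h2 : Complex.exp (Complex.log (Q (f t) i i / (v s i * v s i)) / 2)
        * Complex.exp (Complex.log (Q (f t) i i / (v s i * v s i)) / 2)
        = Q (f t) i i / (v s i * v s i) := by
      rw [← Complex.exp_add, add_halves, Complex.exp_log]
      exact div_ne_zero hx (mul_ne_zero hi' hi')
    simp only [r]
    rw [mul_mul_mul_comm, h2, h.products]
    field_simp
  have hti : v t i ≠ 0 := by
    intro h0
    rw [h.products, h0, zero_mul] at hx
    exact hx rfl
  -- The reconstructed vector is `v t` or `v (neg t)`; both points lie over `f t`.
  rcases mul_self_eq_mul_self_iff.1 hrr with h2 | h2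
  · refine hNW (show v t ∈ N from ?_)
    convert hxN using 1
    funext j
    rw [h2, h.products, mul_div_cancel_left₀ _ hti]
  · rw [← h.map_neg]
    refine hNW (show v (neg t) ∈ N from ?_)
    convert hxN using 1
    funext j
    rw [h2, h.products, h.vec_neg, div_neg, mul_div_cancel_left₀ _ hti, Pi.neg_apply]

theorem isOpenQuotientMap : IsOpenQuotientMap f := ⟨h.surjective, h.continuous, h.isOpenMap⟩

theorem isCoveringMap : IsCoveringMap f := by
  let : MulAction ℤˣ S :=
    { smul := fun u s => if u = 1 then s else neg s
      one_smul := fun s => if_pos rfl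
      mul_smul := fun a b s => by
        rcases Int.units_eq_one_or a with rfl | rfl <;>
          rcases Int.units_eq_one_or b with rfl | rfl
        · exact (if_pos rfl).symm
        · exact (if_pos rfl).symm
        · change (if (-1 : ℤˣ) * 1 = 1 then s else neg s)
            = if (-1 : ℤˣ) = 1 then _ else neg (if (1 : ℤˣ) = 1 then s else _)
          rw [if_pos (rfl : (1 : ℤˣ) = 1)]
          rfl
        · change s = neg (neg s)
          rw [h.neg_neg] }
  have hone (s : S) : (1 : ℤˣ) • s = s := one_smul _ s
  have hneg (s : S) : (-1 : ℤˣ) • s = neg s := rfl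
  have hq : IsQuotientCoveringMap f ℤˣ :=
    { h.isOpenQuotientMap.isQuotientMap with
      continuous_const_smul := by
        intro a
        rcases Int.units_eq_one_or a with rfl | rfl
        · exact continuous_id
        · exact h.continuous_neg
      apply_eq_iff_mem_orbit := by
        intro s s'
        constructor
        · intro hs
          rcases h.eq_or_eq_neg hs with rfl | rfl
          · exact ⟨1, rfl⟩
          · exact ⟨-1, rfl⟩
        · rintro ⟨a, rfl⟩
          rcases Int.units_eq_one_or a with rfl | rfl
          · rfl
          · exact h.map_neg s'
      disjoint := by
        intro s
        obtain ⟨i, hi⟩ := Function.ne_iff.1 (h.ne_zero s)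
        have hi' : v s i ≠ 0 := hi
        have hc : Continuous fun t => (v t i / v s i).re :=
          Complex.continuous_re.comp
            (((continuous_apply i).comp h.isInducing.continuous).div_const _)
        -- A half-space in the `i`-th coordinate is disjoint from its negative.
        refine ⟨{t | 0 < (v t i / v s i).re}, (isOpen_lt continuous_const hc).mem_nhds ?_, ?_⟩
        · simp [div_self hi']
        · rintro a ⟨_, ⟨t, ht, rfl⟩, ht'⟩
          rcases Int.units_eq_one_or a with rfl | rfl
          · rfl
          · exfalso
            change 0 < (v (neg t) i / v s i).re at ht'
            change 0 < (v t i / v s i).re at ht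
            rw [h.vec_neg, Pi.neg_apply, neg_div, Complex.neg_re] at ht'
            linarith }
  exact hq.isCoveringMap

theorem isConnectedDoubleCover [ConnectedSpace S] : IsConnectedDoubleCover f := by
  refine ⟨h.isCoveringMap, fun x => ?_, inferInstance⟩
  obtain ⟨s, rfl⟩ := h.surjective x
  have : f ⁻¹' {f s} = {s, neg s} := by
    ext t
    constructor
    · intro ht
      exact h.eq_or_eq_neg ht
    · rintro (rfl | rfl)
      · rfl
      · exact h.map_neg s
  rw [this, Set.ncard_pair (h.neg_ne s).symm]

/-- A lift of `f` to a connected double cover is a homeomorphism. -/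
theorem isHomeomorph_lift [ConnectedSpace S] {E : Type*} [TopologicalSpace E] {π : E → X}
    (hπ : IsConnectedDoubleCover π) {g : S → E} (hg : Continuous g) (hgf : π ∘ g = f) :
    IsHomeomorph g := by
  obtain ⟨hcov, hcard, hE⟩ := hπ
  have hlocal : IsLocalHomeomorph g :=
    IsLocalHomeomorph.of_comp (by rw [hgf]; exact h.isCoveringMap.isLocalHomeomorph)
      hcov.isLocalHomeomorph hg
  have hgs (s : S) : π (g s) = f s := congrFun hgf s
  -- If the two values agreed at one point, then `g ∘ neg = g` by uniqueness of lifts, so `g` would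
  -- descend to a section `σ` of `π`. Uniqueness of lifts on the connected space `E` gives `σ ∘ π =
  -- id`, so `π` would be injective, contrary to its fibres having two points.
  have hne (s : S) : g (neg s) ≠ g s := by
    intro hs
    have hgneg : g ∘ neg = g := by
      refine hcov.eq_of_comp_eq (hg.comp h.continuous_neg) hg ?_ s hs
      funext t
      simp [hgs, h.map_neg]
    have hfac : Function.FactorsThrough g f := by
      intro t t' ht
      rcases h.eq_or_eq_neg ht with rfl | rfl
      · rfl
      · exact congrFun hgneg t'
    let σ : X → E := fun x => g (Function.surjInv h.surjective x)
    have hσ (t : S) : σ (f t) = g t := hfac (Function.surjInv_eq h.surjective _)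
    have hσc : Continuous σ := by
      rw [h.isOpenQuotientMap.isQuotientMap.continuous_iff]
      convert hg using 1
      exact funext hσ
    have hid : σ ∘ π = id := by
      refine hcov.eq_of_comp_eq (hσc.comp hcov.continuous) continuous_id ?_ (g s) ?_
      · funext e
        obtain ⟨t, ht⟩ := h.surjective (π e)
        simp [← ht, hσ, hgs]
      · simp [hgs, hσ]
    have hinj : Function.Injective π := Function.LeftInverse.injective (congrFun hid)
    have := hcard (f s)
    obtain ⟨a, b, hab, hpair⟩ := Set.ncard_eq_two.1 this
    have ha : a ∈ π ⁻¹' {f s} := by rw [hpair]; simp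
    have hb : b ∈ π ⁻¹' {f s} := by rw [hpair]; simp
    exact hab (hinj (ha.trans hb.symm))
  have hinj : Function.Injective g := by
    intro s t hst
    have : f s = f t := by rw [← hgs, ← hgs, hst]
    rcases h.eq_or_eq_neg this with h1 | rfl
    · exact h1
    · exact absurd hst (hne t)
  have hsurj : Function.Surjective g := by
    intro e
    obtain ⟨s, hs⟩ := h.surjective (π e)
    have hsub : ({g s, g (neg s)} : Set E) ⊆ π ⁻¹' {π e} := by
      rintro _ (rfl | rfl)
      · exact (hgs s).trans hs
      · exact (hgs _).trans ((h.map_neg s).trans hs)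
    have hfin : (π ⁻¹' {π e}).Finite := Set.finite_of_ncard_ne_zero (by rw [hcard]; norm_num)
    have := Set.eq_of_subset_of_ncard_le hsub
      (by rw [hcard, Set.ncard_pair (hne s).symm]) hfin
    have he : e ∈ ({g s, g (neg s)} : Set E) := by rw [this]; rfl
    rcases he with rfl | rfl
    · exact ⟨_, rfl⟩
    · exact ⟨_, rfl⟩
  exact ⟨hg, hlocal.isOpenMap, hinj, hsurj⟩

end SignQuotient

/-! ### Lifted actions -/

universe u v

section

variable {E : Type u} {X : Type v} [TopologicalSpace E] [TopologicalSpace X] {π : E → X}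
  {act : SL2 → X → X}

/-- For fixed `e`, both orbit maps lift `A ↦ act A (π e)` and agree at `A = 1`. -/
theorem LiftedAction.eq_of_connectedSpace [ConnectedSpace SL2] (hπ : IsCoveringMap π)
    (a b : LiftedAction π act) : a = b := by
  ext A e
  have := hπ.eq_of_comp_eq (g₁ := fun A => a.smul A e) (g₂ := fun A => b.smul A e)
    (a.continuous.comp (Continuous.prodMk_left e)) (b.continuous.comp (Continuous.prodMk_left e))
    (funext fun A => by simp [a.lift, b.lift]) 1 (by simp [a.one_smul, b.one_smul])
  exact congrFun this A

/-- Transport of an action along a homeomorphism. -/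
def LiftedAction.ofHomeomorph {S : Type*} [TopologicalSpace S] (g : S ≃ₜ E)
    (act' : SL2 → S → S) (hone : ∀ s, act' 1 s = s)
    (hmul : ∀ A B s, act' (A * B) s = act' A (act' B s))
    (hcont : Continuous fun z : SL2 × S => act' z.1 z.2)
    (hlift : ∀ A s, π (g (act' A s)) = act A (π (g s))) : LiftedAction π act where
  smul A e := g (act' A (g.symm e))
  one_smul e := by rw [hone, g.apply_symm_apply]
  mul_smul A B e := by rw [hmul, g.symm_apply_apply]
  continuous := g.continuous.comp
    (hcont.comp (continuous_fst.prodMk (g.symm.continuous.comp continuous_snd)))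
  lift A e := by rw [hlift, g.apply_symm_apply]

theorem IsConnectedDoubleCover.surjective (hπ : IsConnectedDoubleCover π) :
    Function.Surjective π := fun x => by
  have : (π ⁻¹' {x}).Nonempty := Set.nonempty_of_ncard_ne_zero (by rw [hπ.2.1]; norm_num)
  exact this

/-- Connected double covers are stable under isomorphism. -/
theorem IsConnectedDoubleCover.of_homeomorph (hπ : IsConnectedDoubleCover π) {E' X' : Type*}
    [TopologicalSpace E'] [TopologicalSpace X'] {π' : E' → X'} (g : E ≃ₜ E') (k : X ≃ₜ X')
    (h : ∀ e, π' (g e) = k (π e)) : IsConnectedDoubleCover π' := by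
  have hπ' : π' = k ∘ π ∘ g.symm := by
    funext e
    simpa using h (g.symm e)
  refine ⟨?_, fun x => ?_, ?_⟩
  · rw [hπ']
    exact (hπ.1.comp_homeomorph g.symm).homeomorph_comp k
  · have : π' ⁻¹' {x} = g '' (π ⁻¹' {k.symm x}) := by
      ext e
      rw [g.image_eq_preimage_symm, hπ']
      simp [Homeomorph.eq_symm_apply]
    rw [this, Set.ncard_image_of_injective _ g.injective, hπ.2.1]
  · have := hπ.2.2
    exact g.surjective.connectedSpace g.continuous

end

/-! ### Lifting to covering spaces from the space of pairs of a nonzero spinor and a number -/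

section

variable {E X : Type*} [TopologicalSpace E] [TopologicalSpace X] {p : E → X}

theorem exists_lift_of_starConvex {V : Type*} [NormedAddCommGroup V] [NormedSpace ℝ V]
    (hp : IsCoveringMap p) {U : Set V} (hU : IsOpen U) {x : V} (hs : StarConvex ℝ x U)
    {f : V → X} (hf : ContinuousOn f U) {a : V} (ha : a ∈ U) {e : E} (he : p e = f a) :
    ∃ F : V → E, ContinuousOn F U ∧ F a = e ∧ ∀ y ∈ U, p (F y) = f y := by
  classical
  have := hs.contractibleSpace ⟨a, ha⟩
  have := hU.locallyPathConnectedSpace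
  obtain ⟨F, ⟨hFa, hF⟩, -⟩ := hp.existsUnique_continuousMap_lifts (A := U)
    ⟨fun y => f y.1, continuousOn_iff_continuous_domRestrict.1 hf⟩ ⟨a, ha⟩ e he
  -- The value `e` outside `U` is arbitrary.
  refine ⟨fun y => if h : y ∈ U then F ⟨y, h⟩ else e, ?_, ?_, ?_⟩
  · rw [continuousOn_iff_continuous_domRestrict]
    convert F.continuous using 1
    funext y
    simp
  · simp [ha, hFa]
  · intro y hy
    have := congrFun hF ⟨y, hy⟩
    simp only [hy, dif_pos]
    exact this

/-- The complement of the half-space of nonpositive multiples of the first basis vector. -/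
def spinorSlit : Set ((Fin 2 → ℂ) × ℂ) := {w | w.1 1 ≠ 0 ∨ w.1 0 ∈ Complex.slitPlane}

theorem isOpen_spinorSlit : IsOpen spinorSlit := by
  refine (isOpen_ne_fun (by fun_prop) continuous_const).union
    (Complex.isOpen_slitPlane.preimage (by fun_prop))

theorem starConvex_spinorSlit : StarConvex ℝ ((![1, 0], 0) : (Fin 2 → ℂ) × ℂ) spinorSlit := by
  intro w hw a b ha hb hab
  rcases hb.eq_or_lt with rfl | hb0
  · right
    simp at hab
    simp [hab]
  · rcases hw with hw | hw
    · left
      simp [hb0.ne', hw]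
    · right
      simpa using Complex.starConvex_one_slitPlane hw ha hb hab

/-- The set removed from the whole space is the real subspace on which the second coordinate and the
imaginary part of the first vanish. It has codimension 3, so its complement is connected. -/
theorem isPreconnected_spinorSlit_inter_neg :
    IsPreconnected (spinorSlit ∩ Neg.neg ⁻¹' spinorSlit) := by
  let L : ((Fin 2 → ℂ) × ℂ) →ₗ[ℝ] ℂ × ℝ :=
    { toFun := fun w => (w.1 1, (w.1 0).im)
      map_add' := fun w w' => by simp
      map_smul' := fun c w => by simp }
  have hL : Function.Surjective L := by
    rintro ⟨z, t⟩
    exact ⟨(![t * Complex.I, z], 0), by simp [L]⟩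
  have hset : spinorSlit ∩ Neg.neg ⁻¹' spinorSlit = (LinearMap.ker L : Set _)ᶜ := by
    ext w
    simp only [spinorSlit, Set.mem_inter_iff, Set.mem_ofPred_eq, Set.mem_preimage, Set.mem_compl_iff,
      SetLike.mem_coe, LinearMap.mem_ker, Complex.mem_slitPlane_iff]
    simp only [L, LinearMap.coe_mk, AddHom.coe_mk, Prod.mk_eq_zero, Prod.fst_neg, Pi.neg_apply,
      Complex.neg_re, Complex.neg_im, ne_eq, neg_eq_zero]
    by_cases h1 : w.1 1 = 0 <;> by_cases h2 : (w.1 0).im = 0 <;> simp [h1, h2]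
    intro h
    linarith
  rw [hset]
  refine (isConnected_compl_of_one_lt_codim ?_).isPreconnected
  rw [(L.quotKerEquivOfSurjective hL).rank_eq]
  simp [Complex.rank_real_complex]
  norm_num

/-- Simple connectedness by hand: the domain is the union of two open star-shaped sets, the slit set
and its negative, with connected intersection. Lifts over the two pieces that agree at one common
point agree on the intersection and glue. -/
theorem exists_lift_of_ne_zero (hp : IsCoveringMap p) (hps : Function.Surjective p)
    {f : (Fin 2 → ℂ) × ℂ → X} (hf : ContinuousOn f {w | w.1 ≠ 0}) :
    ∃ F : (Fin 2 → ℂ) × ℂ → E, ContinuousOn F {w | w.1 ≠ 0} ∧ ∀ w, w.1 ≠ 0 → p (F w) = f w := by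
  classical
  set U₁ := spinorSlit
  set U₂ := Neg.neg ⁻¹' spinorSlit with hU₂
  have hsub₁ : U₁ ⊆ {w | w.1 ≠ 0} := by
    rintro w hw h
    rcases hw with hw | hw <;> simp [h] at hw
  have hsub₂ : U₂ ⊆ {w | w.1 ≠ 0} := by
    intro w hw h
    exact hsub₁ hw (by simp [h])
  have ho₂ : IsOpen U₂ := isOpen_spinorSlit.preimage continuous_neg
  have hs₂ : StarConvex ℝ (-(![1, 0], 0) : (Fin 2 → ℂ) × ℂ) U₂ := by
    intro w hw a b ha hb hab
    have := starConvex_spinorSlit hw ha hb hab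
    change -(a • -(![1, 0], 0) + b • w) ∈ spinorSlit
    convert this using 1
    module
  let w₀ : (Fin 2 → ℂ) × ℂ := (![0, 1], 0)
  have h₁ : w₀ ∈ U₁ := Or.inl (by simp [w₀])
  have h₂ : w₀ ∈ U₂ := Or.inl (by simp [w₀])
  obtain ⟨e, he⟩ := hps (f w₀)
  obtain ⟨F₁, hF₁c, hF₁w, hF₁⟩ := exists_lift_of_starConvex hp isOpen_spinorSlit
    starConvex_spinorSlit (hf.mono hsub₁) h₁ he
  obtain ⟨F₂, hF₂c, hF₂w, hF₂⟩ := exists_lift_of_starConvex hp ho₂ hs₂ (hf.mono hsub₂) h₂ he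
  have heq : (U₁ ∩ U₂).EqOn F₁ F₂ :=
    hp.eqOn_of_comp_eqOn isPreconnected_spinorSlit_inter_neg
      (hF₁c.mono Set.inter_subset_left) (hF₂c.mono Set.inter_subset_right)
      (fun w hw => by simp [hF₁ w hw.1, hF₂ w hw.2]) ⟨h₁, h₂⟩ (hF₁w.trans hF₂w.symm)
  let F := fun w => if w ∈ U₁ then F₁ w else F₂ w
  have hF1 : ∀ w ∈ U₁, F w = F₁ w := fun w hw => if_pos hw
  have hF2 : ∀ w ∈ U₂, F w = F₂ w := fun w hw => by
    by_cases h : w ∈ U₁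
    · rw [hF1 w h, heq ⟨h, hw⟩]
    · exact if_neg h
  have hcover : ∀ w : (Fin 2 → ℂ) × ℂ, w.1 ≠ 0 → w ∈ U₁ ∨ w ∈ U₂ := by
    intro w hw
    by_contra! h
    simp only [U₁, hU₂, spinorSlit, Set.mem_preimage, Set.mem_ofPred_eq, not_or,
      Complex.mem_slitPlane_iff, not_lt, not_not, Prod.fst_neg, Pi.neg_apply, Complex.neg_re,
      Complex.neg_im, ne_eq] at h
    apply hw
    funext i
    fin_cases i
    · apply Complex.ext <;> simp <;> linarith
    · exact h.1.1
  refine ⟨F, fun w hw => ContinuousAt.continuousWithinAt ?_, fun w hw => ?_⟩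
  · rcases hcover w hw with h | h
    · refine (hF₁c.continuousAt (isOpen_spinorSlit.mem_nhds h)).congr ?_
      filter_upwards [isOpen_spinorSlit.mem_nhds h] with y hy using (hF1 y hy).symm
    · refine (hF₂c.continuousAt (ho₂.mem_nhds h)).congr ?_
      filter_upwards [ho₂.mem_nhds h] with y hy using (hF2 y hy).symm
  · rcases hcover w hw with h | h
    · rw [hF1 w h, hF₁ w h]
    · rw [hF2 w h, hF₂ w h]

end

/-! ### The action on spinors -/

theorem Spinor.act_one (κ : Spinor) : Spinor.act 1 κ = κ :=
  Subtype.ext (by simp [Spinor.act])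

theorem Spinor.act_mul (A B : SL2) (κ : Spinor) :
    Spinor.act (A * B) κ = Spinor.act A (Spinor.act B κ) :=
  Subtype.ext (mulVec_mulVec κ.1 A.1 B.1).symm

theorem Spinor.continuous_act : Continuous fun z : SL2 × Spinor => Spinor.act z.1 z.2 := by
  refine Continuous.subtype_mk ?_ _
  exact Continuous.matrix_mulVec (continuous_subtype_val.comp continuous_fst)
    (continuous_subtype_val.comp continuous_snd)

/-- The opposite of a spinor. -/
def Spinor.neg (κ : Spinor) : Spinor := ⟨-κ.1, neg_ne_zero.2 κ.2⟩

theorem Spinor.act_neg (A : SL2) (κ : Spinor) : Spinor.act A κ.neg = (Spinor.act A κ).neg :=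
  Subtype.ext (by simp [Spinor.act, Spinor.neg, mulVec_neg])

theorem Spinor.neg_act (A : SL2) (κ : Spinor) : Spinor.act (-A) κ = (Spinor.act A κ).neg :=
  Subtype.ext (by simp [Spinor.act, Spinor.neg, neg_mulVec])

/-- The first basis spinor. -/
def Spinor.e : Spinor := ⟨![1, 0], fun h => one_ne_zero (congrFun h 0)⟩

theorem Spinor.act_e (A : SL2) : (Spinor.act A Spinor.e).1 = fun i => A.1 i 0 := by
  funext i
  simp [Spinor.act, Spinor.e]
  fin_cases i <;> rfl

theorem Spinor.normSq_ne_zero (κ : Spinor) : κ.1 0 * star (κ.1 0) + κ.1 1 * star (κ.1 1) ≠ 0 := by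
  intro h
  apply κ.2
  have h1 := congrArg Complex.re h
  simp at h1
  funext i
  apply Complex.ext <;> fin_cases i <;> simp <;>
    nlinarith [sq_nonneg (κ.1 0).re, sq_nonneg (κ.1 0).im, sq_nonneg (κ.1 1).re,
      sq_nonneg (κ.1 1).im]

/-- An element of `SL(2,ℂ)` with first column `κ`. -/
def Spinor.toSL (κ : Spinor) : SL2 :=
  -- The second column is orthogonal to `κ` and divided by `|κ|²`. This makes the determinant 1 and
  -- gives a global section of `A ↦ A e` that is smooth in `κ`.
  ⟨!![κ.1 0, -star (κ.1 1) / (κ.1 0 * star (κ.1 0) + κ.1 1 * star (κ.1 1));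
      κ.1 1, star (κ.1 0) / (κ.1 0 * star (κ.1 0) + κ.1 1 * star (κ.1 1))], by
    have := κ.normSq_ne_zero
    rw [det_fin_two_of]
    field_simp
    ring⟩

theorem Spinor.toSL_act_e (κ : Spinor) : Spinor.act κ.toSL Spinor.e = κ := by
  apply Subtype.ext
  rw [Spinor.act_e]
  funext i
  fin_cases i <;> simp [Spinor.toSL]

theorem Spinor.toSL_inv_act (κ : Spinor) : Spinor.act κ.toSL⁻¹ κ = Spinor.e := by
  have := congrArg (Spinor.act κ.toSL⁻¹) κ.toSL_act_e
  rwa [← Spinor.act_mul, inv_mul_cancel, Spinor.act_one, eq_comm] at this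

theorem Spinor.exists_act_eq (κ κ' : Spinor) : ∃ A : SL2, Spinor.act A κ = κ' :=
  ⟨κ'.toSL * κ.toSL⁻¹, by rw [Spinor.act_mul, Spinor.toSL_inv_act, Spinor.toSL_act_e]⟩

theorem Spinor.continuous_toSL : Continuous Spinor.toSL := by
  have h (i : Fin 2) : Continuous fun κ : Spinor => κ.1 i :=
    (continuous_apply i).comp continuous_subtype_val
  refine Continuous.subtype_mk (continuous_matrix ?_) _
  have hd : Continuous fun κ : Spinor => κ.1 0 * star (κ.1 0) + κ.1 1 * star (κ.1 1) :=
    ((h 0).mul (h 0).star).add ((h 1).mul (h 1).star)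
  intro i j
  fin_cases i <;> fin_cases j
  · exact h 0
  · exact (h 1).star.neg.div hd fun κ => κ.normSq_ne_zero
  · exact h 1
  · exact (h 0).star.div hd fun κ => κ.normSq_ne_zero

/-- The unipotent upper triangular matrix with off-diagonal entry `z`. -/
def unip (z : ℂ) : SL2 := ⟨!![1, z; 0, 1], by simp [det_fin_two_of]⟩

theorem unip_zero : unip 0 = 1 := by
  apply Subtype.ext
  ext i j
  fin_cases i <;> fin_cases j <;> simp [unip]

theorem unip_act_e (z : ℂ) : Spinor.act (unip z) Spinor.e = Spinor.e := by
  apply Subtype.ext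
  rw [Spinor.act_e]
  funext i
  fin_cases i <;> simp [unip, Spinor.e]

theorem continuous_unip : Continuous unip := by
  refine Continuous.subtype_mk (continuous_matrix ?_) _
  intro i j
  fin_cases i <;> fin_cases j <;> simp <;> fun_prop

theorem eq_unip_of_act_e {A : SL2} (h : Spinor.act A Spinor.e = Spinor.e) :
    A = unip (A.1 0 1) := by
  have h1 := congrArg Subtype.val h
  rw [Spinor.act_e] at h1
  have h0 : A.1 0 0 = 1 := by simpa [Spinor.e] using congrFun h1 0
  have h2 : A.1 1 0 = 0 := by simpa [Spinor.e] using congrFun h1 1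
  have hd := A.2
  rw [det_fin_two, h0, h2] at hd
  have h3 : A.1 1 1 = 1 := by simpa using hd
  apply Subtype.ext
  ext i j
  fin_cases i <;> fin_cases j <;> simp [unip, h0, h2, h3]

/-- The stabiliser of `e` is the unipotent group, and `toSL` is a section of the orbit map. This is
the trivialisation `SL(2,ℂ) ≅ (ℂ²∖0) × ℂ` that reduces connectedness and lifting to the space of
pairs. -/
theorem eq_toSL_mul_unip (A : SL2) : A = (Spinor.act A Spinor.e).toSL *
    unip (((Spinor.act A Spinor.e).toSL⁻¹ * A).1 0 1) := by
  rw [← eq_unip_of_act_e, mul_inv_cancel_left]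
  rw [Spinor.act_mul, Spinor.toSL_inv_act]

theorem Spinor.continuous_act_e : Continuous fun A : SL2 => Spinor.act A Spinor.e :=
  Spinor.continuous_act.comp (Continuous.prodMk_left _)

instance : ConnectedSpace Spinor := by
  have h : IsConnected ({0}ᶜ : Set (Fin 2 → ℂ)) := by
    refine isConnected_compl_singleton_of_one_lt_rank ?_ _
    rw [← Module.finrank_eq_rank, Module.finrank_pi_fintype]
    simp [Complex.finrank_real_complex]
  exact isConnected_iff_connectedSpace.1 h

instance : ConnectedSpace SL2 := by
  refine Function.Surjective.connectedSpace (f := fun w : Spinor × ℂ => w.1.toSL * unip w.2) ?_ ?_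
  · intro A
    exact ⟨(_, _), (eq_toSL_mul_unip A).symm⟩
  · exact (Spinor.continuous_toSL.comp continuous_fst).mul (continuous_unip.comp continuous_snd)

section

variable {E X : Type*} [TopologicalSpace E] [TopologicalSpace X] {p : E → X}

/-- Continuous maps from `SL(2,ℂ)` lift to covering spaces. -/
theorem exists_lift_SL (hp : IsCoveringMap p) (hps : Function.Surjective p) {f : SL2 → X}
    (hf : Continuous f) : ∃ F : SL2 → E, Continuous F ∧ p ∘ F = f := by
  classical
  -- The value `1` at a zero first component is arbitrary; `k` below is a right inverse of `m` that
  -- avoids that locus.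
  let m : (Fin 2 → ℂ) × ℂ → SL2 := fun w =>
    if h : w.1 ≠ 0 then Spinor.toSL ⟨w.1, h⟩ * unip w.2 else 1
  have hm : ContinuousOn m {w | w.1 ≠ 0} := by
    rw [continuousOn_iff_continuous_domRestrict]
    have : ({w : (Fin 2 → ℂ) × ℂ | w.1 ≠ 0}).domRestrict m
        = fun w => Spinor.toSL ⟨w.1.1, w.2⟩ * unip w.1.2 := funext fun w => dif_pos w.2
    rw [this]
    exact (Spinor.continuous_toSL.comp (Continuous.subtype_mk
      (continuous_fst.comp continuous_subtype_val) _)).mul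
      (continuous_unip.comp (continuous_snd.comp continuous_subtype_val))
  obtain ⟨F, hF, hF'⟩ := exists_lift_of_ne_zero hp hps (hf.comp_continuousOn hm)
  let k : SL2 → (Fin 2 → ℂ) × ℂ := fun A =>
    ((Spinor.act A Spinor.e).1, ((Spinor.act A Spinor.e).toSL⁻¹ * A).1 0 1)
  have hk : Continuous k := by
    have h1 : Continuous fun A : SL2 => (Spinor.act A Spinor.e).toSL⁻¹ * A :=
      (Spinor.continuous_toSL.comp Spinor.continuous_act_e).inv.mul continuous_id
    exact (continuous_subtype_val.comp Spinor.continuous_act_e).prodMk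
      ((continuous_subtype_val.comp h1).matrix_elem 0 1)
  have hk0 (A : SL2) : (k A).1 ≠ 0 := (Spinor.act A Spinor.e).2
  refine ⟨F ∘ k, hF.comp_continuous hk hk0, funext fun A => ?_⟩
  have : m (k A) = A := by
    simp only [m, dif_pos (hk0 A)]
    exact (eq_toSL_mul_unip A).symm
  simp [hF' _ (hk0 A), this]

/-- Continuous maps from the space of spinors lift to covering spaces. -/
theorem exists_lift_spinor (hp : IsCoveringMap p) (hps : Function.Surjective p) {f : Spinor → X}
    (hf : Continuous f) : ∃ F : Spinor → E, Continuous F ∧ p ∘ F = f := by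
  -- The map is pulled back along `A ↦ A e`, lifted there, and restricted to the section `toSL`.
  obtain ⟨F, hF, hF'⟩ := exists_lift_SL hp hps (hf.comp Spinor.continuous_act_e)
  refine ⟨F ∘ Spinor.toSL, hF.comp Spinor.continuous_toSL, funext fun κ => ?_⟩
  have := congrFun hF' κ.toSL
  simpa [Spinor.toSL_act_e] using this

end

/-! ### Flags -/

theorem NullFlag.exists_eq_flagOf (f : NullFlag) {u : Mink} (hu : u ∈ f.pos) :
    ∃ x : FlagPair, x.1 = (f.pt, u) ∧ f = flagOf x := by
  obtain ⟨v, hv, hv', hpos⟩ := f.pos_eq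
  obtain ⟨a, b, hb, rfl⟩ : ∃ a b : ℝ, 0 < b ∧ u = a • f.pt + b • v := by
    rw [hpos] at hu; exact hu
  have hmem : a • f.pt + b • v ∈ f.plane :=
    add_mem (Submodule.smul_mem _ _ f.pt_mem_plane) (Submodule.smul_mem _ _ hv)
  have hx : a • f.pt + b • v ∉ Submodule.span ℝ {f.pt} := by
    intro h
    apply hv'
    have h1 := Submodule.sub_mem _ h (Submodule.smul_mem _ a (Submodule.mem_span_singleton_self f.pt))
    rw [add_sub_cancel_left] at h1
    exact (Submodule.smul_mem_iff _ hb.ne').1 h1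
  refine ⟨⟨(f.pt, a • f.pt + b • v), f.pt_mem, f.tangent _ hmem, hx⟩, rfl, ?_⟩
  set x : FlagPair := ⟨(f.pt, a • f.pt + b • v), f.pt_mem, f.tangent _ hmem, hx⟩ with hxdef
  ext1
  · rfl
  · symm
    refine Submodule.eq_of_le_of_finrank_eq ?_ ?_
    · refine Submodule.span_le.2 ?_
      rintro w (rfl | rfl)
      · exact f.pt_mem_plane
      · exact hmem
    · rw [(flagOf x).finrank_plane, f.finrank_plane]
  · rw [hpos]
    ext w
    constructor
    · rintro ⟨c, d, hd, rfl⟩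
      refine ⟨c - d / b * a, d / b, div_pos hd hb, ?_⟩
      change _ = (c - d / b * a) • f.pt + (d / b) • (a • f.pt + b • v)
      rw [smul_add, smul_smul, smul_smul, div_mul_cancel₀ _ hb.ne', sub_smul]
      abel
    · rintro ⟨c, d, hd, rfl⟩
      refine ⟨c + d * a, d * b, mul_pos hd hb, ?_⟩
      change c • f.pt + d • (a • f.pt + b • v) = _
      rw [smul_add, smul_smul, smul_smul, add_smul]
      abel

/-- By `exists_eq_flagOf` both flags are `[[p, u]]`. Most equalities of flags below are checked by
exhibiting one common positive vector. -/
theorem NullFlag.eq_of_mem_pos {f f' : NullFlag} (hpt : f.pt = f'.pt) {u : Mink} (hu : u ∈ f.pos)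
    (hu' : u ∈ f'.pos) : f = f' := by
  obtain ⟨x, hx, rfl⟩ := f.exists_eq_flagOf hu
  obtain ⟨x', hx', rfl⟩ := f'.exists_eq_flagOf hu'
  have : x = x' := Subtype.ext (by rw [hx, hx', hpt])
  rw [this]

theorem NullFlag.pos_nonempty (f : NullFlag) : f.pos.Nonempty := by
  obtain ⟨v, -, -, hpos⟩ := f.pos_eq
  exact ⟨v, by rw [hpos]; exact ⟨0, 1, one_pos, by simp⟩⟩

theorem mem_pos_flagOf {x : FlagPair} : x.1.2 ∈ (flagOf x).pos := ⟨0, 1, one_pos, by simp⟩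

theorem NullFlag.act_one (f : NullFlag) : f.act 1 = f := by
  obtain ⟨u, hu⟩ := f.pos_nonempty
  exact NullFlag.eq_of_mem_pos (lorentz_one _) (u := u) ⟨u, hu, lorentz_one u⟩ hu

theorem NullFlag.act_mul (A B : SL2) (f : NullFlag) : f.act (A * B) = (f.act B).act A := by
  obtain ⟨u, hu⟩ := f.pos_nonempty
  exact NullFlag.eq_of_mem_pos (lorentz_mul _ _ _) (u := lorentz (A * B) u) ⟨u, hu, rfl⟩
    ⟨lorentz B u, ⟨u, hu, rfl⟩, (lorentz_mul A B u).symm⟩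

/-- The tangent vector `κ w* + w κ*`. -/
def spinorTangent (κ w : Fin 2 → ℂ) : Mink := ofHerm (vecMulVec κ (star w) + vecMulVec w (star κ))

theorem lorentz_ofHerm (A : SL2) {S : Matrix (Fin 2) (Fin 2) ℂ} (hS : S.IsHermitian) :
    lorentz A (ofHerm S) = ofHerm (A.1 * S * A.1ᴴ) := by
  rw [lorentz_apply, toHerm_ofHerm hS]

theorem mul_vecMulVec_mul_conjTranspose (A : Matrix (Fin 2) (Fin 2) ℂ) (κ w : Fin 2 → ℂ) :
    A * vecMulVec κ (star w) * Aᴴ = vecMulVec (A *ᵥ κ) (star (A *ᵥ w)) := by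
  rw [mul_vecMulVec, vecMulVec_mul, star_mulVec]

theorem isHermitian_vecMulVec_star_self (κ : Fin 2 → ℂ) : (vecMulVec κ (star κ)).IsHermitian := by
  ext i j
  simp [vecMulVec_apply, mul_comm]

theorem lorentz_phi (A : SL2) (κ : Fin 2 → ℂ) : lorentz A (phi κ) = phi (A.1 *ᵥ κ) := by
  rw [phi, lorentz_ofHerm A (isHermitian_vecMulVec_star_self κ), mul_vecMulVec_mul_conjTranspose]
  rfl

theorem lorentz_spinorTangent (A : SL2) (κ w : Fin 2 → ℂ) :
    lorentz A (spinorTangent κ w) = spinorTangent (A.1 *ᵥ κ) (A.1 *ᵥ w) := by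
  rw [spinorTangent, lorentz_ofHerm A, mul_add, add_mul, mul_vecMulVec_mul_conjTranspose,
    mul_vecMulVec_mul_conjTranspose]
  · rfl
  · ext i j
    simp [vecMulVec_apply]
    ring

/-- Only the real part of `a` survives, because moving `κ` in the direction `iκ` changes only its
phase and fixes `κκ*`. -/
theorem spinorTangent_add_smul (κ w : Fin 2 → ℂ) (a : ℂ) (b : ℝ) :
    spinorTangent κ (a • κ + (b : ℂ) • w) = (2 * a.re) • phi κ + b • spinorTangent κ w := by
  ext i
  fin_cases i <;> simp [spinorTangent, phi, ofHerm, vecMulVec_apply] <;> ring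

/-- The direction `Z` is not equivariant, but its failure to be so does not change the flag. As
`det(κ, Zκ) = -i|κ|²` and `det A = 1`, Cramer's rule in the basis `Aκ, A(Zκ)` gives `Z(Aκ) = c·Aκ +
(|Aκ|²/|κ|²)·A(Zκ)`: the second coefficient is real and positive, and the first contributes only a
multiple of the point. -/
theorem dphi_act (A : SL2) (κ : Spinor) : ∃ a b : ℝ, 0 < b ∧
    dphi (A.1 *ᵥ κ.1) = a • lorentz A (phi κ.1) + b • lorentz A (dphi κ.1) := by
  set x := A.1 *ᵥ κ.1 with hx
  set y := A.1 *ᵥ zdir κ.1 with hy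
  have hpos (κ : Spinor) : 0 < (κ.1 0).re ^ 2 + (κ.1 0).im ^ 2 + (κ.1 1).re ^ 2 + (κ.1 1).im ^ 2 := by
    have := (phi_pair κ).1.2
    rw [phi_coords] at this
    exact this
  have hκ := hpos κ
  have hx' := hpos (Spinor.act A κ)
  change 0 < (x 0).re ^ 2 + (x 0).im ^ 2 + (x 1).re ^ 2 + (x 1).im ^ 2 at hx'
  set n := (κ.1 0).re ^ 2 + (κ.1 0).im ^ 2 + (κ.1 1).re ^ 2 + (κ.1 1).im ^ 2 with hn
  set m := (x 0).re ^ 2 + (x 0).im ^ 2 + (x 1).re ^ 2 + (x 1).im ^ 2 with hm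
  have hstar (z : ℂ) : z * star z = ((z.re ^ 2 + z.im ^ 2 : ℝ) : ℂ) := by
    apply Complex.ext <;> simp [-Complex.ofReal_add, -Complex.ofReal_pow] <;> ring
  have h0 (κ : Fin 2 → ℂ) : zdir κ 0 = Complex.I * star (κ 1) := rfl
  have h1 (κ : Fin 2 → ℂ) : zdir κ 1 = -Complex.I * star (κ 0) := rfl
  have hdetx : x 0 * zdir x 1 - x 1 * zdir x 0 = -Complex.I * m := by
    rw [h0, h1, hm]
    have e0 := hstar (x 0)
    have e1 := hstar (x 1)
    push_cast at e0 e1 ⊢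
    linear_combination -Complex.I * e0 - Complex.I * e1
  have hdetκ : κ.1 0 * zdir κ.1 1 - κ.1 1 * zdir κ.1 0 = -Complex.I * n := by
    rw [h0, h1, hn]
    have e0 := hstar (κ.1 0)
    have e1 := hstar (κ.1 1)
    push_cast at e0 e1 ⊢
    linear_combination -Complex.I * e0 - Complex.I * e1
  have hdet : x 0 * y 1 - x 1 * y 0 = -Complex.I * n := by
    rw [← hdetκ, hx, hy]
    have hA := A.2
    rw [det_fin_two] at hA
    simp only [mulVec, dotProduct, Fin.sum_univ_two]
    linear_combination (κ.1 0 * zdir κ.1 1 - κ.1 1 * zdir κ.1 0) * hA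
  have hn0 : (n : ℂ) ≠ 0 := by exact_mod_cast hκ.ne'
  have hI := Complex.I_ne_zero
  obtain ⟨c, key⟩ : ∃ c : ℂ, zdir x = c • x + ((m / n : ℝ) : ℂ) • y := by
    refine ⟨(zdir x 0 * y 1 - zdir x 1 * y 0) / (-Complex.I * n), ?_⟩
    have e : ((m / n : ℝ) : ℂ) = (-Complex.I * m) / (-Complex.I * n) := by
      push_cast
      field_simp
    rw [e, ← hdetx, ← hdet]
    have hd0 : x 0 * y 1 - x 1 * y 0 ≠ 0 := by
      rw [hdet]
      exact mul_ne_zero (neg_ne_zero.2 hI) hn0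
    funext i
    apply mul_left_cancel₀ hd0
    rw [Pi.add_apply, Pi.smul_apply, Pi.smul_apply, smul_eq_mul, smul_eq_mul, mul_add,
      ← mul_assoc, ← mul_assoc, mul_div_cancel₀ _ hd0, mul_div_cancel₀ _ hd0]
    fin_cases i <;> simp <;> ring
  have e1 : dphi x = spinorTangent x (zdir x) := dphi_eq x
  have e2 : dphi κ.1 = spinorTangent κ.1 (zdir κ.1) := dphi_eq κ.1
  refine ⟨2 * c.re, m / n, div_pos hx' hκ, ?_⟩
  rw [e1, key, spinorTangent_add_smul, lorentz_phi, e2, lorentz_spinorTangent]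

theorem spinorFlag_act (A : SL2) (κ : Spinor) :
    spinorFlag (Spinor.act A κ) = (spinorFlag κ).act A := by
  obtain ⟨a, b, hb, h⟩ := dphi_act A κ
  refine NullFlag.eq_of_mem_pos ?_ (u := dphi (Spinor.act A κ).1) mem_pos_flagOf ?_
  · exact (lorentz_phi A κ.1).symm
  · refine ⟨a • phi κ.1 + b • dphi κ.1, ⟨a, b, hb, rfl⟩, ?_⟩
    rw [map_add, map_smul, map_smul]
    exact h.symm

theorem exists_phi_eq {p : Mink} (hp : p ∈ LightCone) : ∃ κ : Spinor, phi κ.1 = p := by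
  obtain ⟨hpp, hp0⟩ := hp
  simp only [mink] at hpp
  suffices ∃ κ : Fin 2 → ℂ, phi κ = p by
    obtain ⟨κ, h⟩ := this
    refine ⟨⟨κ, ?_⟩, h⟩
    rintro rfl
    rw [← h] at hp0
    simp [phi_coords] at hp0
  have hm : 0 ≤ p 0 + p 3 := by nlinarith [sq_nonneg (p 1), sq_nonneg (p 2)]
  -- The number `(T + Z)/2` is the entry `|ξ|²` of the matrix `κκ*`. If it vanishes, `κ = (0, √T)`;
  -- otherwise `ξ` is taken real and positive and `η` is read off from the off-diagonal entry.
  rcases hm.eq_or_lt with h | h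
  · have h1 : p 1 = 0 := by nlinarith [sq_nonneg (p 1), sq_nonneg (p 2)]
    have h2 : p 2 = 0 := by nlinarith [sq_nonneg (p 1), sq_nonneg (p 2)]
    have hs := Real.sq_sqrt hp0.le
    refine ⟨![0, (Real.sqrt (p 0) : ℂ)], ?_⟩
    rw [phi_coords]
    ext i
    fin_cases i <;> (simp [hs, h1, h2]; try linarith)
  · have hs := Real.sq_sqrt (show 0 ≤ (p 0 + p 3) / 2 by linarith)
    have hs0 : 0 < Real.sqrt ((p 0 + p 3) / 2) := Real.sqrt_pos.2 (by linarith)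
    set s := Real.sqrt ((p 0 + p 3) / 2)
    refine ⟨![(s : ℂ), ⟨p 1 / (2 * s), -p 2 / (2 * s)⟩], ?_⟩
    have key : (p 1 / (2 * s)) ^ 2 + (-p 2 / (2 * s)) ^ 2 = (p 0 - p 3) / 2 := by
      rw [div_pow, div_pow, mul_pow, hs]
      field_simp
      linarith
    rw [phi_coords]
    ext i
    fin_cases i <;> simp
    · linarith
    · field_simp
    · field_simp
    · linarith

theorem spinorFlag_surjective : Function.Surjective spinorFlag := by
  intro f
  obtain ⟨κ, hκ⟩ := exists_phi_eq f.pt_mem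
  set A := κ.toSL
  -- By equivariance the point of the flag may be taken to be `phi e = (1, 0, 0, 1)`.
  suffices ∃ κ', spinorFlag κ' = f.act A⁻¹ by
    obtain ⟨κ', h⟩ := this
    refine ⟨Spinor.act A κ', ?_⟩
    rw [spinorFlag_act, h, ← NullFlag.act_mul, mul_inv_cancel, NullFlag.act_one]
  set f' := f.act A⁻¹
  have hpt : f'.pt = phi Spinor.e.1 := by
    change lorentz A⁻¹ f.pt = _
    rw [← hκ, lorentz_phi]
    exact congrArg phi (congrArg Subtype.val κ.toSL_inv_act)
  have hpt' : f'.pt = ![1, 0, 0, 1] := by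
    rw [hpt, phi_coords]
    simp [Spinor.e]
  clear_value f'
  clear hκ hpt
  obtain ⟨v, hv, hv', hpos⟩ := f'.pos_eq
  have htan := f'.tangent v hv
  have h03 : v 3 = v 0 := by
    rw [hpt'] at htan
    simp [mink] at htan
    linarith
  -- For `κ = (ξ, 0)` the vector `dphi κ` has `X + iY = 2i ξ²`. So `ξ²` must be a positive multiple
  -- of `v₂ - i v₁`; the normalisation `ξ = s/|s|` makes the point equal to `(1, 0, 0, 1)`.
  obtain ⟨s, hs⟩ := IsAlgClosed.exists_pow_nat_eq (⟨v 2, -v 1⟩ : ℂ) (n := 2) (by norm_num)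
  have hs0 : s ≠ 0 := by
    rintro rfl
    apply hv'
    have h1 := congrArg Complex.re hs
    have h2 := congrArg Complex.im hs
    simp at h1 h2
    refine Submodule.mem_span_singleton.2 ⟨v 0, ?_⟩
    rw [hpt']
    ext i
    fin_cases i <;> simp [← h1, h2, h03]
  have hn : 0 < Complex.normSq s := Complex.normSq_pos.2 hs0
  have hsn : (Real.sqrt (Complex.normSq s)) ^ 2 = Complex.normSq s := Real.sq_sqrt hn.le
  have hr0 : 0 < Real.sqrt (Complex.normSq s) := Real.sqrt_pos.2 hn
  set r := Real.sqrt (Complex.normSq s)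
  have hre := congrArg Complex.re hs
  have him := congrArg Complex.im hs
  simp [pow_two] at hre him
  rw [Complex.normSq_apply] at hsn
  refine ⟨⟨![⟨s.re / r, s.im / r⟩, 0], ?_⟩, ?_⟩
  · intro h
    have h0 := congrFun h 0
    simp [Complex.ext_iff, hr0.ne'] at h0
    exact hs0 (Complex.ext h0.1 h0.2)
  · refine NullFlag.eq_of_mem_pos ?_ mem_pos_flagOf ?_
    · rw [hpt']
      change phi _ = _
      rw [phi_coords]
      have : (s.re / r) ^ 2 + (s.im / r) ^ 2 = 1 := by
        rw [div_pow, div_pow, ← add_div, div_eq_one_iff_eq (by positivity)]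
        linarith
      simp [this]
    · rw [hpos]
      refine ⟨-(2 / r ^ 2 * v 0), 2 / r ^ 2, by positivity, ?_⟩
      change dphi _ = _
      rw [dphi_coords, hpt']
      ext i
      fin_cases i <;> simp
      · field_simp
        linarith
      · field_simp
        linarith
      · rw [h03]; ring

/-! ### Flags and products of spinor coordinates -/

/-- The products of the coordinates of a spinor `κ` in terms of the bivector of
`(phi κ, dphi κ)`. -/
def bivectorProducts (x : Mink × Mink) : Fin 2 → Fin 2 → ℂ :=
  -- For `(phi κ, dphi κ)` the square root is `2 (phi κ)₀`, and the combinations of bivector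
  -- components below are the real and imaginary parts of `κ_i κ_j` times `4 (phi κ)₀`.
  let r := (2 * Real.sqrt (-mink x.2 x.2))⁻¹
  let P (i j : Fin 4) : ℝ := x.1 i * x.2 j - x.1 j * x.2 i
  let d : ℂ := (r * P 1 2 : ℝ) + (r * P 0 3 : ℝ) * Complex.I
  ![![(r * (P 0 2 + P 3 2) : ℝ) + (r * -(P 0 1 + P 3 1) : ℝ) * Complex.I, d],
    ![d, (r * (P 0 2 - P 3 2) : ℝ) + (r * (P 0 1 - P 3 1) : ℝ) * Complex.I]]

/-- The bivector `p ∧ v` ignores multiples of `p` added to `v` and is scaled by `b`, as is `√(-⟨v,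
v⟩)`. So the products depend on the flag only. -/
theorem bivectorProducts_add_smul {p v : Mink} (hp : mink p p = 0) (hv : mink v p = 0) (a : ℝ)
    {b : ℝ} (hb : 0 < b) : bivectorProducts (p, a • p + b • v) = bivectorProducts (p, v) := by
  have h1 : mink (a • p + b • v) (a • p + b • v) = b ^ 2 * mink v v := by
    have : mink (a • p + b • v) (a • p + b • v)
        = a ^ 2 * mink p p + 2 * a * b * mink v p + b ^ 2 * mink v v := by
      simp [mink]; ring
    rw [this, hp, hv]
    ring
  have h2 : Real.sqrt (-(b ^ 2 * mink v v)) = b * Real.sqrt (-mink v v) := by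
    rw [← mul_neg, Real.sqrt_mul (sq_nonneg b), Real.sqrt_sq hb.le]
  have h3 (i j : Fin 4) : (2 * (b * Real.sqrt (-mink v v)))⁻¹ *
      (p i * (a • p + b • v) j - p j * (a • p + b • v) i)
      = (2 * Real.sqrt (-mink v v))⁻¹ * (p i * v j - p j * v i) := by
    have : p i * (a • p + b • v) j - p j * (a • p + b • v) i = b * (p i * v j - p j * v i) := by
      simp
      ring
    rw [this, mul_left_comm 2 b, mul_inv]
    field_simp
  simp only [bivectorProducts, h1, h2, mul_add, mul_sub, mul_neg] at h3 ⊢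
  simp only [← mul_sub, h3]

theorem bivectorProducts_phi (κ : Spinor) (i j : Fin 2) :
    bivectorProducts (phi κ.1, dphi κ.1) i j = κ.1 i * κ.1 j := by
  have hpos := (phi_pair κ).1.2
  have hm : -mink (dphi κ.1) (dphi κ.1) = (2 * phi κ.1 0) ^ 2 := by
    rw [dphi_coords, phi_coords]
    simp [mink]
    ring
  have hs : Real.sqrt (-mink (dphi κ.1) (dphi κ.1)) = 2 * phi κ.1 0 := by
    rw [hm, Real.sqrt_sq (by linarith)]
  have key (z : ℂ) (s t : ℝ) (hs : s = 4 * phi κ.1 0 * z.re) (ht : t = 4 * phi κ.1 0 * z.im) :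
      (((2 * (2 * phi κ.1 0))⁻¹ * s : ℝ) : ℂ) + (((2 * (2 * phi κ.1 0))⁻¹ * t : ℝ) : ℂ) * Complex.I
      = z := by
    have e (w : ℝ) : (2 * (2 * phi κ.1 0))⁻¹ * (4 * phi κ.1 0 * w) = w := by
      field_simp
      ring
    rw [hs, ht, e, e, Complex.re_add_im]
  simp only [bivectorProducts, hs]
  fin_cases i <;> fin_cases j <;> apply key <;> rw [dphi_coords, phi_coords] <;> simp <;> ring

/-- The products of the coordinates of the spinors of a flag. -/
def flagProducts (f : NullFlag) : Fin 2 → Fin 2 → ℂ :=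
  bivectorProducts (f.pt, f.pos_nonempty.some)

theorem flagProducts_eq (f : NullFlag) {u : Mink} (hu : u ∈ f.pos) :
    flagProducts f = bivectorProducts (f.pt, u) := by
  have h := f.pos_nonempty.some_mem
  obtain ⟨x, hx, hf⟩ := f.exists_eq_flagOf hu
  have hpos := congrArg NullFlag.pos hf
  rw [flagProducts]
  set w := f.pos_nonempty.some
  rw [hpos] at h
  obtain ⟨a, b, hb, hw⟩ := h
  rw [hx] at hw
  rw [hw]
  exact bivectorProducts_add_smul f.pt_mem.1 (f.pos_tangent hu) a hb

theorem flagProducts_flagOf (x : FlagPair) : flagProducts (flagOf x) = bivectorProducts x.1 :=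
  flagProducts_eq _ mem_pos_flagOf

theorem contDiffAt_bivectorProducts {n : WithTop ℕ∞} {x : Mink × Mink} (hx : mink x.2 x.2 < 0) :
    ContDiffAt ℝ n bivectorProducts x := by
  have h1 (i : Fin 4) : ContDiffAt ℝ n (fun x : Mink × Mink => x.1 i) x := by fun_prop
  have h2 (i : Fin 4) : ContDiffAt ℝ n (fun x : Mink × Mink => x.2 i) x := by fun_prop
  have hr : ContDiffAt ℝ n (fun x : Mink × Mink => (2 * Real.sqrt (-mink x.2 x.2))⁻¹) x := by
    refine ContDiffAt.inv (contDiffAt_const.mul (ContDiffAt.sqrt ?_ ?_)) ?_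
    · unfold mink
      fun_prop
    · linarith
    · have := Real.sqrt_pos.2 (show 0 < -mink x.2 x.2 by linarith)
      positivity
  have hP (i j : Fin 4) :
      ContDiffAt ℝ n (fun x : Mink × Mink => x.1 i * x.2 j - x.1 j * x.2 i) x :=
    ((h1 i).mul (h2 j)).sub ((h1 j).mul (h2 i))
  have hof {g : Mink × Mink → ℝ} (hg : ContDiffAt ℝ n g x) :
      ContDiffAt ℝ n (fun y => (g y : ℂ)) x :=
    Complex.ofRealCLM.contDiff.contDiffAt.comp x hg
  have hcomb {g k : Mink × Mink → ℝ} (hg : ContDiffAt ℝ n g x) (hk : ContDiffAt ℝ n k x) :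
      ContDiffAt ℝ n (fun y => (g y : ℂ) + (k y : ℂ) * Complex.I) x :=
    (hof hg).add ((hof hk).mul contDiffAt_const)
  rw [contDiffAt_pi]
  intro i
  rw [contDiffAt_pi]
  intro j
  fin_cases i <;> fin_cases j
  · exact hcomb (hr.mul ((hP 0 2).add (hP 3 2))) (hr.mul ((hP 0 1).add (hP 3 1)).neg)
  · exact hcomb (hr.mul (hP 1 2)) (hr.mul (hP 0 3))
  · exact hcomb (hr.mul (hP 1 2)) (hr.mul (hP 0 3))
  · exact hcomb (hr.mul ((hP 0 2).sub (hP 3 2))) (hr.mul ((hP 0 1).sub (hP 3 1)))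

instance : TopologicalSpace FlagPair := .induced (fun x : FlagPair => x.1) inferInstance

theorem FlagPair.mink_neg (x : FlagPair) : mink x.1.2 x.1.2 < 0 :=
  LightCone.mink_neg x.2.1 x.2.2.1 x.2.2.2

theorem continuous_flagOf : Continuous flagOf := continuous_coinduced_rng

theorem continuous_flagProducts : Continuous flagProducts := by
  refine continuous_coinduced_dom.2 ?_
  have : flagProducts ∘ flagOf = fun x : FlagPair => bivectorProducts x.1 :=
    funext flagProducts_flagOf
  rw [this]
  refine continuous_iff_continuousAt.2 fun x => ?_
  exact (contDiffAt_bivectorProducts (n := 0) x.mink_neg).continuousAt.comp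
    (f := fun x : FlagPair => x.1) continuous_induced_dom.continuousAt

theorem contDiff_phi {n : WithTop ℕ∞} : ContDiff ℝ n phi := by
  have hre (i : Fin 2) : ContDiff ℝ n fun κ : Fin 2 → ℂ => (κ i).re :=
    Complex.reCLM.contDiff.comp (contDiff_apply ℝ ℂ i)
  have him (i : Fin 2) : ContDiff ℝ n fun κ : Fin 2 → ℂ => (κ i).im :=
    Complex.imCLM.contDiff.comp (contDiff_apply ℝ ℂ i)
  rw [show phi = _ from funext phi_coords, contDiff_pi]
  intro i
  fin_cases i <;> simp <;> fun_prop

theorem contDiff_dphi {n : WithTop ℕ∞} : ContDiff ℝ n dphi := by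
  have hre (i : Fin 2) : ContDiff ℝ n fun κ : Fin 2 → ℂ => (κ i).re :=
    Complex.reCLM.contDiff.comp (contDiff_apply ℝ ℂ i)
  have him (i : Fin 2) : ContDiff ℝ n fun κ : Fin 2 → ℂ => (κ i).im :=
    Complex.imCLM.contDiff.comp (contDiff_apply ℝ ℂ i)
  rw [show dphi = _ from funext dphi_coords, contDiff_pi]
  intro i
  fin_cases i <;> simp <;> fun_prop

theorem continuous_spinorFlag : Continuous spinorFlag := by
  refine continuous_flagOf.comp (continuous_induced_rng.2 ?_)
  exact ((contDiff_phi (n := 0)).continuous.comp continuous_subtype_val).prodMk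
    ((contDiff_dphi (n := 0)).continuous.comp continuous_subtype_val)

theorem spinorFlag_neg (κ : Spinor) : spinorFlag κ.neg = spinorFlag κ := by
  have h1 : phi (-κ.1) = phi κ.1 := by simp [phi_coords]
  have h2 : dphi (-κ.1) = dphi κ.1 := by simp [dphi_coords]
  exact congrArg flagOf (Subtype.ext (Prod.ext h1 h2))

theorem signQuotient_spinorFlag :
    SignQuotient (fun κ : Spinor => κ.1) Spinor.neg spinorFlag flagProducts where
  isInducing := IsInducing.subtypeVal
  injective := Subtype.val_injective
  ne_zero κ := κ.2
  vec_neg _ := rfl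
  continuous := continuous_spinorFlag
  surjective := spinorFlag_surjective
  map_neg := spinorFlag_neg
  continuous_products := continuous_flagProducts
  products κ i j := by
    rw [← bivectorProducts_phi]
    exact congrFun (congrFun (flagProducts_flagOf _) i) j

/-! ### Frames as a quotient of `SL(2,ℂ)` -/

theorem HFrame.act_one (F : HFrame) : F.act 1 = F :=
  Subtype.ext (funext fun _ => lorentz_one _)

theorem HFrame.act_mul (A B : SL2) (F : HFrame) : F.act (A * B) = (F.act B).act A :=
  Subtype.ext (funext fun _ => lorentz_mul A B _)

/-- The frame `(∂_Z, ∂_Y, -∂_X)` at `(1, 0, 0, 0)`. -/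
def stdFrame : HFrame :=
  ⟨![![1, 0, 0, 0], ![0, 0, 0, 1], ![0, 0, 1, 0], ![0, -1, 0, 0]],
    ⟨by simp [mink], by simp⟩, by
      intro i j
      fin_cases i <;> fin_cases j <;> simp [mink], by
      simp [det_succ_row_zero, Fin.sum_univ_succ, Fin.succAbove]⟩

theorem stdFrame_val :
    stdFrame.1 = ![![1, 0, 0, 0], ![0, 0, 0, 1], ![0, 0, 1, 0], ![0, -1, 0, 0]] := rfl

theorem stdFrame_zero : stdFrame.1 0 = ![1, 0, 0, 0] := rfl

theorem stdFrame_add : stdFrame.1 0 + stdFrame.1 1 = phi Spinor.e.1 := by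
  rw [phi_coords]
  ext i
  fin_cases i <;> simp [stdFrame, Spinor.e]

theorem lorentz_unip (z : ℂ) (x : Mink) : lorentz (unip z) x =
    ![x 0 + (z.re * x 1 + z.im * x 2) + Complex.normSq z * (x 0 - x 3) / 2,
      x 1 + z.re * (x 0 - x 3), x 2 + z.im * (x 0 - x 3),
      x 3 + (z.re * x 1 + z.im * x 2) + Complex.normSq z * (x 0 - x 3) / 2] := by
  rw [lorentz_apply, Complex.normSq_apply]
  ext i
  fin_cases i <;> simp [ofHerm, toHerm, unip, Matrix.mul_apply, Fin.sum_univ_two] <;> ring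

/-- The points of the horosphere `x 0 - x 3 = 1`. -/
theorem lorentz_unip_stdFrame {q : Mink} (hq : q ∈ Hyp) (h : mink q (phi Spinor.e.1) = 1) :
    lorentz (unip ⟨q 1, q 2⟩) (stdFrame.1 0) = q := by
  rw [phi_coords] at h
  have h1 := hq.1
  simp [mink, Spinor.e] at h h1
  rw [lorentz_unip, stdFrame_zero, Complex.normSq_apply]
  have h0 : q 0 = 1 + q 3 := by linarith
  rw [h0] at h1
  ext i
  fin_cases i <;> simp <;> linarith

/-- The sum is null by orthonormality. For the time component, the Cauchy–Schwarz inequality for the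
spatial parts of `q` and `N` gives `N₀² ≤ q₀² - 1`, hence `|N₀| < q₀`. -/
theorem HFrame.add_mem_lightCone (F : HFrame) : F.1 0 + F.1 1 ∈ LightCone := by
  have h00 : mink (F.1 0) (F.1 0) = 1 := F.2.2.1 0 0
  have h11 : mink (F.1 1) (F.1 1) = -1 := F.2.2.1 1 1
  have h01 : mink (F.1 0) (F.1 1) = 0 := F.2.2.1 0 1
  have hpos := F.2.1.2
  refine ⟨?_, ?_⟩
  · have h10 : mink (F.1 1) (F.1 0) = 0 := F.2.2.1 1 0
    have hadd (x y z : Mink) : mink x (y + z) = mink x y + mink x z := by simp [mink]; ring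
    rw [mink_add_left, hadd, hadd, h00, h11, h01, h10]
    ring
  · generalize F.1 0 = q at *
    generalize F.1 1 = N at *
    simp only [mink, Pi.add_apply] at *
    have key : N 0 ^ 2 < q 0 ^ 2 := by
      have cs : (q 1 * N 1 + q 2 * N 2 + q 3 * N 3) ^ 2
          ≤ (q 1 ^ 2 + q 2 ^ 2 + q 3 ^ 2) * (N 1 ^ 2 + N 2 ^ 2 + N 3 ^ 2) := by
        nlinarith [sq_nonneg (q 1 * N 2 - q 2 * N 1), sq_nonneg (q 1 * N 3 - q 3 * N 1),
          sq_nonneg (q 2 * N 3 - q 3 * N 2)]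
      have e1 : q 1 * N 1 + q 2 * N 2 + q 3 * N 3 = q 0 * N 0 := by linarith
      have e2 : q 1 ^ 2 + q 2 ^ 2 + q 3 ^ 2 = q 0 ^ 2 - 1 := by linarith
      have e3 : N 1 ^ 2 + N 2 ^ 2 + N 3 ^ 2 = N 0 ^ 2 + 1 := by linarith
      rw [e1, e2, e3] at cs
      linarith
    have := abs_lt_of_sq_lt_sq key hpos.le
    rw [abs_lt] at this
    linarith

/-- The flag of a frame `(q, N, v, N × v)`: its point is `q + N`, and its direction is `v`. -/
def HFrame.toFlag (F : HFrame) : NullFlag :=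
  flagOf ⟨(F.1 0 + F.1 1, F.1 2), F.add_mem_lightCone, by
    have h20 : mink (F.1 2) (F.1 0) = 0 := F.2.2.1 2 0
    have h21 : mink (F.1 2) (F.1 1) = 0 := F.2.2.1 2 1
    change mink (F.1 2) (F.1 0 + F.1 1) = 0
    rw [mink_comm, mink_add_left, mink_comm, h20, mink_comm, h21, add_zero], by
    intro h
    obtain ⟨c, hc⟩ := Submodule.mem_span_singleton.1 h
    have h22 : mink (F.1 2) (F.1 2) = -1 := F.2.2.1 2 2
    change c • (F.1 0 + F.1 1) = F.1 2 at hc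
    rw [← hc, mink_smul_left, mink_comm, mink_smul_left, F.add_mem_lightCone.1] at h22
    norm_num at h22⟩

theorem HFrame.toFlag_act (A : SL2) (F : HFrame) : (F.act A).toFlag = F.toFlag.act A :=
  NullFlag.eq_of_mem_pos (map_add (lorentz A) _ _).symm mem_pos_flagOf ⟨F.1 2, mem_pos_flagOf, rfl⟩

theorem HFrame.mem_pos_toFlag (F : HFrame) : F.1 2 ∈ F.toFlag.pos := mem_pos_flagOf

theorem dphi_e : dphi Spinor.e.1 = (2 : ℝ) • stdFrame.1 2 := by
  rw [dphi_coords]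
  ext i
  fin_cases i <;> simp [stdFrame, Spinor.e]

theorem stdFrame_toFlag : stdFrame.toFlag = spinorFlag Spinor.e := by
  refine NullFlag.eq_of_mem_pos stdFrame_add stdFrame.mem_pos_toFlag ?_
  refine ⟨0, 1 / 2, by norm_num, ?_⟩
  change _ = (0 : ℝ) • phi Spinor.e.1 + (1 / 2 : ℝ) • dphi Spinor.e.1
  rw [dphi_e, smul_smul]
  norm_num

theorem toFlag_stdFrame_act (A : SL2) :
    (stdFrame.act A).toFlag = spinorFlag (Spinor.act A Spinor.e) := by
  rw [HFrame.toFlag_act, stdFrame_toFlag, spinorFlag_act]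

/-- The point of the flag determines `N = p - q`; the vector `v` is the only positive vector
orthogonal to `q` with `⟨v, v⟩ = -1`; the last vector is then fixed up to sign by orthonormality,
and its sign by the orientation. -/
theorem HFrame.eq_stdFrame {F : HFrame} (h0 : F.1 0 = stdFrame.1 0)
    (h : F.toFlag = stdFrame.toFlag) : F = stdFrame := by
  have hpt : F.1 0 + F.1 1 = stdFrame.1 0 + stdFrame.1 1 := congrArg NullFlag.pt h
  have h1 : F.1 1 = stdFrame.1 1 := by rwa [h0, add_right_inj] at hpt
  have h2 : F.1 2 = stdFrame.1 2 := by
    have hm := F.mem_pos_toFlag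
    rw [h] at hm
    obtain ⟨a, b, hb, hab⟩ := hm
    change F.1 2 = a • (stdFrame.1 0 + stdFrame.1 1) + b • stdFrame.1 2 at hab
    have h20 : mink (F.1 2) (F.1 0) = 0 := F.2.2.1 2 0
    have h22 : mink (F.1 2) (F.1 2) = -1 := F.2.2.1 2 2
    rw [h0, hab] at h20
    simp [mink, stdFrame] at h20
    rw [hab] at h22
    simp [mink, stdFrame, h20] at h22
    have hb1 : b = 1 := by nlinarith
    rw [hab, h20, hb1]
    simp
  have h30 : mink (F.1 3) (F.1 0) = 0 := F.2.2.1 3 0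
  have h31 : mink (F.1 3) (F.1 1) = 0 := F.2.2.1 3 1
  have h32 : mink (F.1 3) (F.1 2) = 0 := F.2.2.1 3 2
  have h33 : mink (F.1 3) (F.1 3) = -1 := F.2.2.1 3 3
  rw [h0] at h30
  rw [h1] at h31
  rw [h2] at h32
  simp [mink, stdFrame] at h30 h31 h32
  simp only [mink, h30, h31, h32] at h33
  have h3 : F.1 3 = ![0, F.1 3 1, 0, 0] := by
    ext j
    fin_cases j <;> simp [h30, h31, h32]
  have hF : F.1 = ![![1, 0, 0, 0], ![0, 0, 0, 1], ![0, 0, 1, 0], ![0, F.1 3 1, 0, 0]] := by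
    rw [stdFrame_val] at h0 h1 h2
    rw [← h3, ← List.ofFn_inj]
    simpa using ⟨h0, h1, h2⟩
  have hdet := F.2.2.2
  generalize F.1 3 1 = x at hF h33
  rw [hF] at hdet
  have hneg : x < 0 := by
    simpa [det_succ_row_zero, Fin.sum_univ_succ, Fin.succAbove] using hdet
  have : x = -1 := by nlinarith
  apply Subtype.ext
  rw [hF, this, stdFrame_val]

/-- Frames are determined by their base point and their flag. -/
theorem HFrame.exists_act_eq (F : HFrame) {κ : Spinor} (h : F.toFlag = spinorFlag κ) :
    ∃ A : SL2, Spinor.act A Spinor.e = κ ∧ stdFrame.act A = F := by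
  -- After `κ` is moved to `e`, the base point lies on the horosphere `⟨x, phi e⟩ = 1`. The
  -- unipotent group acts transitively on this horosphere and fixes `e`.
  set F' := F.act κ.toSL⁻¹ with hF'
  have h1 : F'.toFlag = spinorFlag Spinor.e := by
    rw [HFrame.toFlag_act, h, ← spinorFlag_act, Spinor.toSL_inv_act]
  have h2 : mink (F'.1 0) (phi Spinor.e.1) = 1 := by
    have hpt : F'.1 0 + F'.1 1 = phi Spinor.e.1 := congrArg NullFlag.pt h1
    have h00 : mink (F'.1 0) (F'.1 0) = 1 := F'.2.2.1 0 0
    have h10 : mink (F'.1 1) (F'.1 0) = 0 := F'.2.2.1 1 0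
    rw [← hpt, mink_comm, mink_add_left, h00, h10, add_zero]
  have h3 := lorentz_unip_stdFrame F'.2.1 h2
  set u := unip ⟨F'.1 0 1, F'.1 0 2⟩
  have h4 : F'.act u⁻¹ = stdFrame := by
    apply HFrame.eq_stdFrame
    · change lorentz u⁻¹ (F'.1 0) = _
      rw [← h3, lorentz_inv_lorentz]
    · rw [HFrame.toFlag_act, h1, stdFrame_toFlag, ← spinorFlag_act]
      congr 1
      have := congrArg (Spinor.act u⁻¹) (unip_act_e ⟨F'.1 0 1, F'.1 0 2⟩)
      rwa [← Spinor.act_mul, inv_mul_cancel, Spinor.act_one, eq_comm] at this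
  refine ⟨κ.toSL * u, ?_, ?_⟩
  · rw [Spinor.act_mul, unip_act_e, Spinor.toSL_act_e]
  · rw [← h4, HFrame.act_mul, ← HFrame.act_mul u, mul_inv_cancel, HFrame.act_one, hF',
      ← HFrame.act_mul, mul_inv_cancel, HFrame.act_one]

theorem stdFrame_act_surjective : Function.Surjective fun A : SL2 => stdFrame.act A := by
  intro F
  obtain ⟨κ, hκ⟩ := spinorFlag_surjective F.toFlag
  obtain ⟨A, -, hA⟩ := F.exists_act_eq hκ.symm
  exact ⟨A, hA⟩

/-- The matrix `∑ F_i B F⁰_i`, for the standard frame `F⁰`; it is a multiple of `A` if `F = A F⁰`. -/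
def frameMatrix (F : Fin 4 → Mink) (B : Matrix (Fin 2) (Fin 2) ℂ) : Matrix (Fin 2) (Fin 2) ℂ :=
  ∑ i, toHerm (F i) * B * toHerm (stdFrame.1 i)

/-- This is the completeness relation `∑ σ B σ = 2 tr(B)·1` for the identity and the Pauli matrices,
of which the frame vectors are the halves up to sign. -/
theorem frameMatrix_stdFrame (B : Matrix (Fin 2) (Fin 2) ℂ) :
    frameMatrix stdFrame.1 B = (B.trace / 2) • (1 : Matrix (Fin 2) (Fin 2) ℂ) := by
  have hI := Complex.I_sq
  ext i j
  simp only [frameMatrix, Fin.sum_univ_four, Matrix.add_apply, Matrix.mul_apply,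
    Fin.sum_univ_two, trace_fin_two]
  fin_cases i <;> fin_cases j <;> simp [stdFrame, toHerm] <;> ring_nf <;> simp [hI] <;> ring

/-- Each summand is `A F⁰ᵢ A* B F⁰ᵢ`, so `A` factors out and the completeness relation applies to
`A* B`. For a matrix unit `B` the trace is the conjugate of one entry of `A`. -/
theorem frameMatrix_act (A : SL2) (B : Matrix (Fin 2) (Fin 2) ℂ) :
    frameMatrix (stdFrame.act A).1 B = ((A.1ᴴ * B).trace / 2) • A.1 := by
  have : frameMatrix (stdFrame.act A).1 B = A.1 * frameMatrix stdFrame.1 (A.1ᴴ * B) := by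
    simp only [frameMatrix, Finset.mul_sum]
    refine Finset.sum_congr rfl fun i _ => ?_
    change toHerm (lorentz A _) * _ * _ = _
    rw [toHerm_lorentz]
    simp only [Matrix.mul_assoc]
  rw [this, frameMatrix_stdFrame, mul_smul_comm, mul_one]

/-- The products of the entries of the matrices `A` with `F = A F⁰`, for the standard frame
`F⁰`. -/
def frameProducts (F : Fin 4 → Mink) (i j : Fin 2 × Fin 2) : ℂ :=
  let M := frameMatrix F (single i.1 i.2 1)
  let N := frameMatrix F (single j.1 j.2 1)
  star (2 * (M 0 0 * N 1 1 + N 0 0 * M 1 1 - M 0 1 * N 1 0 - N 0 1 * M 1 0))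

/-- The matrices `M` and `N` are `A` times half the conjugates of the entries `i` and `j` of `A`.
The polarised determinant removes the factor `A`, as `det A = 1`, and leaves the product of these
scalars. -/
theorem frameProducts_act (A : SL2) (i j : Fin 2 × Fin 2) :
    frameProducts (stdFrame.act A).1 i j = A.1 i.1 i.2 * A.1 j.1 j.2 := by
  have htr (i : Fin 2 × Fin 2) : (A.1ᴴ * single i.1 i.2 1).trace = star (A.1 i.1 i.2) := by
    simp [trace_mul_single]
  simp only [frameProducts, frameMatrix_act, htr, Matrix.smul_apply, smul_eq_mul]
  have hd := A.2
  rw [det_fin_two] at hd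
  set a := star (A.1 i.1 i.2) with ha
  set b := star (A.1 j.1 j.2) with hb
  have e : 2 * (a / 2 * A.1 0 0 * (b / 2 * A.1 1 1) + b / 2 * A.1 0 0 * (a / 2 * A.1 1 1)
      - a / 2 * A.1 0 1 * (b / 2 * A.1 1 0) - b / 2 * A.1 0 1 * (a / 2 * A.1 1 0)) = a * b := by
    linear_combination a * b * hd
  rw [e, star_mul, ha, hb, star_star, star_star, mul_comm]

theorem contDiff_frameProducts {n : WithTop ℕ∞} : ContDiff ℝ n frameProducts := by
  have hx (k : Fin 4) (l : Fin 4) : ContDiff ℝ n fun F : Fin 4 → Mink => ((F k l : ℝ) : ℂ) :=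
    Complex.ofRealCLM.contDiff.comp (contDiff_apply_apply ℝ ℝ k l)
  have hH (k : Fin 4) (a b : Fin 2) : ContDiff ℝ n fun F : Fin 4 → Mink => toHerm (F k) a b := by
    fin_cases a <;> fin_cases b <;> simp [toHerm] <;> simp only [div_eq_mul_inv] <;> fun_prop
  have hM (B : Matrix (Fin 2) (Fin 2) ℂ) (a b : Fin 2) :
      ContDiff ℝ n fun F : Fin 4 → Mink => frameMatrix F B a b := by
    simp only [frameMatrix, Matrix.sum_apply, Matrix.mul_apply]
    fun_prop
  rw [contDiff_pi]
  intro i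
  rw [contDiff_pi]
  intro j
  have h2 : ContDiff ℝ n fun z : ℂ => star z := Complex.conjCLE.contDiff
  exact h2.comp (contDiff_const.mul (((((hM _ 0 0).mul (hM _ 1 1)).add
    ((hM _ 0 0).mul (hM _ 1 1))).sub ((hM _ 0 1).mul (hM _ 1 0))).sub
    ((hM _ 0 1).mul (hM _ 1 0))))

theorem continuous_ofHerm : Continuous ofHerm := by
  refine continuous_pi fun i => ?_
  fin_cases i <;> simp [ofHerm] <;> fun_prop

theorem continuous_lorentz (x : Mink) : Continuous fun A : SL2 => lorentz A x := by
  have h : Continuous fun A : SL2 => A.1 := continuous_subtype_val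
  exact continuous_ofHerm.comp ((h.matrix_mul continuous_const).matrix_mul h.matrix_conjTranspose)

theorem continuous_stdFrame_act : Continuous fun A : SL2 => stdFrame.act A :=
  Continuous.subtype_mk (continuous_pi fun _ => continuous_lorentz _) _

theorem contDiff_lorentz {V : Type*} [NormedAddCommGroup V] [NormedSpace ℝ V] {n : WithTop ℕ∞}
    {c : V → SL2} (hc : ∀ i j, ContDiff ℝ n fun x => (c x).1 i j) (y : Mink) :
    ContDiff ℝ n fun x => lorentz (c x) y := by
  have hs (i j) : ContDiff ℝ n fun x => star ((c x).1 i j) :=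
    Complex.conjCLE.contDiff.comp (hc i j)
  have hS (i j) : ContDiff ℝ n fun x => ((c x).1 * toHerm y * (c x).1ᴴ) i j := by
    simp only [Matrix.mul_apply, conjTranspose_apply]
    fun_prop
  have hre {f : V → ℂ} (hf : ContDiff ℝ n f) : ContDiff ℝ n fun x => (f x).re :=
    Complex.reCLM.contDiff.comp hf
  have him {f : V → ℂ} (hf : ContDiff ℝ n f) : ContDiff ℝ n fun x => (f x).im :=
    Complex.imCLM.contDiff.comp hf
  rw [contDiff_pi]
  intro i
  fin_cases i
  · exact hre ((hS 0 0).add (hS 1 1))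
  · exact contDiff_const.mul (hre (hS 0 1))
  · exact contDiff_const.mul (him (hS 0 1))
  · exact hre ((hS 0 0).sub (hS 1 1))

/-- This identifies `SL(2,ℂ)` with a spin frame bundle; it plays the same role for frames as
`signQuotient_spinorFlag` does for flags. -/
theorem signQuotient_stdFrame_act :
    SignQuotient (fun (A : SL2) (i : Fin 2 × Fin 2) => A.1 i.1 i.2) (fun A => -A)
      (fun A => stdFrame.act A) (fun F => frameProducts F.1) where
  isInducing := by
    have h1 : Continuous fun (A : SL2) (i : Fin 2 × Fin 2) => A.1 i.1 i.2 :=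
      continuous_pi fun i => (continuous_subtype_val (p := fun A : Matrix (Fin 2) (Fin 2) ℂ =>
        A.det = 1)).matrix_elem i.1 i.2
    have h2 : Continuous fun (v : Fin 2 × Fin 2 → ℂ) => (Matrix.of fun i j => v (i, j)) :=
      continuous_matrix fun i j => continuous_apply _
    exact IsInducing.of_comp h1 h2 IsInducing.subtypeVal
  injective A B h := by
    apply Subtype.ext
    ext i j
    exact congrFun h (i, j)
  ne_zero A h := by
    have hd := A.2
    have h' (i j) : A.1 i j = 0 := congrFun h (i, j)
    rw [det_fin_two, h' 0 0, h' 1 0] at hd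
    simp at hd
  vec_neg A := rfl
  continuous := continuous_stdFrame_act
  surjective := stdFrame_act_surjective
  map_neg A := by
    apply Subtype.ext
    funext i
    change lorentz (-A) _ = lorentz A _
    simp [lorentz_apply]
  continuous_products := (contDiff_frameProducts (n := 0)).continuous.comp continuous_subtype_val
  products A i j := frameProducts_act A i j

/-! ### Horospheres and decorations -/

/-- The horosphere of a point of the light cone. -/
def horo (p : Mink) : Set Mink := {x | x ∈ Hyp ∧ mink x p = 1}

theorem image_horo (A : SL2) (p : Mink) : lorentz A '' horo p = horo (lorentz A p) := by
  ext x
  constructor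
  · rintro ⟨y, ⟨hy, hyp⟩, rfl⟩
    exact ⟨lorentz_mem_hyp A hy, by rw [mink_lorentz, hyp]⟩
  · rintro ⟨hx, hxp⟩
    refine ⟨lorentz A⁻¹ x, ⟨lorentz_mem_hyp _ hx, ?_⟩, lorentz_lorentz_inv A x⟩
    rw [mink_lorentz_left, inv_inv, hxp]

theorem stdFrame_mem_horo : stdFrame.1 0 ∈ horo (phi Spinor.e.1) :=
  ⟨stdFrame.2.1, by rw [phi_coords]; simp [stdFrame, Spinor.e, mink]⟩

theorem lorentz_unip_phi_e (z : ℂ) : lorentz (unip z) (phi Spinor.e.1) = phi Spinor.e.1 := by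
  rw [lorentz_phi]
  exact congrArg phi (congrArg Subtype.val (unip_act_e z))

/-- By equivariance `p` may be taken to be `phi e`, whose horosphere contains the unipotent
translates of the base point. These points span Minkowski space, so the equations `⟨x, p'⟩ = 1` on
them determine `p'`. -/
theorem horo_injective {p p' : Mink} (hp : p ∈ LightCone) (h : horo p ⊆ horo p') : p = p' := by
  obtain ⟨κ, rfl⟩ := exists_phi_eq hp
  set A := κ.toSL
  have hA : lorentz A (phi Spinor.e.1) = phi κ.1 := by
    rw [lorentz_phi]
    exact congrArg phi (congrArg Subtype.val κ.toSL_act_e)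
  rw [← lorentz_lorentz_inv A p', ← hA] at h ⊢
  congr 1
  rw [← image_horo, ← image_horo] at h
  have hinj : Function.Injective (lorentz A) :=
    Function.LeftInverse.injective (lorentz_inv_lorentz A)
  rw [Set.image_subset_image_iff hinj] at h
  have hz (z : ℂ) : mink (lorentz (unip z) (stdFrame.1 0)) (lorentz A⁻¹ p') = 1 := by
    refine (h ?_).2
    rw [← lorentz_unip_phi_e z, ← image_horo]
    exact ⟨_, stdFrame_mem_horo, rfl⟩
  generalize lorentz A⁻¹ p' = x at hz
  -- The translates by `0, ±1, ±i` suffice to solve for the four coordinates.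
  have h0 := hz 0
  have h1 := hz 1
  have h2 := hz (-1)
  have h3 := hz Complex.I
  have h4 := hz (-Complex.I)
  rw [lorentz_unip, stdFrame_zero] at h0 h1 h2 h3 h4
  simp [mink] at h0 h1 h2 h3 h4
  rw [phi_coords]
  ext i
  fin_cases i <;> simp [Spinor.e] <;> linarith

theorem IsCentre.exists_horo {H : Set Mink} {p : Mink} (h : IsCentre H p) :
    ∃ c : ℝ, 0 < c ∧ ∃ p' ∈ LightCone, p = c • p' ∧ H = horo p' := by
  obtain ⟨hp, c, hc, rfl⟩ := h
  refine ⟨c, hc, c⁻¹ • p, ⟨?_, ?_⟩, ?_, ?_⟩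
  · rw [mink_smul_left, mink_comm, mink_smul_left, hp.1]
    simp
  · exact mul_pos (inv_pos.2 hc) hp.2
  · rw [smul_smul, mul_inv_cancel₀ hc.ne', one_smul]
  · ext x
    refine and_congr_right fun _ => ?_
    rw [mink_comm x (c⁻¹ • p), mink_smul_left, mink_comm p, inv_mul_eq_one₀ hc.ne', eq_comm]

theorem isCentre_horo {p : Mink} (hp : p ∈ LightCone) : IsCentre (horo p) p :=
  ⟨hp, 1, one_pos, rfl⟩

theorem IsCentre.eq_smul {p p' : Mink} (hp : p ∈ LightCone) (h : IsCentre (horo p) p') :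
    ∃ c : ℝ, 0 < c ∧ p' = c • p := by
  obtain ⟨c, hc, x, hx, rfl, hH⟩ := h.exists_horo
  exact ⟨c, hc, by rw [horo_injective hp hH.le]⟩

theorem mem_tangentPlane_horo {p q w : Mink} (hp : p ∈ LightCone) :
    w ∈ tangentPlane (horo p) q ↔ mink w q = 0 ∧ mink w p = 0 := by
  refine and_congr_right fun _ => ⟨?_, fun h => ⟨p, isCentre_horo hp, h⟩⟩
  rintro ⟨p', hp', h⟩
  obtain ⟨c, hc, rfl⟩ := hp'.eq_smul hp
  rw [mink_comm, mink_smul_left] at h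
  rw [mink_comm]
  exact (mul_eq_zero.1 h).resolve_left hc.ne'

/-- The centre condition says `q + N = c p`; pairing with `q` gives `c = 1`. -/
theorem isOutNormal_horo {p q N : Mink} (hp : p ∈ LightCone) (hq : q ∈ horo p) :
    IsOutNormal (horo p) q N ↔ q + N = p := by
  constructor
  · rintro ⟨h1, -, -, h4⟩
    obtain ⟨c, hc, h⟩ := h4.eq_smul hp
    have := congrArg (mink · q) h
    simp only [mink_add_left, mink_smul_left, hq.1.1, h1] at this
    rw [mink_comm, hq.2] at this
    have hc1 : c = 1 := by linarith
    rw [h, hc1, one_smul]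
  · intro h
    have hN : N = p + (-1 : ℝ) • q := by rw [← h]; module
    have hpq : mink p q = 1 := by rw [mink_comm]; exact hq.2
    have hNq : mink N q = 0 := by
      rw [hN, mink_add_left, mink_smul_left, hpq, hq.1.1]; norm_num
    refine ⟨hNq, ?_, ?_, by rw [h]; exact isCentre_horo hp⟩
    · have hNp : mink N p = -1 := by
        rw [hN, mink_add_left, mink_smul_left, hp.1, hq.2]; norm_num
      rw [mink_comm, hN, mink_add_left, mink_smul_left, ← hN, mink_comm p, hNp, mink_comm q, hNq]
      norm_num
    · intro w hw
      rw [mem_tangentPlane_horo hp] at hw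
      rw [hN, mink_add_left, mink_smul_left, mink_comm p, hw.2, mink_comm q, hw.1]
      norm_num

/-- The vector chosen in the definition of `penner` is unique. It has the form `a p + b u` with `b >
0`; orthogonality to `q` forces `a = 0`, and the normalisation forces `b = 1`. -/
theorem penner_dir {f : NullFlag} {q u : Mink} (hq : q ∈ horo f.pt) (hu : u ∈ f.pos)
    (huq : mink u q = 0) (huu : mink u u = -1) : (penner f).dir q = u := by
  have hd : (penner f).dir q ∈ f.pos ∧ mink ((penner f).dir q) q = 0 ∧
      mink ((penner f).dir q) ((penner f).dir q) = -1 := by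
    change (dite _ _ _) ∈ _ ∧ mink (dite _ _ _) _ = _ ∧ mink (dite _ _ _) (dite _ _ _) = _
    rw [dif_pos ⟨hq.1.1, hq.1.2, hq.2⟩]
    exact (f.exists_dir hq.2).choose_spec
  obtain ⟨x, hx, hf⟩ := f.exists_eq_flagOf hu
  obtain ⟨a, b, hb, hab⟩ : ∃ a b : ℝ, 0 < b ∧ (penner f).dir q = a • f.pt + b • u := by
    have h1 := hd.1
    have hpos := congrArg NullFlag.pos hf
    rw [hpos] at h1
    obtain ⟨a, b, hb, h⟩ := h1
    exact ⟨a, b, hb, by rw [h, hx]⟩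
  obtain ⟨-, h2, h3⟩ := hd
  rw [hab, mink_add_left, mink_smul_left, mink_smul_left, huq, mink_comm, hq.2] at h2
  have ha : a = 0 := by linarith
  rw [hab, ha, zero_smul, zero_add, mink_smul_left, mink_comm, mink_smul_left, huu] at h3
  have hb1 : b = 1 := by nlinarith
  rw [hab, ha, hb1, zero_smul, zero_add, one_smul]

theorem penner_dir_spec (f : NullFlag) {q : Mink} (hq : q ∈ horo f.pt) :
    (penner f).dir q ∈ f.pos ∧ mink ((penner f).dir q) q = 0 ∧
      mink ((penner f).dir q) ((penner f).dir q) = -1 := by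
  obtain ⟨u, hu, huq, huu⟩ := f.exists_dir hq.2
  rw [penner_dir hq hu huq huu]
  exact ⟨hu, huq, huu⟩

/-- The outward frames of the decorated horosphere of a flag. -/
theorem mem_outFrames_penner {F : HFrame} {f : NullFlag} :
    F ∈ (penner f).outFrames ↔ F.toFlag = f := by
  constructor
  · rintro ⟨h0, h1, h2⟩
    refine NullFlag.eq_of_mem_pos ?_ F.mem_pos_toFlag ?_
    · exact (isOutNormal_horo f.pt_mem h0).1 h1
    · rw [h2]
      exact (penner_dir_spec f h0).1
  · rintro rfl
    have h00 : mink (F.1 0) (F.1 0) = 1 := F.2.2.1 0 0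
    have h10 : mink (F.1 1) (F.1 0) = 0 := F.2.2.1 1 0
    have h0 : F.1 0 ∈ horo F.toFlag.pt := by
      refine ⟨F.2.1, ?_⟩
      change mink (F.1 0) (F.1 0 + F.1 1) = 1
      rw [mink_comm, mink_add_left, h00, h10, add_zero]
    exact ⟨h0, (isOutNormal_horo F.toFlag.pt_mem h0).2 rfl,
      (penner_dir h0 F.mem_pos_toFlag (F.2.2.1 2 0) (F.2.2.1 2 2)).symm⟩

theorem penner_act (A : SL2) (f : NullFlag) : penner (f.act A) = (penner f).act A := by
  have hcar : (penner (f.act A)).carrier = lorentz A '' (penner f).carrier :=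
    (image_horo A f.pt).symm
  ext1
  · exact hcar
  · funext q
    by_cases hq : q ∈ (penner (f.act A)).carrier
    · have hq' : lorentz A⁻¹ q ∈ horo f.pt := by
        rw [hcar] at hq
        exact lorentz_inv_mem hq
      obtain ⟨h1, h2, h3⟩ := penner_dir_spec f hq'
      have e : ((penner f).act A).dir q = lorentz A ((penner f).dir (lorentz A⁻¹ q)) := rfl
      rw [e]
      refine penner_dir hq ⟨_, h1, rfl⟩ ?_ ?_
      · rw [mink_lorentz_left, h2]
      · rw [mink_lorentz, h3]
    · rw [(penner (f.act A)).dir_off q hq]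
      refine (LineFieldHorosphere.dir_off _ q ?_).symm
      rw [hcar] at hq
      exact hq

theorem exists_toFlag_eq (f : NullFlag) : ∃ F : HFrame, F.toFlag = f := by
  obtain ⟨κ, rfl⟩ := spinorFlag_surjective f
  exact ⟨stdFrame.act κ.toSL, by rw [toFlag_stdFrame_act, Spinor.toSL_act_e]⟩

theorem penner_injective : Function.Injective penner := by
  intro f f' h
  obtain ⟨F, hF⟩ := exists_toFlag_eq f
  have h1 := mem_outFrames_penner.2 hF
  rw [h, mem_outFrames_penner] at h1
  rw [← hF, h1]

/-! ### Parallel line fields and flags -/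

theorem mink_phi_phi (x y : Fin 2 → ℂ) :
    mink (phi x) (phi y) = 2 * Complex.normSq (x 0 * y 1 - x 1 * y 0) := by
  rw [phi_coords, phi_coords, Complex.normSq_apply]
  simp [mink]
  ring

/-- Since `⟨phi x, phi y⟩ = 2|det(x, y)|²` and `phi y` is null, the determinant of `x` and `y`
vanishes. -/
theorem exists_eq_smul_of_phi_eq {x y : Spinor} (h : phi x.1 = phi y.1) : ∃ c : ℂ, x.1 = c • y.1 := by
  have h1 := mink_phi_phi x.1 y.1
  rw [h, (phi_pair y).1.1, eq_comm, mul_eq_zero, or_iff_right two_ne_zero,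
    Complex.normSq_eq_zero] at h1
  by_cases h0 : y.1 0 = 0
  · have hy1 : y.1 1 ≠ 0 := fun hy1 => y.2 (by funext i; fin_cases i <;> assumption)
    have hx0 : x.1 0 = 0 := by
      rw [h0, mul_zero, sub_zero] at h1
      exact (mul_eq_zero.1 h1).resolve_right hy1
    refine ⟨x.1 1 / y.1 1, ?_⟩
    funext i
    fin_cases i <;> simp [h0, hx0, hy1]
  · refine ⟨x.1 0 / y.1 0, ?_⟩
    funext i
    fin_cases i <;> simp [h0]
    field_simp
    linear_combination -h1

/-- A `B` that preserves the horosphere fixes `p = κκ*`, so `κ` is an eigenvector. If `B` is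
parabolic its eigenvalue is double, hence `±1` because `det B = 1`. So `B` fixes the flag of `κ`,
and by equivariance it preserves the line field. -/
theorem penner_isParallel (f : NullFlag) : (penner f).IsParallel := by
  intro B hB hBf q hq
  obtain ⟨κ, rfl⟩ := spinorFlag_surjective f
  have hpt : phi (Spinor.act B κ).1 = phi κ.1 := by
    have h1 : horo (lorentz B (phi κ.1)) = horo (phi κ.1) := by
      rw [← image_horo]
      exact hBf
    rw [lorentz_phi] at h1
    exact horo_injective (phi_pair (Spinor.act B κ)).1 h1.le
  obtain ⟨c, hc⟩ := exists_eq_smul_of_phi_eq hpt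
  have hc0 := congrFun hc 0
  have hc1 := congrFun hc 1
  simp [Spinor.act] at hc0 hc1
  have hd := B.2
  rw [det_fin_two] at hd
  have hdisc := hB.2
  rw [Matrix.discr_fin_two, trace_fin_two, det_fin_two, hd] at hdisc
  -- The eigenvalue is a root of the characteristic polynomial; vanishing discriminant then gives
  -- `tr B = 2c`.
  have hquad : c ^ 2 - (B.1 0 0 + B.1 1 1) * c + 1 = 0 := by
    have e0 : (c ^ 2 - (B.1 0 0 + B.1 1 1) * c + 1) * κ.1 0 = 0 := by
      linear_combination (-κ.1 0) * hd + (B.1 1 1 - c) * hc0 - B.1 0 1 * hc1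
    have e1 : (c ^ 2 - (B.1 0 0 + B.1 1 1) * c + 1) * κ.1 1 = 0 := by
      linear_combination (-κ.1 1) * hd + (B.1 0 0 - c) * hc1 - B.1 1 0 * hc0
    by_contra hne
    apply κ.2
    funext i
    fin_cases i
    · exact (mul_eq_zero.1 e0).resolve_left hne
    · exact (mul_eq_zero.1 e1).resolve_left hne
  have hcc : c = 1 ∨ c = -1 := by
    have h1 : (B.1 0 0 + B.1 1 1 - 2 * c) ^ 2 = 0 := by linear_combination hdisc + 4 * hquad
    have h2 : B.1 0 0 + B.1 1 1 = 2 * c := by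
      have := pow_eq_zero_iff two_ne_zero |>.1 h1
      linear_combination this
    rw [h2] at hquad
    exact mul_self_eq_one_iff.1 (by linear_combination -hquad)
  have hfix : spinorFlag (Spinor.act B κ) = spinorFlag κ := by
    rcases hcc with rfl | rfl
    · congr 1
      exact Subtype.ext (by rw [hc, one_smul])
    · rw [← spinorFlag_neg κ]
      congr 1
      exact Subtype.ext (by rw [hc, neg_one_smul]; rfl)
  have h2 := penner_act B (spinorFlag κ)
  rw [← spinorFlag_act, hfix] at h2
  rw [h2]
  change lorentz B ((penner (spinorFlag κ)).dir (lorentz B⁻¹ (lorentz B q)))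
    = lorentz B (((penner (spinorFlag κ)).act B).dir q)
  rw [lorentz_inv_lorentz, ← h2]

theorem isParabolic_conj_unip (A : SL2) {z : ℂ} (hz : z ≠ 0) :
    (A * unip z * A⁻¹).1.IsParabolic := by
  have h1 : (A * unip z * A⁻¹).1 = (SpecialLinearGroup.toGL A).1 * (unip z).1
      * (SpecialLinearGroup.toGL A).1⁻¹ := by
    have h2 : (SpecialLinearGroup.toGL A).1⁻¹ = A⁻¹.1 := by
      apply Matrix.inv_eq_left_inv
      exact congrArg Subtype.val (inv_mul_cancel A)
    rw [h2]
    rfl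
  rw [h1, isParabolic_conj_iff]
  refine ⟨?_, ?_⟩
  · rintro ⟨c, hc⟩
    have := congrFun (congrFun hc 0) 1
    simp [unip] at this
    exact hz this.symm
  · rw [Matrix.discr_fin_two, trace_fin_two, det_fin_two]
    simp [unip]
    norm_num

/-- Every decorated horosphere comes from a flag. -/
theorem exists_penner_eq {h : LineFieldHorosphere} (hh : h.IsParallel) :
    ∃ f : NullFlag, penner f = h := by
  obtain ⟨p', hp'⟩ := h.isHorosphere
  obtain ⟨-, -, p, hp, -, hH⟩ := hp'.exists_horo
  obtain ⟨κ, rfl⟩ := exists_phi_eq hp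
  set A := κ.toSL
  have hA : lorentz A (phi Spinor.e.1) = phi κ.1 := by
    rw [lorentz_phi]
    exact congrArg phi (congrArg Subtype.val κ.toSL_act_e)
  set q := lorentz A (stdFrame.1 0)
  have hq : q ∈ horo (phi κ.1) := by
    rw [← hA, ← image_horo]
    exact ⟨_, stdFrame_mem_horo, rfl⟩
  have hu := h.dir_tangent q (by rw [hH]; exact hq)
  have huu := h.dir_unit q (by rw [hH]; exact hq)
  rw [hH, mem_tangentPlane_horo hp] at hu
  let x : FlagPair := ⟨(phi κ.1, h.dir q), hp, hu.2, by
    intro hs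
    obtain ⟨c, hc⟩ := Submodule.mem_span_singleton.1 hs
    change c • phi κ.1 = h.dir q at hc
    rw [← hc, mink_smul_left, mink_comm, mink_smul_left, hp.1] at huu
    norm_num at huu⟩
  -- The flag is built from the line at the single point `q`. Two parallel fields that agree at `q`
  -- agree everywhere, as the conjugates of unipotent matrices below move `q` to any point of the
  -- horosphere.
  have hdirq : (penner (flagOf x)).dir q = h.dir q := penner_dir hq mem_pos_flagOf hu.1 huu
  refine ⟨flagOf x, ?_⟩
  have hcar : (penner (flagOf x)).carrier = h.carrier := hH.symm
  ext1
  · exact hcar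
  · funext q'
    by_cases hq' : q' ∈ h.carrier
    · have hq1 : lorentz A⁻¹ q' ∈ horo (phi Spinor.e.1) := by
        rw [hH, ← hA, ← image_horo] at hq'
        exact lorentz_inv_mem hq'
      have hz := lorentz_unip_stdFrame hq1.1 hq1.2
      set z : ℂ := ⟨lorentz A⁻¹ q' 1, lorentz A⁻¹ q' 2⟩
      have hBq : lorentz (A * unip z * A⁻¹) q = q' := by
        rw [lorentz_mul, lorentz_mul, lorentz_inv_lorentz, hz, lorentz_lorentz_inv]
      -- The identity is not parabolic, so the point `q` itself is treated apart.
      by_cases hz0 : z = 0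
      · rw [hz0, unip_zero, mul_one, mul_inv_cancel, lorentz_one] at hBq
        rw [← hBq, hdirq]
      · have hBH : lorentz (A * unip z * A⁻¹) '' h.carrier = h.carrier := by
          rw [hH, image_horo]
          congr 1
          rw [lorentz_mul, lorentz_mul, ← hA, lorentz_inv_lorentz, lorentz_unip_phi_e]
        have h1 := hh _ (isParabolic_conj_unip A hz0) hBH q (by rw [hH]; exact hq)
        have h2 := penner_isParallel (flagOf x) _ (isParabolic_conj_unip A hz0)
          (by rw [hcar]; exact hBH) q hq
        rw [← hBq, h1, h2, hdirq]
    · rw [h.dir_off q' hq', (penner (flagOf x)).dir_off q' (by rw [hcar]; exact hq')]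

/-- The correspondence between flags and decorated horospheres. -/
def pennerEquiv : NullFlag ≃ DecoratedHorosphere :=
  Equiv.ofBijective (fun f => ⟨penner f, penner_isParallel f⟩)
    ⟨fun _ _ h => penner_injective (congrArg Subtype.val h), fun h => by
      obtain ⟨f, hf⟩ := exists_penner_eq h.2
      exact ⟨f, Subtype.ext hf⟩⟩

theorem HFrame.continuous_toFlag : Continuous HFrame.toFlag := by
  refine continuous_flagOf.comp (continuous_induced_rng.2 ?_)
  have h (i : Fin 4) : Continuous fun F : HFrame => F.1 i :=
    (continuous_apply i).comp continuous_subtype_val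
  exact ((h 0).add (h 1)).prodMk (h 2)

theorem isQuotientMap_spinorFlag : IsQuotientMap spinorFlag :=
  signQuotient_spinorFlag.isOpenQuotientMap.isQuotientMap

/-- A decorated horosphere together with one of its outward frames. -/
def MarkedDecoratedHorosphere : Type :=
  {x : HFrame × DecoratedHorosphere // x.1 ∈ x.2.1.outFrames}

instance : TopologicalSpace MarkedDecoratedHorosphere := .induced (fun x => x.1.1) inferInstance

theorem continuous_markedDecoratedHorosphere_snd :
    Continuous fun x : MarkedDecoratedHorosphere => x.1.2 := continuous_coinduced_rng

/-- The correspondence between flags and decorated horospheres is a homeomorphism. -/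
def pennerHomeomorph : NullFlag ≃ₜ DecoratedHorosphere where
  toEquiv := pennerEquiv
  continuous_toFun := by
    rw [isQuotientMap_spinorFlag.continuous_iff]
    have hmem (κ : Spinor) : stdFrame.act κ.toSL ∈ (penner (spinorFlag κ)).outFrames :=
      mem_outFrames_penner.2 (by rw [toFlag_stdFrame_act, Spinor.toSL_act_e])
    -- Continuity into the quotient is shown by marking the horosphere of `κ` with the outward frame
    -- `κ.toSL F⁰`, which varies continuously.
    let m : Spinor → MarkedDecoratedHorosphere := fun κ =>
      ⟨(stdFrame.act κ.toSL, pennerEquiv (spinorFlag κ)), hmem κ⟩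
    have h1 : Continuous m := continuous_induced_rng.2 (continuous_stdFrame_act.comp Spinor.continuous_toSL)
    exact continuous_markedDecoratedHorosphere_snd.comp h1
  continuous_invFun := by
    refine continuous_coinduced_dom.2 ?_
    have h1 : (pennerEquiv.symm ∘ fun x : MarkedDecoratedHorosphere => x.1.2)
        = fun x => x.1.1.toFlag := by
      funext x
      obtain ⟨⟨F, h⟩, hx⟩ := x
      obtain ⟨f, rfl⟩ := pennerEquiv.surjective h
      exact (pennerEquiv.symm_apply_apply f).trans (mem_outFrames_penner.1 hx).symm
    change Continuous (pennerEquiv.symm ∘ fun x : MarkedDecoratedHorosphere => x.1.2)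
    rw [h1]
    exact HFrame.continuous_toFlag.comp continuous_induced_dom

/-! ### Rotations and sections -/

/-- The rotation by the angle `t` about the second vector of the standard frame. -/
def rot (t : ℝ) : SL2 :=
  ⟨!![(Real.cos (t / 2) : ℂ), -(Real.sin (t / 2) : ℂ); (Real.sin (t / 2) : ℂ),
    (Real.cos (t / 2) : ℂ)], by
    rw [det_fin_two_of]
    have h := Real.sin_sq_add_cos_sq (t / 2)
    have h' : ((Real.sin (t / 2) : ℂ)) ^ 2 + (Real.cos (t / 2) : ℂ) ^ 2 = 1 := by
      exact_mod_cast h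
    linear_combination h'⟩

theorem rot_zero : rot 0 = 1 := by
  apply Subtype.ext
  ext i j
  fin_cases i <;> fin_cases j <;> simp [rot]

theorem continuous_rot : Continuous rot := by
  refine Continuous.subtype_mk (continuous_matrix ?_) _
  intro i j
  fin_cases i <;> fin_cases j <;> simp <;> fun_prop

theorem lorentz_rot (t : ℝ) (x : Mink) : lorentz (rot t) x =
    ![x 0, Real.cos t * x 1 + Real.sin t * x 3, x 2, Real.cos t * x 3 - Real.sin t * x 1] := by
  obtain ⟨u, rfl⟩ : ∃ u, t = 2 * u := ⟨t / 2, by ring⟩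
  have hd : (2 * u) / 2 = u := by ring
  have hsc := Real.sin_sq_add_cos_sq u
  rw [lorentz_apply, Real.cos_two_mul', Real.sin_two_mul]
  simp only [rot, hd]
  generalize Real.sin u = s at *
  generalize Real.cos u = c at *
  ext i
  fin_cases i <;> simp [ofHerm, toHerm, Matrix.mul_apply, Fin.sum_univ_two]
  · linear_combination x 0 * hsc
  · ring
  · linear_combination x 2 * hsc
  · ring

theorem stdFrame_act_rot (t : ℝ) : stdFrame.act (rot t) = stdFrame.rotate t := by
  apply Subtype.ext
  change (fun i => lorentz (rot t) (stdFrame.1 i)) = ![stdFrame.1 0,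
    Real.cos t • stdFrame.1 1 - Real.sin t • stdFrame.1 3, stdFrame.1 2,
    Real.sin t • stdFrame.1 1 + Real.cos t • stdFrame.1 3]
  simp only [lorentz_rot, stdFrame_val]
  ext i j
  fin_cases i <;> fin_cases j <;> simp

/-- Rotation about a frame's own vector commutes with the left action, so on `SL(2,ℂ)` it is right
multiplication. -/
theorem stdFrame_act_mul_rot (A : SL2) (t : ℝ) :
    stdFrame.act (A * rot t) = (stdFrame.act A).rotate t := by
  rw [HFrame.act_mul, stdFrame_act_rot, HFrame.rotate_act]

theorem rotate_pi_mem_inFrames {h : LineFieldHorosphere} {F : HFrame} (hF : F ∈ h.outFrames) :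
    F.rotate Real.pi ∈ h.inFrames := by
  have h1 : -(F.rotate Real.pi).1 1 = F.1 1 := by
    change -(Real.cos Real.pi • F.1 1 - Real.sin Real.pi • F.1 3) = F.1 1
    simp
  refine ⟨hF.1, ?_, hF.2.2⟩
  rw [h1]
  exact hF.2.1

theorem mem_outFrames_spinorFlag {A : SL2} {κ : Spinor} :
    stdFrame.act A ∈ (penner (spinorFlag κ)).outFrames
      ↔ spinorFlag (Spinor.act A Spinor.e) = spinorFlag κ := by
  rw [mem_outFrames_penner, toFlag_stdFrame_act]

theorem mem_outFrames_of_act_e {A : SL2} {κ : Spinor} (h : Spinor.act A Spinor.e = κ) :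
    stdFrame.act A ∈ (penner (spinorFlag κ)).outFrames :=
  mem_outFrames_spinorFlag.2 (by rw [h])

/-- An element of `SL(2,ℂ)` is determined by its first column and its image in hyperbolic
space. -/
theorem SL_ext {A B : SL2} (h : Spinor.act A Spinor.e = Spinor.act B Spinor.e)
    (h' : lorentz A (stdFrame.1 0) = lorentz B (stdFrame.1 0)) : A = B := by
  have h1 : Spinor.act (B⁻¹ * A) Spinor.e = Spinor.e := by
    rw [Spinor.act_mul, h, ← Spinor.act_mul, inv_mul_cancel, Spinor.act_one]
  have h2 : lorentz (B⁻¹ * A) (stdFrame.1 0) = stdFrame.1 0 := by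
    rw [lorentz_mul, h', lorentz_inv_lorentz]
  have h3 := eq_unip_of_act_e h1
  set z := (B⁻¹ * A).1 0 1
  rw [h3, lorentz_unip, stdFrame_zero] at h2
  have hz1 := congrFun h2 1
  have hz2 := congrFun h2 2
  simp at hz1 hz2
  have hz : z = 0 := Complex.ext hz1 hz2
  rw [hz, unip_zero] at h3
  exact (inv_mul_eq_one.1 h3).symm

/-- The element of `SL(2,ℂ)` with first column `κ` that maps the base point to `q`. -/
def horoSection (κ : Spinor) (q : Mink) : SL2 :=
  κ.toSL * unip ⟨lorentz κ.toSL⁻¹ q 1, lorentz κ.toSL⁻¹ q 2⟩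

theorem horoSection_act_e (κ : Spinor) (q : Mink) :
    Spinor.act (horoSection κ q) Spinor.e = κ := by
  rw [horoSection, Spinor.act_mul, unip_act_e, Spinor.toSL_act_e]

theorem lorentz_toSL_phi_e (κ : Spinor) : lorentz κ.toSL (phi Spinor.e.1) = phi κ.1 := by
  rw [lorentz_phi]
  exact congrArg phi (congrArg Subtype.val κ.toSL_act_e)

theorem lorentz_horoSection (κ : Spinor) {q : Mink} (hq : q ∈ horo (phi κ.1)) :
    lorentz (horoSection κ q) (stdFrame.1 0) = q := by
  have h1 : lorentz κ.toSL⁻¹ q ∈ horo (phi Spinor.e.1) := by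
    rw [← lorentz_toSL_phi_e, ← image_horo] at hq
    exact lorentz_inv_mem hq
  rw [horoSection, lorentz_mul, lorentz_unip_stdFrame h1.1 h1.2, lorentz_lorentz_inv]

theorem continuous_horoSection (κ : Spinor) : Continuous (horoSection κ) := by
  have hL : Continuous (lorentz κ.toSL⁻¹) := LinearMap.continuous_of_finiteDimensional _
  have hz : Continuous fun q => (⟨lorentz κ.toSL⁻¹ q 1, lorentz κ.toSL⁻¹ q 2⟩ : ℂ) :=
    Complex.equivRealProdCLM.symm.continuous.comp
      (((continuous_apply 1).comp hL).prodMk ((continuous_apply 2).comp hL))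
  exact continuous_const.mul (continuous_unip.comp hz)

theorem lorentz_mem_horo {A : SL2} {κ : Spinor} (h : Spinor.act A Spinor.e = κ) :
    lorentz A (stdFrame.1 0) ∈ horo (phi κ.1) := by
  have : phi κ.1 = lorentz A (phi Spinor.e.1) := by rw [← h, lorentz_phi]; rfl
  rw [this, ← image_horo]
  exact ⟨_, stdFrame_mem_horo, rfl⟩

theorem preconnectedSpace_horo (κ : Spinor) : PreconnectedSpace (horo (phi κ.1)) := by
  have h (z : ℂ) : Spinor.act (κ.toSL * unip z) Spinor.e = κ := by
    rw [Spinor.act_mul, unip_act_e, Spinor.toSL_act_e]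
  refine (Function.Surjective.connectedSpace (α := ℂ)
    (f := fun z => ⟨lorentz (κ.toSL * unip z) (stdFrame.1 0), lorentz_mem_horo (h z)⟩) ?_ ?_).toPreconnectedSpace
  · intro q
    exact ⟨_, Subtype.ext (lorentz_horoSection κ q.2)⟩
  · exact Continuous.subtype_mk ((continuous_lorentz _).comp
      (continuous_const.mul continuous_unip)) _

/-! ### Spin-decorated horospheres -/

section

variable {E : Type u} [TopologicalSpace E] {π : E → HFrame}

theorem SpinHorosphere.eq_of_eq {h h' : SpinHorosphere π}
    (h₁ : h.toLineFieldHorosphere = h'.toLineFieldHorosphere) (h₂ : h.Win = h'.Win)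
    (h₃ : h.Wout = h'.Wout) : h = h' := by
  obtain ⟨L, _, _, _, _, _, _⟩ := h
  obtain ⟨L', _, _, _, _, _, _⟩ := h'
  obtain rfl : L = L' := h₁
  subst h₂ h₃
  rfl

variable (g : SL2 ≃ₜ E) (hg : ∀ A, π (g A) = stdFrame.act A)

/-- The spin-decorated horosphere of a spinor, for an isomorphism `g` of `SL(2,ℂ)` with the bundle
of spin frames. -/
def spinHorosphere (κ : Spinor) : SpinHorosphere π where
  toLineFieldHorosphere := penner (spinorFlag κ)
  parallel := penner_isParallel _
  Win := (fun A => g (A * rot Real.pi)) '' {A | Spinor.act A Spinor.e = κ}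
  Wout := g '' {A | Spinor.act A Spinor.e = κ}
  in_lift := by
    refine ⟨fun q => g (horoSection κ q.1 * rot Real.pi), ?_, fun q => ?_, ?_⟩
    · exact g.continuous.comp (((continuous_horoSection κ).comp continuous_subtype_val).mul
        continuous_const)
    · rw [hg, stdFrame_act_mul_rot]
      exact ⟨rotate_pi_mem_inFrames (mem_outFrames_of_act_e (horoSection_act_e κ q.1)),
        lorentz_horoSection κ q.2⟩
    · ext w
      constructor
      · rintro ⟨A, hA, rfl⟩
        refine ⟨⟨lorentz A (stdFrame.1 0), lorentz_mem_horo hA⟩, ?_⟩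
        simp only
        rw [SL_ext ((horoSection_act_e κ _).trans hA.symm)
          (lorentz_horoSection κ (lorentz_mem_horo hA))]
      · rintro ⟨q, rfl⟩
        exact ⟨_, horoSection_act_e κ q.1, rfl⟩
  out_lift := by
    refine ⟨fun q => g (horoSection κ q.1), ?_, fun q => ?_, ?_⟩
    · exact g.continuous.comp ((continuous_horoSection κ).comp continuous_subtype_val)
    · rw [hg]
      exact ⟨mem_outFrames_of_act_e (horoSection_act_e κ q.1), lorentz_horoSection κ q.2⟩
    · ext w
      constructor
      · rintro ⟨A, hA, rfl⟩
        refine ⟨⟨lorentz A (stdFrame.1 0), lorentz_mem_horo hA⟩, ?_⟩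
        simp only
        rw [SL_ext ((horoSection_act_e κ _).trans hA.symm)
          (lorentz_horoSection κ (lorentz_mem_horo hA))]
      · rintro ⟨q, rfl⟩
        exact ⟨_, horoSection_act_e κ q.1, rfl⟩
  assoc := by
    rintro _ ⟨A, hA, rfl⟩
    refine ⟨_, ⟨A, hA, rfl⟩, fun t => g (A * rot t), ?_, ?_, rfl, fun t => ?_⟩
    · exact g.continuous.comp (continuous_const.mul continuous_rot)
    · simp [rot_zero]
    · rw [hg, hg, stdFrame_act_mul_rot]

theorem spinHorosphere_injective : Function.Injective (spinHorosphere g hg) := by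
  intro κ κ' h
  have h1 : g κ.toSL ∈ (spinHorosphere g hg κ).Wout := ⟨_, κ.toSL_act_e, rfl⟩
  rw [h] at h1
  obtain ⟨A, hA, hA'⟩ := h1
  rw [g.injective hA'] at hA
  exact κ.toSL_act_e.symm.trans hA

/-- The path `t ↦ g (A * rot t)` lifts the rotating frame, and lifts of paths are unique. -/
theorem spinRotation_iff (g : SL2 ≃ₜ E) (hg : ∀ A, π (g A) = stdFrame.act A)
    (hπ : IsCoveringMap π) (A : SL2) (t : ℝ) (w : E) :
    SpinRotation π t (g A) w ↔ w = g (A * rot t) := by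
  have hc : Continuous fun t => g (A * rot t) :=
    g.continuous.comp (continuous_const.mul continuous_rot)
  constructor
  · rintro ⟨γ, hγ, h0, rfl, h⟩
    refine congrFun (hπ.eq_of_comp_eq hγ hc (funext fun s => ?_) 0 ?_) t
    · simp only [Function.comp_apply]
      rw [h, hg, hg, stdFrame_act_mul_rot]
    · rw [h0, rot_zero, mul_one]
  · rintro rfl
    refine ⟨_, hc, by rw [rot_zero, mul_one], rfl, fun s => ?_⟩
    rw [hg, hg, stdFrame_act_mul_rot]

/-- Along the outward lift `s`, the spinor `(g⁻¹ s(q)) e` stays in the two-point fibre over one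
flag, hence is a constant `κ` on the connected horosphere. So `Wout` is the full coset of `κ`, and
the rotation condition determines `Win`. -/
theorem spinHorosphere_surjective (hπ : IsCoveringMap π) :
    Function.Surjective (spinHorosphere g hg) := by
  rintro ⟨L, par, Win, Wout, hin, ⟨s, hs, hs', rfl⟩, hassoc⟩
  obtain ⟨f, rfl⟩ := exists_penner_eq par
  obtain ⟨κ', rfl⟩ := spinorFlag_surjective f
  have hs'' (q) : spinorFlag (Spinor.act (g.symm (s q)) Spinor.e) = spinorFlag κ' ∧
      lorentz (g.symm (s q)) (stdFrame.1 0) = q.1 := by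
    have h1 : π (s q) = stdFrame.act (g.symm (s q)) := by rw [← hg, g.apply_symm_apply]
    have h2 := hs' q
    rw [h1] at h2
    exact ⟨mem_outFrames_spinorFlag.1 h2.1, h2.2⟩
  have : PreconnectedSpace (penner (spinorFlag κ')).carrier := preconnectedSpace_horo κ'
  let q₀ : (penner (spinorFlag κ')).carrier := ⟨_, lorentz_mem_horo κ'.toSL_act_e⟩
  let κ := Spinor.act (g.symm (s q₀)) Spinor.e
  have hκ (q) : Spinor.act (g.symm (s q)) Spinor.e = κ :=
    signQuotient_spinorFlag.isCoveringMap.const_of_comp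
      (Spinor.continuous_act_e.comp (g.symm.continuous.comp hs))
      (fun q q' => (hs'' q).1.trans (hs'' q').1.symm) q q₀
  have hflag : spinorFlag κ = spinorFlag κ' := (hs'' q₀).1
  have hphi : phi κ.1 = phi κ'.1 := congrArg NullFlag.pt hflag
  have hmem {A : SL2} (hA : Spinor.act A Spinor.e = κ) :
      lorentz A (stdFrame.1 0) ∈ horo (phi κ'.1) := by
    rw [← hphi]
    exact lorentz_mem_horo hA
  have hout : g '' {A | Spinor.act A Spinor.e = κ} = Set.range s := by
    ext w
    constructor
    · rintro ⟨A, hA, rfl⟩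
      refine ⟨⟨_, hmem hA⟩, ?_⟩
      exact g.symm_apply_eq.1 (SL_ext ((hκ ⟨_, hmem hA⟩).trans hA.symm) (hs'' ⟨_, hmem hA⟩).2)
    · rintro ⟨q, rfl⟩
      exact ⟨g.symm (s q), hκ q, g.apply_symm_apply _⟩
  refine ⟨κ, SpinHorosphere.eq_of_eq (congrArg penner hflag) ?_ hout⟩
  change (fun A => g (A * rot Real.pi)) '' {A | Spinor.act A Spinor.e = κ} = Win
  have hsub : (fun A => g (A * rot Real.pi)) '' {A | Spinor.act A Spinor.e = κ} ⊆ Win := by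
    rintro _ ⟨A, hA, rfl⟩
    obtain ⟨w, hw, hrot⟩ := hassoc (g A) (by rw [← hout]; exact ⟨A, hA, rfl⟩)
    rw [spinRotation_iff g hg hπ] at hrot
    rwa [hrot] at hw
  -- For the other inclusion: `Win` contains exactly one spin frame over each point of the
  -- horosphere, and the rotated coset already provides one.
  refine hsub.antisymm ?_
  obtain ⟨s', -, hs₁, rfl⟩ := hin
  rintro _ ⟨q, rfl⟩
  obtain ⟨q₁, hq₁⟩ := hsub ⟨_, hκ q, rfl⟩
  have hq : q₁ = q := by
    apply Subtype.ext
    have h1 := (hs₁ q₁).2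
    rw [hq₁, hg, stdFrame_act_mul_rot] at h1
    rw [← h1]
    exact (hs'' q).2
  rw [← hq, hq₁]
  exact ⟨_, hκ q, rfl⟩

theorem spinHorosphere_act (a : LiftedAction π HFrame.act)
    (ha : ∀ A B, a.smul A (g B) = g (A * B)) (A : SL2) (κ : Spinor) :
    (spinHorosphere g hg κ).act a A = spinHorosphere g hg (Spinor.act A κ) := by
  have himage (R : SL2) : a.smul A '' ((fun B => g (B * R)) '' {B | Spinor.act B Spinor.e = κ})
      = (fun B => g (B * R)) '' {B | Spinor.act B Spinor.e = Spinor.act A κ} := by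
    ext w
    constructor
    · rintro ⟨_, ⟨B, hB, rfl⟩, rfl⟩
      refine ⟨A * B, ?_, ?_⟩
      · change Spinor.act (A * B) Spinor.e = _
        rw [Spinor.act_mul, hB]
      · simp only
        rw [ha, mul_assoc]
    · rintro ⟨B, hB, rfl⟩
      refine ⟨_, ⟨A⁻¹ * B, ?_, rfl⟩, ?_⟩
      · change Spinor.act (A⁻¹ * B) Spinor.e = _
        rw [Spinor.act_mul, hB, ← Spinor.act_mul, inv_mul_cancel, Spinor.act_one]
      · simp only
        rw [ha, ← mul_assoc, mul_inv_cancel_left]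
  refine SpinHorosphere.eq_of_eq ?_ (himage _) ?_
  · change (penner (spinorFlag κ)).act A = penner (spinorFlag (Spinor.act A κ))
    rw [spinorFlag_act, penner_act]
  · have h1 := himage 1
    simp only [mul_one] at h1
    exact h1

/-- The correspondence between spinors and spin-decorated horospheres. -/
def spinHorosphereEquiv (hπ : IsCoveringMap π) : Spinor ≃ SpinHorosphere π :=
  Equiv.ofBijective (spinHorosphere g hg)
    ⟨spinHorosphere_injective g hg, spinHorosphere_surjective g hg hπ⟩

instance : TopologicalSpace (MarkedSpinHorosphere π) := .induced (fun x => x.1.1) inferInstance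

theorem continuous_markedSpinHorosphere_snd :
    Continuous fun x : MarkedSpinHorosphere π => x.1.2 := continuous_coinduced_rng

/-- The spin-decorated horosphere of a spinor, marked by a spin frame. -/
def markedSpinHorosphere (κ : Spinor) : MarkedSpinHorosphere π :=
  ⟨(g κ.toSL, spinHorosphere g hg κ), ⟨_, κ.toSL_act_e, rfl⟩⟩

/-- With this formula the inverse is continuous and smooth, because it is so in terms of an outward
spin frame. -/
theorem spinHorosphereEquiv_symm (hπ : IsCoveringMap π) (x : MarkedSpinHorosphere π) :
    (spinHorosphereEquiv g hg hπ).symm x.1.2 = Spinor.act (g.symm x.1.1) Spinor.e := by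
  obtain ⟨⟨w, h⟩, hx⟩ := x
  obtain ⟨κ, rfl⟩ := (spinHorosphereEquiv g hg hπ).surjective h
  obtain ⟨A, hA, hw⟩ := hx
  change g A = w at hw
  subst hw
  simp only
  rw [g.symm_apply_apply]
  exact ((spinHorosphereEquiv g hg hπ).symm_apply_apply κ).trans hA.symm

/-- The correspondence between spinors and spin-decorated horospheres is a homeomorphism. -/
def spinHorosphereHomeomorph (hπ : IsCoveringMap π) : Spinor ≃ₜ SpinHorosphere π where
  toEquiv := spinHorosphereEquiv g hg hπ
  continuous_toFun := by
    have h1 : Continuous (markedSpinHorosphere g hg) :=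
      continuous_induced_rng.2 (g.continuous.comp Spinor.continuous_toSL)
    exact continuous_markedSpinHorosphere_snd.comp h1
  continuous_invFun := by
    refine continuous_coinduced_dom.2 ?_
    have h1 : ((spinHorosphereEquiv g hg hπ).symm ∘ fun x : MarkedSpinHorosphere π => x.1.2)
        = fun x => Spinor.act (g.symm x.1.1) Spinor.e :=
      funext (spinHorosphereEquiv_symm g hg hπ)
    change Continuous ((spinHorosphereEquiv g hg hπ).symm ∘
      fun x : MarkedSpinHorosphere π => x.1.2)
    rw [h1]
    exact Spinor.continuous_act_e.comp (g.symm.continuous.comp continuous_induced_dom)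

/-- Spin-decorated horospheres are a connected double cover of decorated horospheres. -/
theorem isConnectedDoubleCover_forget (g : SL2 ≃ₜ E) (hg : ∀ A, π (g A) = stdFrame.act A)
    (hπ : IsCoveringMap π) : IsConnectedDoubleCover
      (SpinHorosphere.forget : SpinHorosphere π → DecoratedHorosphere) :=
  signQuotient_spinorFlag.isConnectedDoubleCover.of_homeomorph
    (spinHorosphereHomeomorph g hg hπ) pennerHomeomorph fun _ => rfl

/-! ### Smoothness -/

/-- In one direction, `κ.toSL` is a smooth choice of outward spin frame. In the other, a smooth
family of outward frames has smooth matrix products, so its continuous lift to `SL(2,ℂ)` is smooth,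
and `κ` is the first column of this lift. -/
theorem isDiffeo_spinHorosphereEquiv (hπ : IsCoveringMap π) :
    IsDiffeo spinorDiffeology (spinHorosphereDiffeology π) (spinHorosphereEquiv g hg hπ) := by
  constructor
  · intro n c hc
    have hc' : ContDiff ℝ (⊤ : ℕ∞) fun x => (c x).1 := hc
    have hcc : Continuous c := hc'.continuous.subtype_mk _
    have hci (i : Fin 2) : ContDiff ℝ (⊤ : ℕ∞) fun x => (c x).1 i := contDiff_pi.1 hc' i
    have hcs (i : Fin 2) : ContDiff ℝ (⊤ : ℕ∞) fun x => star ((c x).1 i) :=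
      Complex.conjCLE.contDiff.comp (hci i)
    refine DiffeologicalSpace.isPlot_generatedFrom_of_mem
      ⟨markedSpinHorosphere g hg ∘ c, ⟨?_, ?_⟩, rfl⟩
    · exact g.continuous.comp (Spinor.continuous_toSL.comp hcc)
    · change ContDiff ℝ (⊤ : ℕ∞) fun x => (π (g (c x).toSL)).1
      simp_rw [hg]
      rw [contDiff_pi]
      intro k
      refine contDiff_lorentz (fun i j => ?_) _
      have hd := ((hci 0).mul (hcs 0)).add ((hci 1).mul (hcs 1))
      have hd' := hd.inv fun x => (c x).normSq_ne_zero
      fin_cases i <;> fin_cases j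
      · exact hci 0
      · simpa only [div_eq_mul_inv] using! (hcs 1).neg.mul hd'
      · exact hci 1
      · simpa only [div_eq_mul_inv] using! (hcs 0).mul hd'
  -- For a map out of a quotient smooth structure, it is enough to test the generating families.
  · have hle : spinHorosphereDiffeology π
        ≤ inducedDiffeology spinorDiffeology (spinHorosphereEquiv g hg hπ).symm := by
      refine DiffeologicalSpace.generateFrom_le_iff.2 ?_
      rintro n p ⟨(q : EuclideanSpace ℝ (Fin n) → MarkedSpinHorosphere π), ⟨hq, hq'⟩, hp⟩
      change p = (fun x : MarkedSpinHorosphere π => x.1.2) ∘ q at hp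
      rw [hp]
      change ContDiff ℝ (⊤ : ℕ∞) fun x => ((spinHorosphereEquiv g hg hπ).symm (q x).1.2).1
      have hq1 : Continuous fun x => g.symm (q x).1.1 := g.symm.continuous.comp hq
      have hq2 : ContDiff ℝ (⊤ : ℕ∞) fun x => (π (q x).1.1).1 := hq'
      have hq3 (x) : π (q x).1.1 = stdFrame.act (g.symm (q x).1.1) := by
        rw [← hg, g.apply_symm_apply]
      have hsm := contDiff_of_mul (n := (⊤ : ℕ∞))
        (signQuotient_stdFrame_act.isInducing.continuous.comp hq1)
        (fun x => signQuotient_stdFrame_act.ne_zero _) (fun i j => by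
          have h1 := contDiff_frameProducts (n := (⊤ : ℕ∞)).comp hq2
          have h2 := contDiff_pi.1 (contDiff_pi.1 h1 i) j
          convert h2 using 2 with x
          simp only [Function.comp_apply]
          rw [hq3, frameProducts_act])
      simp_rw [spinHorosphereEquiv_symm, Spinor.act_e]
      rw [contDiff_pi]
      intro i
      exact contDiff_pi.1 hsm (i, 0)
    exact fun n p hp => DiffeologicalSpace.le_iff'.1 hle n p hp

/-- Forwards, `(phi κ, dphi κ)` is a smooth representative of the flag. Backwards, `flagProducts` is
smooth on flags, so the continuous spinor with these products is smooth. -/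
theorem isDiffeo_of_lift_spinorFlag {FS : Type*} [TopologicalSpace FS] {ρ : FS → NullFlag}
    (k : Spinor ≃ₜ FS) (hk : ∀ κ, ρ (k κ) = spinorFlag κ) :
    IsDiffeo spinorDiffeology (coverDiffeology flagDiffeology ρ) k.toEquiv := by
  constructor
  · intro n c hc
    have hc' : ContDiff ℝ (⊤ : ℕ∞) fun x => (c x).1 := hc
    have hcc : Continuous c := hc'.continuous.subtype_mk _
    refine ⟨k.continuous.comp hcc, ?_⟩
    refine DiffeologicalSpace.isPlot_generatedFrom_of_mem
      ⟨fun x => ⟨(phi (c x).1, dphi (c x).1), phi_pair (c x)⟩, ?_, ?_⟩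
    · exact (contDiff_phi.comp hc').prodMk (contDiff_dphi.comp hc')
    · exact funext fun x => hk (c x)
  · rintro n p ⟨hp, hp'⟩
    have hle : flagDiffeology ≤ inducedDiffeology
        (NormedSpace.toDiffeology (Fin 2 → Fin 2 → ℂ)) flagProducts := by
      refine DiffeologicalSpace.generateFrom_le_iff.2 ?_
      rintro n p ⟨(q : EuclideanSpace ℝ (Fin n) → FlagPair), hq, hp⟩
      change p = flagOf ∘ q at hp
      rw [hp]
      have hq' : ContDiff ℝ (⊤ : ℕ∞) fun x => (q x).1 := hq
      change ContDiff ℝ (⊤ : ℕ∞) fun x => flagProducts (flagOf (q x))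
      simp_rw [flagProducts_flagOf]
      rw [contDiff_iff_contDiffAt]
      intro x
      exact (contDiffAt_bivectorProducts (q x).mink_neg).comp x hq'.contDiffAt
    have h1 : ContDiff ℝ (⊤ : ℕ∞) fun x => flagProducts (ρ (p x)) :=
      DiffeologicalSpace.le_iff'.1 hle n (ρ ∘ p) hp'
    change ContDiff ℝ (⊤ : ℕ∞) fun x => (k.symm (p x)).1
    refine contDiff_of_mul (continuous_subtype_val.comp (k.symm.continuous.comp hp))
      (fun x => (k.symm (p x)).2) fun i j => ?_
    convert contDiff_pi.1 (contDiff_pi.1 h1 i) j using 2 with x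
    rw [← signQuotient_spinorFlag.products, ← hk, k.apply_symm_apply]

end

theorem IsDiffeo.symm {X Y : Type*} {dX : DiffeologicalSpace X} {dY : DiffeologicalSpace Y}
    {e : X ≃ Y} (h : IsDiffeo dX dY e) : IsDiffeo dY dX e.symm := ⟨h.2, h.1⟩

theorem IsDiffeo.trans {X Y Z : Type*} {dX : DiffeologicalSpace X} {dY : DiffeologicalSpace Y}
    {dZ : DiffeologicalSpace Z} {e : X ≃ Y} {e' : Y ≃ Z} (h : IsDiffeo dX dY e)
    (h' : IsDiffeo dY dZ e') : IsDiffeo dX dZ (e.trans e') :=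
  ⟨fun n p hp => h'.1 n _ (h.1 n p hp), fun n p hp => h.2 n _ (h'.2 n p hp)⟩

/-! ### Lifts through base points -/

/-- Negation, as a homeomorphism. -/
def SignQuotient.negHomeomorph {S ι X : Type*} [TopologicalSpace S] [TopologicalSpace X]
    {v : S → ι → ℂ} {neg : S → S} {f : S → X} {Q : X → ι → ι → ℂ} (h : SignQuotient v neg f Q) :
    S ≃ₜ S where
  toFun := neg
  invFun := neg
  left_inv := h.neg_neg
  right_inv := h.neg_neg
  continuous_toFun := h.continuous_neg
  continuous_invFun := h.continuous_neg

section

variable {E : Type*} [TopologicalSpace E]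

/-- The frame bundle has `SL(2,ℂ)` as its spin frame bundle. -/
theorem exists_homeomorph_SL {π : E → HFrame} (hπ : IsConnectedDoubleCover π) :
    ∃ g : SL2 ≃ₜ E, ∀ A, π (g A) = stdFrame.act A := by
  obtain ⟨g, hg, hgf⟩ := exists_lift_SL hπ.1 hπ.surjective continuous_stdFrame_act
  exact ⟨(signQuotient_stdFrame_act.isHomeomorph_lift hπ hg hgf).homeomorph, congrFun hgf⟩

/-- The space of flags has the nonzero spinors as its space of spin flags. -/
theorem exists_homeomorph_spinor {π : E → NullFlag} (hπ : IsConnectedDoubleCover π) :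
    ∃ k : Spinor ≃ₜ E, ∀ κ, π (k κ) = spinorFlag κ := by
  obtain ⟨k, hk, hkf⟩ := exists_lift_spinor hπ.1 hπ.surjective continuous_spinorFlag
  exact ⟨(signQuotient_spinorFlag.isHomeomorph_lift hπ hk hkf).homeomorph, congrFun hkf⟩

/-- An equivariant isomorphism of the nonzero spinors with spin flags can be adjusted by a sign so
that it maps a given spinor to a given spin flag. -/
theorem exists_homeomorph_spinor_eq {π : E → NullFlag} (k : Spinor ≃ₜ E)
    (hk : ∀ κ, π (k κ) = spinorFlag κ) (b : LiftedAction π NullFlag.act)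
    (hb : ∀ A κ, b.smul A (k κ) = k (Spinor.act A κ)) {κ₀ : Spinor} {f₀ : E}
    (h₀ : π f₀ = spinorFlag κ₀) :
    ∃ k' : Spinor ≃ₜ E, (∀ κ, π (k' κ) = spinorFlag κ) ∧
      (∀ A κ, b.smul A (k' κ) = k' (Spinor.act A κ)) ∧ k' κ₀ = f₀ := by
  have h : spinorFlag (k.symm f₀) = spinorFlag κ₀ := by rw [← hk, k.apply_symm_apply, h₀]
  rcases signQuotient_spinorFlag.eq_or_eq_neg h with h | h
  · exact ⟨k, hk, hb, by rw [← h, k.apply_symm_apply]⟩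
  · refine ⟨signQuotient_spinorFlag.negHomeomorph.trans k, fun κ => ?_, fun A κ => ?_, ?_⟩
    · exact (hk _).trans (spinorFlag_neg κ)
    · change b.smul A (k κ.neg) = k (Spinor.act A κ).neg
      rw [hb, Spinor.act_neg]
    · change k κ₀.neg = f₀
      rw [← h, k.apply_symm_apply]

/-- An equivariant isomorphism of `SL(2,ℂ)` with spin frames can be adjusted by a sign so that a
given spinor has a given spin-decorated horosphere. -/
theorem exists_spinHorosphere_eq {π : E → HFrame} (hπ : IsCoveringMap π) (g : SL2 ≃ₜ E)
    (hg : ∀ A, π (g A) = stdFrame.act A) (a : LiftedAction π HFrame.act)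
    (ha : ∀ A B, a.smul A (g B) = g (A * B)) {κ₀ : Spinor} {h₀ : SpinHorosphere π}
    (h : h₀.toLineFieldHorosphere = penner (spinorFlag κ₀)) :
    ∃ (g' : SL2 ≃ₜ E) (hg' : ∀ A, π (g' A) = stdFrame.act A),
      (∀ A B, a.smul A (g' B) = g' (A * B)) ∧ spinHorosphere g' hg' κ₀ = h₀ := by
  obtain ⟨κ, rfl⟩ := spinHorosphere_surjective g hg hπ h₀
  rcases signQuotient_spinorFlag.eq_or_eq_neg (penner_injective h) with rfl | rfl
  · exact ⟨g, hg, ha, rfl⟩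
  -- The coset of `-κ₀` is the negative of the coset of `κ₀`, so composing `g` with negation
  -- replaces the horosphere of `κ₀` by that of `-κ₀`.
  · have himage (R : SL2) : (fun A => g (-(A * R))) '' {A | Spinor.act A Spinor.e = κ₀}
        = (fun A => g (A * R)) '' {A | Spinor.act A Spinor.e = κ₀.neg} := by
      ext w
      constructor
      · rintro ⟨A, hA, rfl⟩
        refine ⟨-A, ?_, by simp only [neg_mul]⟩
        change Spinor.act (-A) Spinor.e = _
        rw [Spinor.neg_act, hA]
      · rintro ⟨A, hA, rfl⟩
        refine ⟨-A, ?_, by simp only [neg_mul, neg_neg]⟩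
        change Spinor.act (-A) Spinor.e = _
        rw [Spinor.neg_act, hA]
        exact signQuotient_spinorFlag.neg_neg κ₀
    refine ⟨signQuotient_stdFrame_act.negHomeomorph.trans g,
      fun A => (hg _).trans (signQuotient_stdFrame_act.map_neg A), fun A B => ?_,
      SpinHorosphere.eq_of_eq (congrArg penner (spinorFlag_neg κ₀).symm) (himage _) ?_⟩
    · change a.smul A (g (-B)) = g (-(A * B))
      rw [ha, mul_neg]
    · have h1 := himage 1
      simp only [mul_one] at h1
      exact h1

end

end SpinHor
end

/-! ### The correspondence theorem -/

theorem theorem1 :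
    -- Double covers of the frame bundle and of the space of flags exist.
    (∃ (E : Type) (_ : TopologicalSpace E) (π : E → HFrame), IsConnectedDoubleCover π) ∧
    (∃ (E : Type) (_ : TopologicalSpace E) (π : E → NullFlag), IsConnectedDoubleCover π) ∧
    -- Penner's construction sends flags to decorated horospheres.
    (∀ f : NullFlag, (penner f).IsParallel) ∧
    -- Let `FrS` be the bundle of spin frames and `FS` the space of spin flags.
    ∀ (FrS : Type*) [TopologicalSpace FrS] (πFr : FrS → HFrame) (_ : IsConnectedDoubleCover πFr)
      (FS : Type*) [TopologicalSpace FS] (πF : FS → NullFlag) (_ : IsConnectedDoubleCover πF),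
      -- Spin-decorated horospheres form a double cover of decorated horospheres.
      IsConnectedDoubleCover
        (SpinHorosphere.forget : SpinHorosphere πFr → DecoratedHorosphere) ∧
      -- The actions of `SL(2,ℂ)` on frames and flags lift uniquely to spin frames and spin flags.
      ∃ (a : LiftedAction πFr HFrame.act) (b : LiftedAction πF NullFlag.act),
        (∀ a', a' = a) ∧ (∀ b', b' = b) ∧
        -- For every choice of base points there are unique lifts `Φ.1 : ℂ²∖0 ≃ FS` of `Φ₁` and
        -- `Φ.2 : FS ≃ SpinHorosphere` of `Φ₂` that are equivariant diffeomorphisms.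
        ∀ (κ₀ : Spinor) (f₀ : FS) (h₀ : SpinHorosphere πFr),
          πF f₀ = spinorFlag κ₀ →
          h₀.toLineFieldHorosphere = penner (spinorFlag κ₀) →
          ∃! Φ : (Spinor ≃ FS) × (FS ≃ SpinHorosphere πFr),
            Φ.1 κ₀ = f₀ ∧ Φ.2 f₀ = h₀ ∧
            (∀ κ, πF (Φ.1 κ) = spinorFlag κ) ∧
            (∀ f, (Φ.2 f).toLineFieldHorosphere = penner (πF f)) ∧
            (∀ A κ, Φ.1 (Spinor.act A κ) = b.smul A (Φ.1 κ)) ∧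
            (∀ A f, Φ.2 (b.smul A f) = (Φ.2 f).act a A) ∧
            (∀ A κ, (Φ.1.trans Φ.2) (Spinor.act A κ) = ((Φ.1.trans Φ.2) κ).act a A) ∧
            IsDiffeo spinorDiffeology (coverDiffeology flagDiffeology πF) Φ.1 ∧
            IsDiffeo (coverDiffeology flagDiffeology πF) (spinHorosphereDiffeology πFr) Φ.2 ∧
            IsDiffeo spinorDiffeology (spinHorosphereDiffeology πFr) (Φ.1.trans Φ.2) := by
  refine ⟨⟨SL2, _, _, signQuotient_stdFrame_act.isConnectedDoubleCover⟩,
    ⟨Spinor, _, _, signQuotient_spinorFlag.isConnectedDoubleCover⟩, penner_isParallel, ?_⟩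
  intro FrS _ πFr hFr FS _ πF hF
  obtain ⟨g, hg⟩ := exists_homeomorph_SL hFr
  obtain ⟨k, hk⟩ := exists_homeomorph_spinor hF
  have := hFr.2.2
  have := hF.2.2
  -- The actions are left multiplication on `SL(2,ℂ)` and the linear action on spinors, carried over
  -- by `g` and `k`.
  let a : LiftedAction πFr HFrame.act := .ofHomeomorph g (fun A B => A * B) one_mul mul_assoc
    continuous_mul fun A B => by rw [hg, hg, HFrame.act_mul]
  let b : LiftedAction πF NullFlag.act := .ofHomeomorph k Spinor.act Spinor.act_one Spinor.act_mul
    Spinor.continuous_act fun A κ => by rw [hk, hk, spinorFlag_act]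
  have ha (A B) : a.smul A (g B) = g (A * B) := congrArg (fun C => g (A * C)) (g.symm_apply_apply B)
  have hb (A κ) : b.smul A (k κ) = k (Spinor.act A κ) :=
    congrArg (fun κ => k (Spinor.act A κ)) (k.symm_apply_apply κ)
  refine ⟨isConnectedDoubleCover_forget g hg hFr.1, a, b,
    fun a' => LiftedAction.eq_of_connectedSpace hFr.1 a' a,
    fun b' => LiftedAction.eq_of_connectedSpace hF.1 b' b, ?_⟩
  intro κ₀ f₀ h₀ hf₀ hh₀
  -- The identifications are replaced by their sign-adjusted versions, which meet the base points;
  -- the actions `a` and `b` remain as they are.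
  obtain ⟨k, hk, hb, rfl⟩ := exists_homeomorph_spinor_eq k hk b hb hf₀
  obtain ⟨g, hg, ha, rfl⟩ := exists_spinHorosphere_eq hFr.1 g hg a ha hh₀
  have hk' := isDiffeo_of_lift_spinorFlag k hk
  have hg' := isDiffeo_spinHorosphereEquiv g hg hFr.1
  have htrans : k.toEquiv.trans (k.toEquiv.symm.trans (spinHorosphereEquiv g hg hFr.1))
      = spinHorosphereEquiv g hg hFr.1 := by
    rw [← Equiv.trans_assoc, Equiv.self_trans_symm, Equiv.refl_trans]
  have hE (A κ) : spinHorosphereEquiv g hg hFr.1 (Spinor.act A κ)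
      = (spinHorosphereEquiv g hg hFr.1 κ).act a A := (spinHorosphere_act g hg a ha A κ).symm
  refine ⟨(k.toEquiv, k.toEquiv.symm.trans (spinHorosphereEquiv g hg hFr.1)),
    ⟨rfl, ?_, hk, fun f => ?_, fun A κ => (hb A κ).symm, fun A f => ?_, ?_, hk',
      hk'.symm.trans hg', ?_⟩, ?_⟩
  · exact congrArg (spinHorosphere g hg) (k.symm_apply_apply κ₀)
  · change penner (spinorFlag (k.symm f)) = _
    rw [← hk, k.apply_symm_apply]
  · obtain ⟨κ, rfl⟩ := k.surjective f
    rw [hb]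
    change spinHorosphereEquiv g hg hFr.1 (k.symm (k _))
      = (spinHorosphereEquiv g hg hFr.1 (k.symm (k κ))).act a A
    rw [k.symm_apply_apply, k.symm_apply_apply, hE]
  · rw [htrans]
    exact hE
  · rw [htrans]
    exact hg'
  -- Uniqueness uses only equivariance and the base points, since every spinor is `A κ₀` for some
  -- `A`.
  · rintro ⟨Φ₁, Φ₂⟩ ⟨h1, h2, -, -, h3, h4, -⟩
    have e1 : Φ₁ = k.toEquiv := by
      ext κ
      obtain ⟨A, rfl⟩ := Spinor.exists_act_eq κ₀ κ
      exact (h3 A κ₀).trans ((congrArg (b.smul A) h1).trans (hb A κ₀))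
    refine Prod.ext e1 (Equiv.ext fun f => ?_)
    obtain ⟨κ, rfl⟩ := k.surjective f
    obtain ⟨A, rfl⟩ := Spinor.exists_act_eq κ₀ κ
    change Φ₂ (k _) = spinHorosphereEquiv g hg hFr.1 (k.symm (k _))
    rw [k.symm_apply_apply, hE, ← hb]
    exact (h4 A (k κ₀)).trans (congrArg (SpinHorosphere.act a A) h2)
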